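/- Let $n\ge 1$, $0<\alpha<2n$, and let $p_1,p_2,q$ be real numbers with $p_1,p_2>1$, $q\ge p_1$, $q\ge p_2$ and $p_1+p_2\ge p_1p_2$. Write $r'=r/(r-1)$ for $r>1$. For positive locally finite Borel measures $\mu,\nu$ on $\mathbb R^n$ put $$I_\alpha(f_1\mu,f_2\nu)(x)=\int_{\mathbb R^{2n}}\frac{f_1(y_1)f_2(y_2)}{(|x-y_1|+|x-y_2|)^{2n-\alpha}}\,d\mu(y_1)\,d\nu(y_2),$$ where the kernel is $+\infty$ at $x=y_1=y_2$. There is a constant $C\in(0,\infty)$ depending only on $n,\alpha,p_1,p_2,q$ such that the following holds for all positive locally finite Borel measures $\sigma_1,\sigma_2,w$ on $\mathbb R^n$. Let $\mathcal N$ and $\mathcal N_{\rm weak}$ be the best constants ($\infty$ if there is none) such that, for all complex-valued $f_1\in L^{p_1}(\sigma_1)$ and $f_2\in L^{p_2}(\sigma_2)$, the integral $I_\alpha(f_1\sigma_1,f_2\sigma_2)(x)$ converges absolutely for $w$-almost every $x$ and, respectively, $$\|I_\alpha(f_1\sigma_1,f_2\sigma_2)\|_{L^q(w)}\le\mathcal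 N\prod_{i=1}^2\|f_i\|_{L^{p_i}(\sigma_i)},\qquad (1)$$ $$\|I_\alpha(f_1\sigma_1,f_2\sigma_2)\|_{L^{q,\infty}(w)}\le\mathcal N_{\rm weak}\prod_{i=1}^2\|f_i\|_{L^{p_i}(\sigma_i)},\qquad (2)$$ where $\|g\|_{L^{q,\infty}(w)}=\sup_{t>0}t\,w(\{|g|>t\})^{1/q}$. Put $$\mathcal T=\sup_Q\frac{\big(\int_Q I_\alpha(1_Q\sigma_1,1_Q\sigma_2)^q\,dw\big)^{1/q}}{\sigma_1(Q)^{1/p_1}\sigma_2(Q)^{1/p_2}},$$ $$\mathcal T_1^*=\sup_Q\frac{\big(\int_Q I_\alpha(1_Qw,1_Q\sigma_2)^{p_1'}\,d\sigma_1\big)^{1/p_1'}}{w(Q)^{1/q'}\sigma_2(Q)^{1/p_2}},\qquad \mathcal T_2^*=\sup_Q\frac{\big(\int_Q I_\alpha(1_Q\sigma_1,1_Qw)^{p_2'}\,d\sigma_2\big)^{1/p_2'}}{\sigma_1(Q)^{1/p_1}w(Q)^{1/q'}},$$ the suprema being over all half-open cubes $Q=\prod_{i=1}^n[a_i,a_i+l)$,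 $a\in\mathbb R^n$, $l>0$, with the convention $0/0=0$. Then (1) holds with some finite constant if and only if $\mathcal T,\mathcal T_1^*,\mathcal T_2^*<\infty$, and $$C^{-1}(\mathcal T+\mathcal T_1^*+\mathcal T_2^*)\le\mathcal N\le C(\mathcal T+\mathcal T_1^*+\mathcal T_2^*).$$ Moreover, (2) holds with some finite constant if and only if $\mathcal T_1^*,\mathcal T_2^*<\infty$, and $$C^{-1}(\mathcal T_1^*+\mathcal T_2^*)\le\mathcal N_{\rm weak}\le C(\mathcal T_1^*+\mathcal T_2^*).$$ -/

import Mathlib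

open MeasureTheory
open scoped ENNReal NNReal

noncomputable section

namespace BilinearFractional

/-- The kernel `(|x - y₁| + |x - y₂|) ^ (-(2n - α))` on `ℝⁿ`, with values in `[0, ∞]`:
for `α < 2n` its value at `x = y₁ = y₂` is `1 / 0 = ∞`. -/
def kernel {n : ℕ} (α : ℝ) (x y₁ y₂ : EuclideanSpace ℝ (Fin n)) : ℝ≥0∞ :=
  ENNReal.ofReal (dist x y₁ + dist x y₂) ^ (-(2 * (n : ℝ) - α))

/-- `I_α(f₁σ₁, f₂σ₂)(x)` for functions with values in `[0, ∞]`. -/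
def fracIntNonneg {n : ℕ} (α : ℝ) (σ₁ σ₂ : Measure (EuclideanSpace ℝ (Fin n)))
    (f₁ f₂ : EuclideanSpace ℝ (Fin n) → ℝ≥0∞) (x : EuclideanSpace ℝ (Fin n)) : ℝ≥0∞ :=
  ∫⁻ y, kernel α x y.1 y.2 * (f₁ y.1 * f₂ y.2) ∂(σ₁.prod σ₂)

/-- `I_α(f₁σ₁, f₂σ₂)(x)` for complex functions. It is meaningful where the integral converges
absolutely, see `ConvergesAt`. -/
def fracInt {n : ℕ} (α : ℝ) (σ₁ σ₂ : Measure (EuclideanSpace ℝ (Fin n)))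
    (f₁ f₂ : EuclideanSpace ℝ (Fin n) → ℂ) (x : EuclideanSpace ℝ (Fin n)) : ℂ :=
  ∫ y, ((kernel α x y.1 y.2).toReal : ℂ) * (f₁ y.1 * f₂ y.2) ∂(σ₁.prod σ₂)

/-- The integral defining `I_α(f₁σ₁, f₂σ₂)(x)` converges absolutely. The kernel is `∞` on the
diagonal here, so the diagonal must not be charged by `|f₁|σ₁ × |f₂|σ₂`. -/
def ConvergesAt {n : ℕ} (α : ℝ) (σ₁ σ₂ : Measure (EuclideanSpace ℝ (Fin n)))
    (f₁ f₂ : EuclideanSpace ℝ (Fin n) → ℂ) (x : EuclideanSpace ℝ (Fin n)) : Prop :=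
  fracIntNonneg α σ₁ σ₂ (fun y => ‖f₁ y‖ₑ) (fun y => ‖f₂ y‖ₑ) x < ∞

/-- The weak `L^{q,∞}(w)` quasi-norm `sup_{t > 0} t · w {|g| > t} ^ (1/q)`. -/
def weakNorm {n : ℕ} (g : EuclideanSpace ℝ (Fin n) → ℂ) (q : ℝ)
    (w : Measure (EuclideanSpace ℝ (Fin n))) : ℝ≥0∞ :=
  ⨆ t : ℝ≥0, (t : ℝ≥0∞) * w {x | (t : ℝ≥0∞) < ‖g x‖ₑ} ^ (1 / q)

/-- The strong type inequality with constant `N`: for all `fᵢ ∈ L^{pᵢ}(σᵢ)`, the function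
`I_α(f₁σ₁, f₂σ₂)` is defined `w`-a.e. and its `L^q(w)` norm is at most `N ‖f₁‖ ‖f₂‖`. -/
def StrongType {n : ℕ} (α p₁ p₂ q : ℝ) (σ₁ σ₂ w : Measure (EuclideanSpace ℝ (Fin n)))
    (N : ℝ≥0) : Prop :=
  ∀ f₁ f₂ : EuclideanSpace ℝ (Fin n) → ℂ,
    MemLp f₁ (ENNReal.ofReal p₁) σ₁ → MemLp f₂ (ENNReal.ofReal p₂) σ₂ →
      (∀ᵐ x ∂w, ConvergesAt α σ₁ σ₂ f₁ f₂ x) ∧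
      eLpNorm (fracInt α σ₁ σ₂ f₁ f₂) (ENNReal.ofReal q) w ≤
        N * (eLpNorm f₁ (ENNReal.ofReal p₁) σ₁ * eLpNorm f₂ (ENNReal.ofReal p₂) σ₂)

/-- The weak type inequality with constant `N`. -/
def WeakType {n : ℕ} (α p₁ p₂ q : ℝ) (σ₁ σ₂ w : Measure (EuclideanSpace ℝ (Fin n)))
    (N : ℝ≥0) : Prop :=
  ∀ f₁ f₂ : EuclideanSpace ℝ (Fin n) → ℂ,
    MemLp f₁ (ENNReal.ofReal p₁) σ₁ → MemLp f₂ (ENNReal.ofReal p₂) σ₂ →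
      (∀ᵐ x ∂w, ConvergesAt α σ₁ σ₂ f₁ f₂ x) ∧
      weakNorm (fracInt α σ₁ σ₂ f₁ f₂) q w ≤
        N * (eLpNorm f₁ (ENNReal.ofReal p₁) σ₁ * eLpNorm f₂ (ENNReal.ofReal p₂) σ₂)

/-- The best constant in the strong type inequality; it is `∞` if there is none. -/
def strongConst {n : ℕ} (α p₁ p₂ q : ℝ) (σ₁ σ₂ w : Measure (EuclideanSpace ℝ (Fin n))) : ℝ≥0∞ :=
  ⨅ (N : ℝ≥0) (_ : StrongType α p₁ p₂ q σ₁ σ₂ w N), (N : ℝ≥0∞)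

/-- The best constant in the weak type inequality; it is `∞` if there is none. -/
def weakConst {n : ℕ} (α p₁ p₂ q : ℝ) (σ₁ σ₂ w : Measure (EuclideanSpace ℝ (Fin n))) : ℝ≥0∞ :=
  ⨅ (N : ℝ≥0) (_ : WeakType α p₁ p₂ q σ₁ σ₂ w N), (N : ℝ≥0∞)

/-- The half-open cube `∏ᵢ [aᵢ, aᵢ + l)` with sides parallel to the axes. -/
def cube {n : ℕ} (a : EuclideanSpace ℝ (Fin n)) (l : ℝ) : Set (EuclideanSpace ℝ (Fin n)) :=
  {x | ∀ i, a i ≤ x i ∧ x i < a i + l}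

/-- The supremum over all cubes `Q` of
`(∫_Q I_α(1_Q μ, 1_Q ν)^r dρ)^(1/r) / (μ(Q)^(1/s) ν(Q)^(1/t))`.
If the denominator vanishes then so does the numerator, and `0 / 0 = 0`. -/
def testConst {n : ℕ} (α r s t : ℝ) (μ ν ρ : Measure (EuclideanSpace ℝ (Fin n))) : ℝ≥0∞ :=
  ⨆ (a : EuclideanSpace ℝ (Fin n)) (l : ℝ) (_ : 0 < l),
    (∫⁻ x in cube a l,
        fracIntNonneg α μ ν ((cube a l).indicator 1) ((cube a l).indicator 1) x ^ r ∂ρ) ^ (1 / r) /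
      (μ (cube a l) ^ (1 / s) * ν (cube a l) ^ (1 / t))

/-- The testing constant `T`. -/
def testT {n : ℕ} (α p₁ p₂ q : ℝ) (σ₁ σ₂ w : Measure (EuclideanSpace ℝ (Fin n))) : ℝ≥0∞ :=
  testConst α q p₁ p₂ σ₁ σ₂ w

/-- The dual testing constant `T₁*`, with `1_Q w` in the first place and the exponent `p₁'`. -/
def testT₁ {n : ℕ} (α p₁ p₂ q : ℝ) (σ₁ σ₂ w : Measure (EuclideanSpace ℝ (Fin n))) : ℝ≥0∞ :=
  testConst α p₁.conjExponent q.conjExponent p₂ w σ₂ σ₁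

/-- The dual testing constant `T₂*`, with `1_Q w` in the second place and the exponent `p₂'`. -/
def testT₂ {n : ℕ} (α p₁ p₂ q : ℝ) (σ₁ σ₂ w : Measure (EuclideanSpace ℝ (Fin n))) : ℝ≥0∞ :=
  testConst α p₂.conjExponent p₁ q.conjExponent σ₁ w σ₂

end BilinearFractional

end

open MeasureTheory
open scoped ENNReal NNReal

noncomputable section

namespace BilinearFractional

/-! ### Elementary inequalities for sums and averages. -/

section

/-! Write `s = 2n - α`. The kernel is comparable to the sum, over `2 ^ n` shifted dyadic grids, of
`ℓ(Q) ^ (-s)` times the indicator of `Q × Q × Q` (`sum_cubeWeight_le_kernel`,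
`kernel_le_sum_cubeWeight`). This model is symmetric in its three points. By duality the strong
inequality therefore reduces to a bound for the trilinear form `∑ lam Q * ∫_Q f₁ dμ₁ * ∫_Q f₂ dμ₂ *
∫_Q f₃ dμ₃` with exponents `p₁, p₂, q'`. The hypotheses on `p₁, p₂, q` say exactly that any two of
the three reciprocals have sum at least `1`.

To bound the form (`trilinear_le`), call `avg ^ p * μ Q` the energy of a function on `Q`, and sort
the cubes by which function has the smallest energy. Suppose it is `f₁`. Choose stopping families
`S₂`, `S₃` for the averages of `f₂`, `f₃`, and group the cubes according to the least member `F` of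
`S₂ ∪ S₃` above them. In a group, the averages of `f₂` and `f₃` are frozen up to a factor `2`, and
`f₁` may be replaced by its averages on the children of `F`. Hölder's inequality and the testing
condition with the integral against `μ₁` then settle the group. The pieces of `f₁` outside the
children are disjoint. The averages on the children are summable because the energy of `f₁` is
dominated on `S₂` by that of `f₂` and on `S₃` by that of `f₃`, and those satisfy a Carleson
embedding (`sum_le_of_principal`).

For the weak inequality the third function is a normalized indicator of a cube, whose stopping
family is that single cube. Only the energies of `f₁` and `f₂` are compared, so `T` is not needed
(`local_le`). A maximum principle for dyadic sums (`exists_maximal_cover`) turns this localized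
bound into a relation between the level sets at heights `2t` and `t`, from which the weak norm is
absorbed (`dyadic_weak_le`).

Conversely, `T` is bounded by testing on indicators. The dual constants are already controlled by
the weak inequality: Kolmogorov's inequality integrates the operator over a cube, Fubini moves the
integral to the first variable, and the extremal function of `L^p` duality is inserted
(`lintegral_min_rpow_le`). -/

/-- The sum of the geometric series with ratio `2 ^ (-s)`. -/
def geomConst (s : ℝ) : ℝ≥0∞ := (1 - 2 ^ (-s))⁻¹

theorem geomConst_ne_top {s : ℝ} (hs : 0 < s) : geomConst s ≠ ∞ := by
  have h : (2 : ℝ≥0∞) ^ (-s) < 1 := ENNReal.rpow_lt_one_of_one_lt_of_neg (by norm_num) (by linarith)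
  exact ENNReal.inv_ne_top.2 (tsub_pos_of_lt h).ne'

/-- Distinct scales, read downwards from the largest one, form part of a geometric series, so the
sum is comparable to its top term. -/
theorem sum_zpow_rpow_le {s : ℝ} (hs : 0 < s) (K : Finset ℤ) (v : ℝ≥0∞)
    (hK : ∀ k ∈ K, (2 : ℝ≥0∞) ^ k ≤ v) :
    ∑ k ∈ K, ((2 : ℝ≥0∞) ^ k) ^ s ≤ geomConst s * v ^ s := by
  rcases K.eq_empty_or_nonempty with rfl | hne
  · simp
  have hterm : ∀ k ∈ K, ((2 : ℝ≥0∞) ^ k) ^ s =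
      ((2 : ℝ≥0∞) ^ (K.max' hne)) ^ s * (2 ^ (-s)) ^ ((K.max' hne - k).toNat) := by
    intro k hk
    have hle := K.le_max' k hk
    rw [← ENNReal.rpow_intCast, ← ENNReal.rpow_intCast, ← ENNReal.rpow_natCast,
      ← ENNReal.rpow_mul, ← ENNReal.rpow_mul, ← ENNReal.rpow_mul,
      ← ENNReal.rpow_add _ _ (by norm_num) (by norm_num)]
    congr 1
    have : (((K.max' hne - k).toNat : ℕ) : ℝ) = (K.max' hne : ℝ) - k := by
      have h2 : (((K.max' hne - k).toNat : ℕ) : ℤ) = K.max' hne - k := Int.toNat_of_nonneg (by omega)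
      exact_mod_cast h2
    rw [this]; ring
  rw [Finset.sum_congr rfl hterm, ← Finset.mul_sum, mul_comm]
  gcongr
  · rw [geomConst, ← ENNReal.tsum_geometric]
    have hinj : Set.InjOn (fun k : ℤ => (K.max' hne - k).toNat) K := by
      intro a ha b hb hab
      have := K.le_max' a ha
      have := K.le_max' b hb
      simp only at hab
      omega
    rw [← Finset.sum_image (f := fun j : ℕ => ((2 : ℝ≥0∞) ^ (-s)) ^ j) hinj]
    exact ENNReal.sum_le_tsum _
  · exact hK _ (K.max'_mem hne)

/-- Hölder's inequality for the exponents rescaled to have sum `1`, followed by the embedding of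
`ℓ^1` in `ℓ^(s+t)`. All the pairwise conditions on `p₁, p₂, q'` are spent here. -/
theorem sum_rpow_mul_rpow_le {ι : Type*} (A : Finset ι) (x y : ι → ℝ≥0∞) {s t : ℝ}
    (hs : 0 < s) (ht : 0 < t) (hst : 1 ≤ s + t) :
    ∑ i ∈ A, x i ^ s * y i ^ t ≤ (∑ i ∈ A, x i) ^ s * (∑ i ∈ A, y i) ^ t := by
  have hpos : 0 < s + t := by linarith
  have hc : ((s + t) / s).HolderConjugate ((s + t) / t) := by
    rw [Real.holderConjugate_iff]
    refine ⟨by rw [lt_div_iff₀ hs]; linarith, ?_⟩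
    field_simp
  have h1 := ENNReal.inner_le_Lp_mul_Lq A (fun i => x i ^ (s / (s + t)))
    (fun i => y i ^ (t / (s + t))) hc
  have e1 : ∀ i, (x i ^ (s / (s + t))) ^ ((s + t) / s) = x i := fun i => by
    rw [← ENNReal.rpow_mul]
    rw [show s / (s + t) * ((s + t) / s) = 1 by field_simp, ENNReal.rpow_one]
  have e2 : ∀ i, (y i ^ (t / (s + t))) ^ ((s + t) / t) = y i := fun i => by
    rw [← ENNReal.rpow_mul]
    rw [show t / (s + t) * ((s + t) / t) = 1 by field_simp, ENNReal.rpow_one]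
  simp only [e1, e2, one_div_div] at h1
  have h2 : ∀ i, x i ^ s * y i ^ t = (x i ^ (s / (s + t)) * y i ^ (t / (s + t))) ^ (s + t) := by
    intro i
    rw [ENNReal.mul_rpow_of_nonneg _ _ hpos.le, ← ENNReal.rpow_mul, ← ENNReal.rpow_mul]
    congr 2 <;> field_simp
  have h3 : ∀ B : Finset ι, ∀ z : ι → ℝ≥0∞,
      ∑ i ∈ B, z i ^ (s + t) ≤ (∑ i ∈ B, z i) ^ (s + t) := by
    classical
    intro B z
    induction B using Finset.induction_on with
    | empty => simp
    | insert a B ha ih =>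
      rw [Finset.sum_insert ha, Finset.sum_insert ha]
      exact (add_le_add le_rfl ih).trans (ENNReal.add_rpow_le_rpow_add _ _ hst)
  calc ∑ i ∈ A, x i ^ s * y i ^ t
      = ∑ i ∈ A, (x i ^ (s / (s + t)) * y i ^ (t / (s + t))) ^ (s + t) := by simp only [h2]
    _ ≤ (∑ i ∈ A, x i ^ (s / (s + t)) * y i ^ (t / (s + t))) ^ (s + t) := h3 _ _
    _ ≤ ((∑ i ∈ A, x i) ^ (s / (s + t)) * (∑ i ∈ A, y i) ^ (t / (s + t))) ^ (s + t) := by gcongr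
    _ = _ := by
      rw [ENNReal.mul_rpow_of_nonneg _ _ hpos.le, ← ENNReal.rpow_mul, ← ENNReal.rpow_mul]
      congr 2 <;> field_simp

variable {X : Type*} [MeasurableSpace X]

/-- The average of `f` over `Q`. -/
def avg (μ : Measure X) (f : X → ℝ≥0∞) (Q : Set X) : ℝ≥0∞ := (∫⁻ x in Q, f x ∂μ) / μ Q

theorem avg_mul {μ : Measure X} {f : X → ℝ≥0∞} {Q : Set X} (hQ : μ Q ≠ ∞) :
    avg μ f Q * μ Q = ∫⁻ x in Q, f x ∂μ := by
  rcases eq_or_ne (μ Q) 0 with h0 | h0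
  · rw [h0, mul_zero, Measure.restrict_eq_zero.2 h0, lintegral_zero_measure]
  · exact ENNReal.div_mul_cancel h0 hQ

theorem setLIntegral_le_rpow {μ : Measure X} {f : X → ℝ≥0∞} (hf : Measurable f) (Q : Set X)
    {p r : ℝ} (hpr : p.HolderConjugate r) :
    ∫⁻ x in Q, f x ∂μ ≤ (∫⁻ x in Q, f x ^ p ∂μ) ^ (1 / p) * μ Q ^ (1 / r) := by
  have := ENNReal.lintegral_mul_le_Lp_mul_Lq (μ.restrict Q) hpr hf.aemeasurable
    (aemeasurable_const (b := (1 : ℝ≥0∞)))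
  simpa using this

theorem avg_rpow_mul_le {μ : Measure X} {f : X → ℝ≥0∞} (hf : Measurable f) {Q : Set X}
    (hQ : μ Q ≠ ∞) {p : ℝ} (hp : 1 < p) :
    avg μ f Q ^ p * μ Q ≤ ∫⁻ x in Q, f x ^ p ∂μ := by
  have hp0 : 0 < p := by linarith
  rcases eq_or_ne (μ Q) 0 with h0 | h0
  · simp [h0]
  have hpr := Real.HolderConjugate.conjExponent hp
  have h := setLIntegral_le_rpow (μ := μ) hf Q hpr
  rw [← avg_mul hQ] at h
  have h2 : avg μ f Q * μ Q ^ (1 / p) ≤ (∫⁻ x in Q, f x ^ p ∂μ) ^ (1 / p) := by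
    have hne : μ Q ^ (1 / p.conjExponent) ≠ 0 := by simp [h0, hQ]
    have hnt : μ Q ^ (1 / p.conjExponent) ≠ ∞ :=
      ENNReal.rpow_ne_top_of_nonneg (one_div_nonneg.2 hpr.symm.nonneg) hQ
    rw [← ENNReal.mul_le_mul_iff_left hne hnt]
    refine le_trans (le_of_eq ?_) h
    rw [mul_assoc, ← ENNReal.rpow_add _ _ h0 hQ]
    congr 1
    have := hpr.inv_add_inv_eq_one
    rw [one_div, one_div, this, ENNReal.rpow_one]
  have h3 := ENNReal.rpow_le_rpow h2 hp0.le
  rwa [ENNReal.mul_rpow_of_nonneg _ _ hp0.le, ← ENNReal.rpow_mul, ← ENNReal.rpow_mul,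
    one_div_mul_cancel hp0.ne', ENNReal.rpow_one, ENNReal.rpow_one] at h3

theorem avg_mul_rpow_le {μ : Measure X} {f : X → ℝ≥0∞} (hf : Measurable f) {Q : Set X}
    (hQ : μ Q ≠ ∞) {p : ℝ} (hp : 1 < p) :
    avg μ f Q * μ Q ^ (1 / p) ≤ (∫⁻ x in Q, f x ^ p ∂μ) ^ (1 / p) := by
  have hp0 : 0 < p := by linarith
  have h3 := ENNReal.rpow_le_rpow (avg_rpow_mul_le hf hQ hp) (one_div_nonneg.2 hp0.le)
  rwa [ENNReal.mul_rpow_of_nonneg _ _ (one_div_nonneg.2 hp0.le), ← ENNReal.rpow_mul,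
    mul_one_div_cancel hp0.ne', ENNReal.rpow_one] at h3

theorem setLIntegral_ne_top {μ : Measure X} {f : X → ℝ≥0∞} (hf : Measurable f) {Q : Set X}
    (hQ : μ Q ≠ ∞) {p : ℝ} (hp : 1 < p) (h : ∫⁻ x, f x ^ p ∂μ ≠ ∞) :
    ∫⁻ x in Q, f x ∂μ ≠ ∞ := by
  have hpr := Real.HolderConjugate.conjExponent hp
  refine ne_top_of_le_ne_top (ENNReal.mul_ne_top ?_ ?_) (setLIntegral_le_rpow hf Q hpr)
  · exact ENNReal.rpow_ne_top_of_nonneg (one_div_nonneg.2 hpr.nonneg)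
      (ne_top_of_le_ne_top h (setLIntegral_le_lintegral _ _))
  · exact ENNReal.rpow_ne_top_of_nonneg (one_div_nonneg.2 hpr.symm.nonneg) hQ

/-- Extension of a bound on a positive functional from the unit ball of `L^p`. -/
theorem sum_mul_setLIntegral_le_of_unit {μ : Measure X} {p : ℝ} (hp : 1 < p)
    (B : Finset (Set X)) (c : Set X → ℝ≥0∞) (K : ℝ≥0∞)
    (h : ∀ f : X → ℝ≥0∞, Measurable f → ∫⁻ x, f x ^ p ∂μ ≤ 1 →
      ∑ Q ∈ B, c Q * ∫⁻ x in Q, f x ∂μ ≤ K)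
    {f : X → ℝ≥0∞} (hf : Measurable f) (hfin : ∫⁻ x, f x ^ p ∂μ ≠ ∞) :
    ∑ Q ∈ B, c Q * ∫⁻ x in Q, f x ∂μ ≤ K * (∫⁻ x, f x ^ p ∂μ) ^ (1 / p) := by
  have hp0 : 0 < p := by linarith
  set N := (∫⁻ x, f x ^ p ∂μ) ^ (1 / p) with hN
  -- Normalizing divides by the norm `N`, so norm zero is settled separately: there `f` vanishes
  -- almost everywhere.
  rcases eq_or_ne (∫⁻ x, f x ^ p ∂μ) 0 with h0 | h0
  · rw [lintegral_eq_zero_iff (hf.pow_const p)] at h0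
    have hf0 : f =ᵐ[μ] 0 := by
      filter_upwards [h0] with x hx
      simpa [hp0, hp0.not_gt] using hx
    have : ∀ Q, ∫⁻ x in Q, f x ∂μ = 0 := fun Q => by
      rw [lintegral_congr_ae (ae_restrict_of_ae hf0)]; simp
    simp [this]
  have hN0 : N ≠ 0 := by simp [hN, h0, hfin]
  have hNt : N ≠ ∞ := ENNReal.rpow_ne_top_of_nonneg (one_div_nonneg.2 hp0.le) hfin
  have h1 := h (fun x => N⁻¹ * f x) (hf.const_mul _) (by
    simp_rw [ENNReal.mul_rpow_of_nonneg _ _ hp0.le]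
    rw [lintegral_const_mul _ (hf.pow_const p), hN, ENNReal.inv_rpow, ← ENNReal.rpow_mul,
      one_div_mul_cancel hp0.ne', ENNReal.rpow_one, ENNReal.inv_mul_cancel h0 hfin])
  calc ∑ Q ∈ B, c Q * ∫⁻ x in Q, f x ∂μ
      = (∑ Q ∈ B, c Q * ∫⁻ x in Q, N⁻¹ * f x ∂μ) * N := by
        rw [Finset.sum_mul]
        refine Finset.sum_congr rfl fun Q _ => ?_
        rw [lintegral_const_mul _ hf, mul_assoc, mul_comm N⁻¹, mul_assoc,
          ENNReal.inv_mul_cancel hN0 hNt, mul_one]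
    _ ≤ K * N := by gcongr

end

/-! ### Laminar families, stopping families and the Carleson embedding. -/

section

open scoped Classical

variable {X : Type*} [MeasurableSpace X]

/-- A family of nonempty measurable sets, any two of which are nested or disjoint. -/
structure IsLaminar (𝒟 : Set (Set X)) : Prop where
  measurableSet : ∀ Q ∈ 𝒟, MeasurableSet Q
  nonempty : ∀ Q ∈ 𝒟, Q.Nonempty
  nested : ∀ P ∈ 𝒟, ∀ Q ∈ 𝒟, P ⊆ Q ∨ Q ⊆ P ∨ Disjoint P Q

theorem IsLaminar.mono {𝒟 ℰ : Set (Set X)} (h : IsLaminar 𝒟) (hE : ℰ ⊆ 𝒟) : IsLaminar ℰ :=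
  ⟨fun Q hQ => h.1 Q (hE hQ), fun Q hQ => h.2 Q (hE hQ),
    fun P hP Q hQ => h.3 P (hE hP) Q (hE hQ)⟩

theorem IsLaminar.subset_or_subset {𝒟 : Set (Set X)} (h : IsLaminar 𝒟) {P Q : Set X} (hP : P ∈ 𝒟)
    (hQ : Q ∈ 𝒟) {x : X} (hxP : x ∈ P) (hxQ : x ∈ Q) : P ⊆ Q ∨ Q ⊆ P := by
  rcases h.nested P hP Q hQ with h1 | h1 | h1
  · exact Or.inl h1
  · exact Or.inr h1
  · exact absurd hxQ (Set.disjoint_left.1 h1 hxP)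

/-- A stopping family `S` for the averages of `f` over the members of `A`. -/
structure IsPrincipal (μ : Measure X) (f : X → ℝ≥0∞) (p : ℝ) (A S : Finset (Set X))
    (K : ℝ≥0∞) : Prop where
  cover : ∀ Q ∈ A, ∃ F ∈ S, Q ⊆ F ∧ avg μ f Q ≤ 2 * avg μ f F
  anti : ∀ F ∈ S, ∀ G ∈ S, F ⊆ G → avg μ f G ≤ avg μ f F
  sum_le : ∑ F ∈ S, avg μ f F ^ p * μ F ≤ K

/-- The constant in the Carleson embedding for principal sets. -/
def carlesonConst (p : ℝ) : ℝ≥0∞ := 2 * (geomConst (p - 1) * 4 ^ (p - 1))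

theorem carlesonConst_ne_top {p : ℝ} (hp : 1 < p) : carlesonConst p ≠ ∞ := by
  refine ENNReal.mul_ne_top (by norm_num) (ENNReal.mul_ne_top (geomConst_ne_top (by linarith)) ?_)
  exact ENNReal.rpow_ne_top_of_nonneg (by linarith) (by norm_num)

/-- Here `k F` is the dyadic level of the average on `F`. Values of `f` below `2 ^ (k F - 1)` give
at most half of the integral over `F`, so only `f > 2 ^ (k F - 1)` matters. At a fixed point the
sets of `S` through it form a chain with distinct levels, and the sum over them is geometric with
top term comparable to `f x ^ (p - 1)`. No maximal function is involved. -/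
theorem carleson_sum_le {μ : Measure X} {f : X → ℝ≥0∞} {p : ℝ} (hp : 1 < p) {S : Finset (Set X)}
    (hS : IsLaminar (S : Set (Set X))) (hμ : ∀ Q ∈ S, μ Q ≠ ∞) (hf : Measurable f)
    (hfp : ∫⁻ x, f x ^ p ∂μ ≠ ∞) (k : Set X → ℤ)
    (hk : ∀ F ∈ S, (2 : ℝ≥0∞) ^ (k F) < avg μ f F ∧ avg μ f F ≤ 2 ^ (k F + 1))
    (hanti : ∀ F ∈ S, ∀ G ∈ S, F ⊂ G → k G < k F) :
    ∑ F ∈ S, avg μ f F ^ p * μ F ≤ carlesonConst p * ∫⁻ x, f x ^ p ∂μ := by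
  have h2 : (2 : ℝ≥0∞) ≠ 0 := by norm_num
  have h2t : (2 : ℝ≥0∞) ≠ ∞ := by norm_num
  -- the part of `f` above half of the average carries half of the integral
  have key : ∀ F ∈ S, avg μ f F * μ F ≤
      2 * ∫⁻ x in F, {x | (2 : ℝ≥0∞) ^ (k F - 1) < f x}.indicator f x ∂μ := by
    intro F hF
    have hle : ∫⁻ x in F, f x ∂μ ≤
        (∫⁻ x in F, {x | (2 : ℝ≥0∞) ^ (k F - 1) < f x}.indicator f x ∂μ) +
          2 ^ (k F - 1) * μ F := by
      calc ∫⁻ x in F, f x ∂μ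
          ≤ ∫⁻ x in F, ({x | (2 : ℝ≥0∞) ^ (k F - 1) < f x}.indicator f x + 2 ^ (k F - 1)) ∂μ := by
            refine lintegral_mono fun x => ?_
            by_cases hx : (2 : ℝ≥0∞) ^ (k F - 1) < f x
            · simp [Set.indicator, hx]
            · simpa [Set.indicator, hx] using not_lt.1 hx
        _ = _ := by
            rw [lintegral_add_right _ measurable_const]; simp
    have hfin : avg μ f F * μ F ≠ ∞ := by
      rw [avg_mul (hμ F hF)]; exact setLIntegral_ne_top hf (hμ F hF) hp hfp
    have hhalf : 2 * ((2 : ℝ≥0∞) ^ (k F - 1) * μ F) ≤ avg μ f F * μ F := by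
      rw [← mul_assoc]
      gcongr
      have : (2 : ℝ≥0∞) * 2 ^ (k F - 1) = 2 ^ (k F) := by
        calc (2 : ℝ≥0∞) * 2 ^ (k F - 1) = 2 ^ (1 : ℤ) * 2 ^ (k F - 1) := by rw [zpow_one]
          _ = 2 ^ (k F) := by rw [← ENNReal.zpow_add h2 h2t]; congr 1; ring
      rw [this]; exact (hk F hF).1.le
    rw [← avg_mul (hμ F hF)] at hle
    set a := avg μ f F * μ F
    set b := ∫⁻ x in F, {x | (2 : ℝ≥0∞) ^ (k F - 1) < f x}.indicator f x ∂μ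
    set c := (2 : ℝ≥0∞) ^ (k F - 1) * μ F
    have : a + a ≤ a + 2 * b := by
      calc a + a = 2 * a := by ring
        _ ≤ 2 * (b + c) := by gcongr
        _ = 2 * c + 2 * b := by ring
        _ ≤ a + 2 * b := by gcongr
    exact (ENNReal.add_le_add_iff_left hfin).1 this
  have hmeas : ∀ F ∈ S, Measurable (fun x => F.indicator (fun x => ((2 : ℝ≥0∞) ^ (k F + 1)) ^ (p - 1) *
      (2 * {x | (2 : ℝ≥0∞) ^ (k F - 1) < f x}.indicator f x)) x) := by
    intro F hF
    refine Measurable.indicator ?_ (hS.measurableSet F hF)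
    exact ((hf.indicator (measurableSet_lt measurable_const hf)).const_mul _).const_mul _
  calc ∑ F ∈ S, avg μ f F ^ p * μ F
      ≤ ∑ F ∈ S, ∫⁻ x, F.indicator (fun x => ((2 : ℝ≥0∞) ^ (k F + 1)) ^ (p - 1) *
          (2 * {x | (2 : ℝ≥0∞) ^ (k F - 1) < f x}.indicator f x)) x ∂μ := by
        refine Finset.sum_le_sum fun F hF => ?_
        rw [lintegral_indicator (hS.measurableSet F hF), lintegral_const_mul, lintegral_const_mul]
        · calc avg μ f F ^ p * μ F = avg μ f F ^ (p - 1) * (avg μ f F * μ F) := by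
                rw [← mul_assoc]; congr 1
                have : avg μ f F ^ (p - 1) * avg μ f F ^ (1 : ℝ) = avg μ f F ^ p := by
                  rw [← ENNReal.rpow_add_of_nonneg _ _ (by linarith) (by norm_num)]
                  congr 1; ring
                rw [← this, ENNReal.rpow_one]
            _ ≤ ((2 : ℝ≥0∞) ^ (k F + 1)) ^ (p - 1) *
                  (2 * ∫⁻ x in F, {x | (2 : ℝ≥0∞) ^ (k F - 1) < f x}.indicator f x ∂μ) :=
                mul_le_mul' (ENNReal.rpow_le_rpow (hk F hF).2 (by linarith)) (key F hF)
        · exact hf.indicator (measurableSet_lt measurable_const hf)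
        · exact (hf.indicator (measurableSet_lt measurable_const hf)).const_mul _
    _ = ∫⁻ x, ∑ F ∈ S, F.indicator (fun x => ((2 : ℝ≥0∞) ^ (k F + 1)) ^ (p - 1) *
          (2 * {x | (2 : ℝ≥0∞) ^ (k F - 1) < f x}.indicator f x)) x ∂μ :=
        (lintegral_finsetSum' _ fun F hF => (hmeas F hF).aemeasurable).symm
    _ ≤ ∫⁻ x, carlesonConst p * f x ^ p ∂μ := by
        refine lintegral_mono fun x => ?_
        set Sx := S.filter fun F => x ∈ F ∧ (2 : ℝ≥0∞) ^ (k F - 1) < f x with hSx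
        have e1 : ∑ F ∈ S, F.indicator (fun x => ((2 : ℝ≥0∞) ^ (k F + 1)) ^ (p - 1) *
            (2 * {x | (2 : ℝ≥0∞) ^ (k F - 1) < f x}.indicator f x)) x =
            ∑ F ∈ Sx, ((2 : ℝ≥0∞) ^ (k F + 1)) ^ (p - 1) * (2 * f x) := by
          rw [hSx, Finset.sum_filter]
          refine Finset.sum_congr rfl fun F _ => ?_
          by_cases h1 : x ∈ F <;> by_cases h3 : (2 : ℝ≥0∞) ^ (k F - 1) < f x <;>
            simp [Set.indicator, h1, h3]
        -- Two sets of `S` through the same point are nested, and nested sets have different levels.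
        have hinj : Set.InjOn (fun F => k F + 1) (Sx : Set (Set X)) := by
          intro F hF G hG hFG
          rw [Finset.mem_coe, hSx, Finset.mem_filter] at hF hG
          have hFG' : k F = k G := by simpa using hFG
          by_contra hne
          rcases hS.subset_or_subset hF.1 hG.1 hF.2.1 hG.2.1 with h | h
          · exact absurd (hanti F hF.1 G hG.1 (h.ssubset_of_ne hne)) (by omega)
          · exact absurd (hanti G hG.1 F hF.1 (h.ssubset_of_ne (Ne.symm hne))) (by omega)
        rw [e1, ← Finset.sum_mul, ← Finset.sum_image (f := fun j : ℤ => ((2 : ℝ≥0∞) ^ j) ^ (p - 1)) hinj]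
        have hb := sum_zpow_rpow_le (s := p - 1) (by linarith) (Sx.image fun F => k F + 1) (4 * f x) (by
          intro j hj
          obtain ⟨F, hF, rfl⟩ := Finset.mem_image.1 hj
          rw [hSx, Finset.mem_filter] at hF
          have : (2 : ℝ≥0∞) ^ (k F + 1) = 4 * 2 ^ (k F - 1) := by
            rw [show (4 : ℝ≥0∞) = 2 ^ (2 : ℤ) by norm_cast, ← ENNReal.zpow_add h2 h2t]
            congr 1; ring
          rw [this]; gcongr; exact hF.2.2.le)
        calc _ ≤ geomConst (p - 1) * (4 * f x) ^ (p - 1) * (2 * f x) := by gcongr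
          _ = carlesonConst p * (f x ^ (p - 1) * f x) := by
            rw [ENNReal.mul_rpow_of_nonneg _ _ (by linarith), carlesonConst]; ring
          _ = _ := by
            congr 1
            have : f x ^ (p - 1) * f x ^ (1 : ℝ) = f x ^ p := by
              rw [← ENNReal.rpow_add_of_nonneg _ _ (by linarith) (by norm_num)]
              congr 1; ring
            rw [← this, ENNReal.rpow_one]
    _ = _ := lintegral_const_mul _ (hf.pow_const p)

/-- A set is selected when no strictly larger member of `A` has average above the lower edge of its
own dyadic level. Levels then strictly increase towards smaller selected sets, as the Carleson
estimate demands. -/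
theorem exists_isPrincipal {μ : Measure X} {f : X → ℝ≥0∞} {p : ℝ} (hp : 1 < p) {A : Finset (Set X)}
    (hA : IsLaminar (A : Set (Set X))) (hμ : ∀ Q ∈ A, μ Q ≠ ∞) (hf : Measurable f)
    (hfp : ∫⁻ x, f x ^ p ∂μ ≤ 1) (hpos : ∀ Q ∈ A, avg μ f Q ≠ 0) :
    ∃ S ⊆ A, IsPrincipal μ f p A S (carlesonConst p) := by
  have hfp' : ∫⁻ x, f x ^ p ∂μ ≠ ∞ := ne_top_of_le_ne_top ENNReal.one_ne_top hfp
  have htop : ∀ Q ∈ A, avg μ f Q ≠ ∞ := by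
    intro Q hQ
    by_cases h0 : μ Q = 0
    -- A null set has average `0 / 0 = 0`, which is excluded.
    · refine absurd ?_ (hpos Q hQ)
      rw [avg, Measure.restrict_eq_zero.2 h0]; simp
    · exact ENNReal.div_ne_top (setLIntegral_ne_top hf (hμ Q hQ) hp hfp') h0
  have hlev : ∀ Q ∈ A, ∃ k : ℤ, (2 : ℝ≥0∞) ^ k < avg μ f Q ∧ avg μ f Q ≤ 2 ^ (k + 1) := by
    intro Q hQ
    obtain ⟨k, hk⟩ := ENNReal.exists_mem_Ioc_zpow (hpos Q hQ) (htop Q hQ)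
      (y := 2) (by norm_num) (by norm_num)
    exact ⟨k, hk.1, hk.2⟩
  choose! k hk using hlev
  have hmono : ∀ j l : ℤ, j ≤ l → (2 : ℝ≥0∞) ^ j ≤ 2 ^ l := fun j l h =>
    ENNReal.zpow_le_of_le (by norm_num) h
  set S := A.filter fun F => ∀ R ∈ A, F ⊂ R → avg μ f R ≤ 2 ^ (k F) with hSdef
  have hSA : S ⊆ A := Finset.filter_subset _ _
  have hanti : ∀ F ∈ S, ∀ G ∈ S, F ⊂ G → k G < k F := by
    intro F hF G hG hFG
    have h1 := (Finset.mem_filter.1 hF).2 G (hSA hG) hFG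
    by_contra hcon
    exact absurd ((hk G (hSA hG)).1.trans_le h1) (not_lt.2 (hmono _ _ (not_lt.1 hcon)))
  refine ⟨S, hSA, ?_, ?_, ?_⟩
  · intro Q hQ
    -- an ancestor of maximal average, and the largest ancestor of the same level
    obtain ⟨P, hP, hPmax⟩ := (A.filter fun R => Q ⊆ R).exists_max_image (avg μ f)
      ⟨Q, by simp [hQ]⟩
    rw [Finset.mem_filter] at hP
    -- `F` is the largest ancestor whose average exceeds the lower edge of the level of `P`.
    -- Anything larger violating the selection rule for `F` would contradict this maximality.
    obtain ⟨F, hPF, hF⟩ := (A.filter fun R => Q ⊆ R ∧ 2 ^ (k P) < avg μ f R).exists_le_maximal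
      (a := P) (by simp [hP, (hk P hP.1).1])
    have hFm := hF.prop
    rw [Finset.mem_filter] at hFm
    have hFP : avg μ f F ≤ avg μ f P := hPmax F (by simp [hFm.1, hFm.2.1])
    have hkF : k P ≤ k F := by
      by_contra hcon
      have := hmono (k F + 1) (k P) (by omega)
      exact absurd (hFm.2.2.trans_le ((hk F hFm.1).2.trans this)) (lt_irrefl _)
    refine ⟨F, ?_, hFm.2.1, ?_⟩
    · rw [hSdef, Finset.mem_filter]
      refine ⟨hFm.1, fun R hR hFR => ?_⟩
      by_contra hcon
      have hR' : R ∈ A.filter fun R => Q ⊆ R ∧ 2 ^ (k P) < avg μ f R := by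
        rw [Finset.mem_filter]
        exact ⟨hR, hFm.2.1.trans hFR.1, (hmono _ _ hkF).trans_lt (not_le.1 hcon)⟩
      exact hFR.2 (hF.le_of_ge hR' hFR.1)
    · calc avg μ f Q ≤ avg μ f P := hPmax Q (by simp [hQ])
        _ ≤ 2 ^ (k P + 1) := (hk P hP.1).2
        _ = 2 * 2 ^ (k P) := by
          rw [ENNReal.zpow_add (by norm_num) (by norm_num), zpow_one, mul_comm]
        _ ≤ 2 * avg μ f F := by gcongr; exact hFm.2.2.le
  · intro F hF G hG hFG
    rcases hFG.eq_or_ssubset with rfl | h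
    · exact le_rfl
    · exact ((Finset.mem_filter.1 hF).2 G (hSA hG) h).trans (hk F (hSA hF)).1.le
  · refine (carleson_sum_le hp (hA.mono (by exact_mod_cast hSA)) (fun Q hQ => hμ Q (hSA hQ)) hf hfp' k
      (fun F hF => hk F (hSA hF)) hanti).trans ?_
    calc carlesonConst p * ∫⁻ x, f x ^ p ∂μ ≤ carlesonConst p * 1 := by gcongr
      _ = _ := mul_one _

end

/-! ### Children of a stopping set and Hölder's inequality inside it. -/

section

open scoped Classical

variable {X : Type*} [MeasurableSpace X]

/-- The maximal members of `S` strictly inside `F`. -/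
def children (S : Finset (Set X)) (F : Set X) : Finset (Set X) :=
  S.filter fun G => G ⊂ F ∧ ∀ H ∈ S, G ⊂ H → ¬ H ⊂ F

/-- The part of `F` outside its children. -/
def residue (S : Finset (Set X)) (F : Set X) : Set X := F \ ⋃ G ∈ children S F, G

/-- The function equal to `u` on the residue of `F` and to `v G` on each child `G` of `F`. -/
def glue (S : Finset (Set X)) (F : Set X) (u : X → ℝ≥0∞) (v : Set X → X → ℝ≥0∞) (x : X) : ℝ≥0∞ :=
  (residue S F).indicator u x + ∑ G ∈ children S F, G.indicator (v G) x

omit [MeasurableSpace X] in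
theorem mem_children {S : Finset (Set X)} {F G : Set X} :
    G ∈ children S F ↔ G ∈ S ∧ G ⊂ F ∧ ∀ H ∈ S, G ⊂ H → ¬ H ⊂ F := by
  simp [children]

omit [MeasurableSpace X] in
theorem exists_child {S : Finset (Set X)} {F H : Set X} (hH : H ∈ S) (hHF : H ⊂ F) :
    ∃ G ∈ children S F, H ⊆ G := by
  obtain ⟨G, hHG, hG⟩ := (S.filter fun G => G ⊂ F).exists_le_maximal (a := H) (by simp [hH, hHF])
  have hGm := Finset.mem_filter.1 hG.prop
  refine ⟨G, mem_children.2 ⟨hGm.1, hGm.2, fun K hK hGK hKF => ?_⟩, hHG⟩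
  exact hGK.2 (hG.le_of_ge (Finset.mem_filter.2 ⟨hK, hKF⟩) hGK.1)

variable {S : Finset (Set X)}

theorem eq_of_mem_children (hS : IsLaminar (S : Set (Set X))) {F G H : Set X} (hG : G ∈ children S F) (hH : H ∈ children S F) {x : X}
    (hxG : x ∈ G) (hxH : x ∈ H) : G = H := by
  rw [mem_children] at hG hH
  by_contra hne
  rcases hS.subset_or_subset hG.1 hH.1 hxG hxH with h | h
  · exact hG.2.2 H hH.1 (h.ssubset_of_ne hne) hH.2.1
  · exact hH.2.2 G hG.1 (h.ssubset_of_ne (Ne.symm hne)) hG.2.1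

/-- Two parents of `G` share a point of the nonempty set `G`, hence are nested; the smaller one
would then lie strictly between `G` and the larger. -/
theorem eq_of_mem_children' (hS : IsLaminar (S : Set (Set X))) {F F' G : Set X} (hF : F ∈ S) (hF' : F' ∈ S) (hG : G ∈ children S F)
    (hG' : G ∈ children S F') : F = F' := by
  rw [mem_children] at hG hG'
  obtain ⟨x, hx⟩ := hS.nonempty G hG.1
  by_contra hne
  rcases hS.subset_or_subset hF hF' (hG.2.1.1 hx) (hG'.2.1.1 hx) with h | h
  · exact hG'.2.2 F hF hG.2.1 (h.ssubset_of_ne hne)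
  · exact hG.2.2 F' hF' hG'.2.1 (h.ssubset_of_ne (Ne.symm hne))

theorem eq_of_mem_residue (hS : IsLaminar (S : Set (Set X))) {F G : Set X} (hF : F ∈ S) (hG : G ∈ S) {x : X}
    (hxF : x ∈ residue S F) (hxG : x ∈ residue S G) : F = G := by
  by_contra hne
  have aux : ∀ F ∈ S, ∀ G ∈ S, x ∈ residue S F → x ∈ residue S G → F ⊂ G → False := by
    intro F hF G _ hxF hxG hFG
    obtain ⟨H, hH, hFH⟩ := exists_child hF hFG
    exact hxG.2 (Set.mem_biUnion hH (hFH hxF.1))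
  rcases hS.subset_or_subset hF hG hxF.1 hxG.1 with h | h
  · exact aux F hF G hG hxF hxG (h.ssubset_of_ne hne)
  · exact aux G hG F hF hxG hxF (h.ssubset_of_ne (Ne.symm hne))

theorem measurableSet_residue (hS : IsLaminar (S : Set (Set X))) {F : Set X} (hF : F ∈ S) : MeasurableSet (residue S F) :=
  (hS.measurableSet F hF).diff
    (Finset.measurableSet_biUnion _ fun G hG => hS.measurableSet G (mem_children.1 hG).1)

theorem glue_of_mem_child (hS : IsLaminar (S : Set (Set X))) {F G : Set X} (hG : G ∈ children S F) {x : X} (hx : x ∈ G)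
    (u : X → ℝ≥0∞) (v : Set X → X → ℝ≥0∞) : glue S F u v x = v G x := by
  have h1 : x ∉ residue S F := fun h => h.2 (Set.mem_biUnion hG hx)
  rw [glue, Set.indicator_of_notMem h1, zero_add, Finset.sum_eq_single_of_mem G hG,
    Set.indicator_of_mem hx]
  intro H hH hne
  exact Set.indicator_of_notMem (fun hxH => hne (eq_of_mem_children hS hH hG hxH hx)) _

omit [MeasurableSpace X] in
theorem glue_of_mem_residue {F : Set X} {x : X} (hx : x ∈ residue S F)
    (u : X → ℝ≥0∞) (v : Set X → X → ℝ≥0∞) : glue S F u v x = u x := by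
  rw [glue, Set.indicator_of_mem hx, Finset.sum_eq_zero, add_zero]
  intro H hH
  exact Set.indicator_of_notMem (fun hxH => hx.2 (Set.mem_biUnion hH hxH)) _

omit [MeasurableSpace X] in
theorem mem_residue_or {F : Set X} {x : X} (hx : x ∈ F) :
    x ∈ residue S F ∨ ∃ G ∈ children S F, x ∈ G := by
  by_cases h : x ∈ ⋃ G ∈ children S F, G
  · right; simpa using h
  · exact Or.inl ⟨hx, h⟩

theorem measurable_glue (hS : IsLaminar (S : Set (Set X))) {F : Set X} (hF : F ∈ S) {u : X → ℝ≥0∞} (hu : Measurable u)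
    {v : Set X → X → ℝ≥0∞} (hv : ∀ G, Measurable (v G)) : Measurable (glue S F u v) := by
  refine (hu.indicator (measurableSet_residue hS hF)).add ?_
  exact Finset.measurable_fun_sum _ fun G hG =>
    (hv G).indicator (hS.measurableSet G (mem_children.1 hG).1)

theorem setLIntegral_glue (hS : IsLaminar (S : Set (Set X))) {μ : Measure X} {F : Set X} (hF : F ∈ S) {u : X → ℝ≥0∞}
    (hu : Measurable u) {v : Set X → X → ℝ≥0∞} (hv : ∀ G, Measurable (v G)) {Q : Set X} :
    ∫⁻ x in Q, glue S F u v x ∂μ =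
      ∫⁻ x in residue S F ∩ Q, u x ∂μ + ∑ G ∈ children S F, ∫⁻ x in G ∩ Q, v G x ∂μ := by
  have hm : ∀ G ∈ children S F, MeasurableSet G := fun G hG =>
    hS.measurableSet G (mem_children.1 hG).1
  unfold glue
  rw [lintegral_add_left (hu.indicator (measurableSet_residue hS hF)),
    lintegral_finsetSum' _ fun G hG => ((hv G).indicator (hm G hG)).aemeasurable,
    lintegral_indicator (measurableSet_residue hS hF),
    Measure.restrict_restrict (measurableSet_residue hS hF)]
  congr 1
  refine Finset.sum_congr rfl fun G hG => ?_
  rw [lintegral_indicator (hm G hG), Measure.restrict_restrict (hm G hG)]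

/-- Hölder's inequality on a stopping set, after averaging over its children. -/
theorem local_sum_le (hS : IsLaminar (S : Set (Set X))) {B : Finset (Set X)} (hBS : IsLaminar ((S : Set (Set X)) ∪ B)) {F : Set X}
    (hF : F ∈ S) (hBF : ∀ Q ∈ B, Q ⊆ F) (hmin : ∀ Q ∈ B, ∀ G ∈ S, Q ⊆ G → F ⊆ G)
    {μ : Measure X} (hμ : ∀ G ∈ S, μ G ≠ ∞) {f : X → ℝ≥0∞} (hf : Measurable f) {p r : ℝ}
    (hpr : p.HolderConjugate r) (c : Set X → ℝ≥0∞) :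
    ∑ Q ∈ B, c Q * ∫⁻ x in Q, f x ∂μ ≤
      (∫⁻ x in F, (∑ Q ∈ B, c Q * Q.indicator 1 x) ^ r ∂μ) ^ (1 / r) *
        (∫⁻ x in residue S F, f x ^ p ∂μ + ∑ G ∈ children S F, avg μ f G ^ p * μ G) ^ (1 / p) := by
  have hBm : ∀ Q ∈ B, MeasurableSet Q := fun Q hQ => hBS.measurableSet Q (Or.inr hQ)
  have hFm := hS.measurableSet F hF
  set φ := glue S F f fun G _ => avg μ f G with hφ
  have hφm : Measurable φ := measurable_glue hS hF hf fun G => measurable_const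
  -- By `hmin`, `Q` lies in no child of `F`, so each child is inside `Q` or disjoint from it.
  -- Averaging `f` over the children therefore leaves its integral over `Q` unchanged.
  have hint : ∀ Q ∈ B, ∫⁻ x in Q, f x ∂μ = ∫⁻ x in Q, φ x ∂μ := by
    intro Q hQ
    -- Writing `f` itself as a glued function allows the two integrals to be compared piece by
    -- piece.
    have h1 : ∫⁻ x in Q, f x ∂μ = ∫⁻ x in Q, glue S F f (fun _ => f) x ∂μ := by
      refine setLIntegral_congr_fun (hBm Q hQ) fun x hx => ?_
      rcases mem_residue_or (S := S) (hBF Q hQ hx) with h | ⟨G, hG, hxG⟩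
      · simp only [glue_of_mem_residue h]
      · simp only [glue_of_mem_child hS hG hxG]
    rw [h1, hφ, setLIntegral_glue hS hF hf fun _ => hf,
      setLIntegral_glue hS hF hf fun _ => measurable_const]
    congr 1
    refine Finset.sum_congr rfl fun G hG => ?_
    have hG' := mem_children.1 hG
    rcases hBS.nested G (Or.inl hG'.1) Q (Or.inr hQ) with h | h | h
    · rw [Set.inter_eq_left.2 h, setLIntegral_const, avg_mul (hμ G hG'.1)]
    · exact absurd (hmin Q hQ G hG'.1 h) hG'.2.1.2
    · rw [h.inter_eq]; simp
  have hpow : ∫⁻ x in F, φ x ^ p ∂μ =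
      ∫⁻ x in residue S F, f x ^ p ∂μ + ∑ G ∈ children S F, avg μ f G ^ p * μ G := by
    have h1 : ∫⁻ x in F, φ x ^ p ∂μ =
        ∫⁻ x in F, glue S F (fun x => f x ^ p) (fun G _ => avg μ f G ^ p) x ∂μ := by
      refine setLIntegral_congr_fun hFm fun x hx => ?_
      rcases mem_residue_or (S := S) hx with h | ⟨G, hG, hxG⟩
      · simp only [hφ, glue_of_mem_residue h]
      · simp only [hφ, glue_of_mem_child hS hG hxG]
    rw [h1, setLIntegral_glue hS hF (hf.pow_const p) fun _ => measurable_const]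
    congr 1
    · rw [Set.inter_eq_left.2 (show residue S F ⊆ F from fun x hx => hx.1)]
    · refine Finset.sum_congr rfl fun G hG => ?_
      rw [setLIntegral_const, Set.inter_eq_left.2 (mem_children.1 hG).2.1.1]
  have hgm : Measurable fun x => ∑ Q ∈ B, c Q * Q.indicator (1 : X → ℝ≥0∞) x :=
    Finset.measurable_fun_sum _ fun Q hQ => (measurable_one.indicator (hBm Q hQ)).const_mul _
  calc ∑ Q ∈ B, c Q * ∫⁻ x in Q, f x ∂μ
      = ∑ Q ∈ B, ∫⁻ x in F, c Q * Q.indicator (1 : X → ℝ≥0∞) x * φ x ∂μ := by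
        refine Finset.sum_congr rfl fun Q hQ => ?_
        rw [hint Q hQ]
        simp_rw [mul_assoc]
        rw [lintegral_const_mul _ (f := fun x => Q.indicator (1 : X → ℝ≥0∞) x * φ x)
          ((measurable_one.indicator (hBm Q hQ)).mul hφm)]
        congr 1
        have : ∀ x, Q.indicator (1 : X → ℝ≥0∞) x * φ x = Q.indicator φ x := fun x => by
          by_cases hx : x ∈ Q <;> simp [hx]
        simp_rw [this]
        rw [lintegral_indicator (hBm Q hQ), Measure.restrict_restrict (hBm Q hQ),
          Set.inter_eq_left.2 (hBF Q hQ)]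
    _ = ∫⁻ x in F, (∑ Q ∈ B, c Q * Q.indicator (1 : X → ℝ≥0∞) x) * φ x ∂μ := by
        rw [← lintegral_finsetSum' (f := fun Q x => c Q * Q.indicator (1 : X → ℝ≥0∞) x * φ x) _
          fun Q hQ =>
          (((measurable_one.indicator (hBm Q hQ)).const_mul _).mul hφm).aemeasurable]
        simp_rw [Finset.sum_mul]
    _ ≤ _ := by
        rw [← hpow]
        exact ENNReal.lintegral_mul_le_Lp_mul_Lq _ hpr.symm hgm.aemeasurable hφm.aemeasurable

/-- The residues are pairwise disjoint, and each member of `S` is a child of at most one other. -/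
theorem sum_residue_add_children_le (hS : IsLaminar (S : Set (Set X))) {μ : Measure X} (u : X → ℝ≥0∞) (a : Set X → ℝ≥0∞) :
    ∑ F ∈ S, (∫⁻ x in residue S F, u x ∂μ + ∑ G ∈ children S F, a G) ≤
      ∫⁻ x, u x ∂μ + ∑ F ∈ S, a F := by
  rw [Finset.sum_add_distrib]
  refine add_le_add ?_ ?_
  · have hdis : Set.PairwiseDisjoint (S : Set (Set X)) (residue S) := by
      intro F hF G hG hne
      rw [Function.onFun, Set.disjoint_left]
      exact fun x hxF hxG => hne (eq_of_mem_residue hS hF hG hxF hxG)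
    rw [← lintegral_biUnion_finset hdis fun F hF => measurableSet_residue hS hF]
    exact setLIntegral_le_lintegral _ _
  · have hdis : Set.PairwiseDisjoint (S : Set (Set X)) (children S) := by
      intro F hF G hG hne
      rw [Function.onFun, Finset.disjoint_left]
      exact fun H hHF hHG => hne (eq_of_mem_children' hS hF hG hHF hHG)
    rw [← Finset.sum_biUnion hdis]
    refine Finset.sum_le_sum_of_subset fun G hG => ?_
    obtain ⟨F, _, hGF⟩ := Finset.mem_biUnion.1 hG
    exact (mem_children.1 hGF).1

end

/-! ### The dyadic trilinear inequality. -/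

section

open scoped Classical

variable {X : Type*} [MeasurableSpace X]

/-- The testing inequality for finite sums over members of `𝒟` contained in a fixed member. -/
def TestingBound (𝒟 : Set (Set X)) (lam : Set X → ℝ≥0∞) (ρ μ ν : Measure X) (r s t : ℝ)
    (T : ℝ≥0∞) : Prop :=
  ∀ F ∈ 𝒟, ∀ B : Finset (Set X), (B : Set (Set X)) ⊆ 𝒟 → (∀ Q ∈ B, Q ⊆ F) →
    (∫⁻ x in F, (∑ Q ∈ B, lam Q * (μ Q * ν Q) * Q.indicator 1 x) ^ r ∂ρ) ^ (1 / r) ≤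
      T * (μ F ^ (1 / s) * ν F ^ (1 / t))

theorem TestingBound.swap {𝒟 : Set (Set X)} {lam : Set X → ℝ≥0∞} {ρ μ ν : Measure X} {r s t : ℝ}
    {T : ℝ≥0∞} (h : TestingBound 𝒟 lam ρ μ ν r s t T) : TestingBound 𝒟 lam ρ ν μ r t s T := by
  intro F hF B hB hBF
  have := h F hF B hB hBF
  rw [mul_comm (ν F ^ _)]
  simpa only [mul_comm (ν _)] using this

/-- The members of a laminar family that contain a given nonempty member form a chain. -/
theorem exists_least_superset {𝒟 : Set (Set X)} (h𝒟 : IsLaminar 𝒟) {S : Finset (Set X)}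
    (hS : (S : Set (Set X)) ⊆ 𝒟) {Q : Set X} (hQ : Q ∈ 𝒟) (hex : ∃ F ∈ S, Q ⊆ F) :
    ∃ F ∈ S, Q ⊆ F ∧ ∀ G ∈ S, Q ⊆ G → F ⊆ G := by
  obtain ⟨F₀, hF₀, hQF₀⟩ := hex
  obtain ⟨F, _, hF⟩ := (S.filter fun F => Q ⊆ F).exists_le_minimal (a := F₀) (by simp [hF₀, hQF₀])
  have hFm := Finset.mem_filter.1 hF.prop
  refine ⟨F, hFm.1, hFm.2, fun G hG hQG => ?_⟩
  obtain ⟨x, hx⟩ := h𝒟.nonempty Q hQ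
  rcases h𝒟.subset_or_subset (hS hFm.1) (hS hG) (hFm.2 hx) (hQG hx) with h | h
  · exact h
  · exact hF.le_of_le (Finset.mem_filter.2 ⟨hG, hQG⟩) h

/-- The largest average of `f` over the members of `S` containing `F`. -/
def stopValue (μ : Measure X) (f : X → ℝ≥0∞) (S : Finset (Set X)) (F : Set X) : ℝ≥0∞ :=
  (S.filter fun G => F ⊆ G).sup (avg μ f)

/-- The supremum is attained at some `G ⊇ F`. Enlarging `μ F` to `μ G` leaves the `p`-th root of an
energy, which is at most the norm by Jensen. -/
theorem stopValue_mul_rpow_le {μ : Measure X} {f : X → ℝ≥0∞} (hf : Measurable f)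
    {S : Finset (Set X)} (hμ : ∀ Q ∈ S, μ Q ≠ ∞) {p : ℝ} (hp : 1 < p)
    (hfp : ∫⁻ x, f x ^ p ∂μ ≤ 1) (F : Set X) :
    stopValue μ f S F * μ F ^ (1 / p) ≤ 1 := by
  rcases (S.filter fun G => F ⊆ G).eq_empty_or_nonempty with h | h
  · simp [stopValue, h]
  obtain ⟨G, hG, hGe⟩ := Finset.exists_mem_eq_sup _ h (avg μ f)
  rw [Finset.mem_filter] at hG
  rw [stopValue, hGe]
  calc avg μ f G * μ F ^ (1 / p) ≤ avg μ f G * μ G ^ (1 / p) := by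
        exact mul_le_mul_right (ENNReal.rpow_le_rpow (measure_mono hG.2) (by positivity)) _
    _ ≤ (∫⁻ x in G, f x ^ p ∂μ) ^ (1 / p) := avg_mul_rpow_le hf (hμ G hG.1) hp
    _ ≤ 1 := by
        refine ENNReal.rpow_le_one ((setLIntegral_le_lintegral _ _).trans hfp) ?_
        positivity

/-- The core estimate. The family `S₂ ∪ S₃` is adapted to `f₂` and `f₃` but not to `f₁`, so the
energies of `f₁` on it must be summable by hypothesis (`hK₁`). `S₂` and `S₃` are kept general so
that the weak inequality can use a one-element `S₃`. -/
theorem sum_le_of_principal {𝒟 : Set (Set X)} (h𝒟 : IsLaminar 𝒟) {lam : Set X → ℝ≥0∞}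
    {μ₁ μ₂ μ₃ : Measure X} (hμ₁ : ∀ Q ∈ 𝒟, μ₁ Q ≠ ∞) (hμ₂ : ∀ Q ∈ 𝒟, μ₂ Q ≠ ∞)
    (hμ₃ : ∀ Q ∈ 𝒟, μ₃ Q ≠ ∞) {p₁ p₂ p₃ r : ℝ} (hpr : p₁.HolderConjugate r) (hp₂ : 1 < p₂)
    (hp₃ : 1 < p₃) (h₁₂ : 1 ≤ 1 / p₁ + 1 / p₂) (h₁₃ : 1 ≤ 1 / p₁ + 1 / p₃) {T : ℝ≥0∞}
    (hT : TestingBound 𝒟 lam μ₁ μ₂ μ₃ r p₂ p₃ T) {f₁ f₂ f₃ : X → ℝ≥0∞} (hf₁ : Measurable f₁)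
    (hf₂ : Measurable f₂) (hf₃ : Measurable f₃) (hn₁ : ∫⁻ x, f₁ x ^ p₁ ∂μ₁ ≤ 1)
    (hn₂ : ∫⁻ x, f₂ x ^ p₂ ∂μ₂ ≤ 1) (hn₃ : ∫⁻ x, f₃ x ^ p₃ ∂μ₃ ≤ 1)
    {A S₂ S₃ : Finset (Set X)} (hA : (A : Set (Set X)) ⊆ 𝒟) (hS₂ : (S₂ : Set (Set X)) ⊆ 𝒟)
    (hS₃ : (S₃ : Set (Set X)) ⊆ 𝒟) {K₁ K₂ K₃ : ℝ≥0∞} (hP₂ : IsPrincipal μ₂ f₂ p₂ A S₂ K₂)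
    (hP₃ : IsPrincipal μ₃ f₃ p₃ A S₃ K₃) (hK₁ : ∑ F ∈ S₂ ∪ S₃, avg μ₁ f₁ F ^ p₁ * μ₁ F ≤ K₁) :
    ∑ Q ∈ A, lam Q * ((∫⁻ x in Q, f₁ x ∂μ₁) * ((∫⁻ x in Q, f₂ x ∂μ₂) * ∫⁻ x in Q, f₃ x ∂μ₃)) ≤
      4 * (K₂ ^ (1 / p₂) + K₃ ^ (1 / p₃)) * (1 + K₁) ^ (1 / p₁) * T := by
  have hp₁0 := hpr.pos
  have hp₂0 : 0 < p₂ := by linarith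
  have hp₃0 : 0 < p₃ := by linarith
  set S := S₂ ∪ S₃ with hSdef
  have hS : (S : Set (Set X)) ⊆ 𝒟 := by
    intro F hF
    rcases Finset.mem_union.1 hF with h | h
    · exact hS₂ h
    · exact hS₃ h
  have hπ : ∀ Q ∈ A, ∃ F ∈ S, Q ⊆ F ∧ ∀ G ∈ S, Q ⊆ G → F ⊆ G := fun Q hQ => by
    obtain ⟨F, hF, hQF, _⟩ := hP₂.cover Q hQ
    exact exists_least_superset h𝒟 hS (hA hQ) ⟨F, Finset.mem_union_left _ hF, hQF⟩
  choose! π hπS hπQ hπm using hπ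
  set τ₂ := stopValue μ₂ f₂ S₂ with hτ₂
  set τ₃ := stopValue μ₃ f₃ S₃ with hτ₃
  have hav₂ : ∀ Q ∈ A, avg μ₂ f₂ Q ≤ 2 * τ₂ (π Q) := fun Q hQ => by
    obtain ⟨G, hG, hQG, hle⟩ := hP₂.cover Q hQ
    refine hle.trans ?_
    gcongr
    exact Finset.le_sup (f := avg μ₂ f₂)
      (Finset.mem_filter.2 ⟨hG, hπm Q hQ G (Finset.mem_union_left _ hG) hQG⟩)
  have hav₃ : ∀ Q ∈ A, avg μ₃ f₃ Q ≤ 2 * τ₃ (π Q) := fun Q hQ => by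
    obtain ⟨G, hG, hQG, hle⟩ := hP₃.cover Q hQ
    refine hle.trans ?_
    gcongr
    exact Finset.le_sup (f := avg μ₃ f₃)
      (Finset.mem_filter.2 ⟨hG, hπm Q hQ G (Finset.mem_union_right _ hG) hQG⟩)
  set b : Set X → ℝ≥0∞ := fun F => ∫⁻ x in residue S F, f₁ x ^ p₁ ∂μ₁ +
    ∑ G ∈ children S F, avg μ₁ f₁ G ^ p₁ * μ₁ G with hb
  set u₂ : Set X → ℝ≥0∞ := fun F => τ₂ F * μ₂ F ^ (1 / p₂) with hu₂
  set u₃ : Set X → ℝ≥0∞ := fun F => τ₃ F * μ₃ F ^ (1 / p₃) with hu₃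
  have hu₂1 : ∀ F, u₂ F ≤ 1 := stopValue_mul_rpow_le hf₂ (fun Q hQ => hμ₂ Q (hS₂ hQ)) hp₂ hn₂
  have hu₃1 : ∀ F, u₃ F ≤ 1 := stopValue_mul_rpow_le hf₃ (fun Q hQ => hμ₃ Q (hS₃ hQ)) hp₃ hn₃
  have hSb : ∑ F ∈ S, b F ≤ 1 + K₁ :=
    (sum_residue_add_children_le (h𝒟.mono hS) _ _).trans (add_le_add hn₁ hK₁)
  -- One group of cubes: the factor `4` comes from freezing two averages, each up to a factor `2`;
  -- `hloc` and the testing bound do the rest.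
  have hfib : ∀ F ∈ S, ∑ Q ∈ A.filter (fun Q => π Q = F), lam Q * ((∫⁻ x in Q, f₁ x ∂μ₁) *
      ((∫⁻ x in Q, f₂ x ∂μ₂) * ∫⁻ x in Q, f₃ x ∂μ₃)) ≤ 4 * T * (u₂ F * u₃ F * b F ^ (1 / p₁)) := by
    intro F hF
    set B := A.filter fun Q => π Q = F with hB
    have hBA : ∀ Q ∈ B, Q ∈ A ∧ π Q = F := fun Q hQ => Finset.mem_filter.1 hQ
    have hBF : ∀ Q ∈ B, Q ⊆ F := fun Q hQ => (hBA Q hQ).2 ▸ hπQ Q (hBA Q hQ).1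
    have hB𝒟 : (B : Set (Set X)) ⊆ 𝒟 := fun Q hQ => hA (hBA Q hQ).1
    have hloc := local_sum_le (h𝒟.mono hS) (B := B) (h𝒟.mono (Set.union_subset hS hB𝒟)) hF hBF
      (fun Q hQ G hG hQG => (hBA Q hQ).2 ▸ hπm Q (hBA Q hQ).1 G hG hQG)
      (fun G hG => hμ₁ G (hS hG)) hf₁ hpr (fun Q => lam Q * (μ₂ Q * μ₃ Q))
    have hTF := hT F (hS hF) B hB𝒟 hBF
    calc _ ≤ ∑ Q ∈ B, (4 * (τ₂ F * τ₃ F)) * (lam Q * (μ₂ Q * μ₃ Q) * ∫⁻ x in Q, f₁ x ∂μ₁) := by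
          refine Finset.sum_le_sum fun Q hQ => ?_
          have hQA := (hBA Q hQ).1
          have e2 := hav₂ Q hQA
          have e3 := hav₃ Q hQA
          rw [(hBA Q hQ).2] at e2 e3
          rw [← avg_mul (hμ₂ Q (hA hQA)), ← avg_mul (hμ₃ Q (hA hQA))]
          calc _ ≤ lam Q * ((∫⁻ x in Q, f₁ x ∂μ₁) *
                ((2 * τ₂ F * μ₂ Q) * (2 * τ₃ F * μ₃ Q))) := by gcongr
            _ = _ := by ring
      _ = 4 * (τ₂ F * τ₃ F) * ∑ Q ∈ B, lam Q * (μ₂ Q * μ₃ Q) * ∫⁻ x in Q, f₁ x ∂μ₁ :=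
          (Finset.mul_sum _ _ _).symm
      _ ≤ 4 * (τ₂ F * τ₃ F) * (T * (μ₂ F ^ (1 / p₂) * μ₃ F ^ (1 / p₃)) * b F ^ (1 / p₁)) := by
          gcongr
          exact hloc.trans (by gcongr)
      _ = _ := by simp only [hu₂, hu₃]; ring
  have hpow : ∀ (a m : ℝ≥0∞) (p : ℝ), 0 < p → a * m ^ (1 / p) = (a ^ p * m) ^ (1 / p) := by
    intro a m p hp
    rw [ENNReal.mul_rpow_of_nonneg _ _ (one_div_nonneg.2 hp.le), ← ENNReal.rpow_mul,
      mul_one_div_cancel hp.ne', ENNReal.rpow_one]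
  -- For `F` in `S₂` the factor `u₃ F` is bounded by `1`, while `τ₂ F` is at most the average of
  -- `f₂` on `F` itself because averages on `S₂` do not increase with the set. This leaves an energy
  -- of `f₂` against `b F`, and the condition on `1 / p₁ + 1 / p₂` allows summation. For `S₃` the
  -- roles of `f₂` and `f₃` are exchanged.
  have hsum₂ : ∑ F ∈ S₂, u₂ F * u₃ F * b F ^ (1 / p₁) ≤ K₂ ^ (1 / p₂) * (1 + K₁) ^ (1 / p₁) := by
    calc _ ≤ ∑ F ∈ S₂, (avg μ₂ f₂ F ^ p₂ * μ₂ F) ^ (1 / p₂) * b F ^ (1 / p₁) := by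
          refine Finset.sum_le_sum fun F hF => ?_
          gcongr
          rw [← hpow _ _ _ hp₂0]
          calc u₂ F * u₃ F ≤ u₂ F * 1 := by gcongr; exact hu₃1 F
            _ = u₂ F := mul_one _
            _ ≤ _ := by
              simp only [hu₂]
              gcongr
              refine Finset.sup_le fun G hG => ?_
              rw [Finset.mem_filter] at hG
              exact hP₂.anti F hF G hG.1 hG.2
      _ ≤ (∑ F ∈ S₂, avg μ₂ f₂ F ^ p₂ * μ₂ F) ^ (1 / p₂) * (∑ F ∈ S₂, b F) ^ (1 / p₁) :=
          sum_rpow_mul_rpow_le _ _ _ (one_div_pos.2 hp₂0) (one_div_pos.2 hp₁0) (by linarith)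
      _ ≤ _ := by
          gcongr
          · exact hP₂.sum_le
          · exact (Finset.sum_le_sum_of_subset Finset.subset_union_left).trans hSb
  have hsum₃ : ∑ F ∈ S₃, u₂ F * u₃ F * b F ^ (1 / p₁) ≤ K₃ ^ (1 / p₃) * (1 + K₁) ^ (1 / p₁) := by
    calc _ ≤ ∑ F ∈ S₃, (avg μ₃ f₃ F ^ p₃ * μ₃ F) ^ (1 / p₃) * b F ^ (1 / p₁) := by
          refine Finset.sum_le_sum fun F hF => ?_
          gcongr
          rw [← hpow _ _ _ hp₃0]
          calc u₂ F * u₃ F ≤ 1 * u₃ F := by gcongr; exact hu₂1 F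
            _ = u₃ F := one_mul _
            _ ≤ _ := by
              simp only [hu₃]
              gcongr
              refine Finset.sup_le fun G hG => ?_
              rw [Finset.mem_filter] at hG
              exact hP₃.anti F hF G hG.1 hG.2
      _ ≤ (∑ F ∈ S₃, avg μ₃ f₃ F ^ p₃ * μ₃ F) ^ (1 / p₃) * (∑ F ∈ S₃, b F) ^ (1 / p₁) :=
          sum_rpow_mul_rpow_le _ _ _ (one_div_pos.2 hp₃0) (one_div_pos.2 hp₁0) (by linarith)
      _ ≤ _ := by
          gcongr
          · exact hP₃.sum_le
          · exact (Finset.sum_le_sum_of_subset Finset.subset_union_right).trans hSb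
  rw [← Finset.sum_fiberwise_of_maps_to hπS]
  calc _ ≤ ∑ F ∈ S, 4 * T * (u₂ F * u₃ F * b F ^ (1 / p₁)) := Finset.sum_le_sum hfib
    _ = 4 * T * ∑ F ∈ S, u₂ F * u₃ F * b F ^ (1 / p₁) := (Finset.mul_sum _ _ _).symm
    _ ≤ 4 * T * (∑ F ∈ S₂, u₂ F * u₃ F * b F ^ (1 / p₁) +
          ∑ F ∈ S₃, u₂ F * u₃ F * b F ^ (1 / p₁)) := by
        gcongr
        rw [← Finset.sum_union_inter]
        exact le_self_add
    _ ≤ 4 * T * (K₂ ^ (1 / p₂) * (1 + K₁) ^ (1 / p₁) + K₃ ^ (1 / p₃) * (1 + K₁) ^ (1 / p₁)) := by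
        gcongr
    _ = _ := by ring

/-- The constant for the cubes on which the first function has the smallest energy. -/
def classConst (p₁ p₂ p₃ : ℝ) : ℝ≥0∞ :=
  4 * (carlesonConst p₂ ^ (1 / p₂) + carlesonConst p₃ ^ (1 / p₃)) *
    (1 + (carlesonConst p₂ + carlesonConst p₃)) ^ (1 / p₁)

theorem classConst_ne_top {p₁ p₂ p₃ : ℝ} (hp₁ : 1 < p₁) (hp₂ : 1 < p₂) (hp₃ : 1 < p₃) :
    classConst p₁ p₂ p₃ ≠ ∞ := by
  have h1 : (0 : ℝ) ≤ 1 / p₁ := by positivity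
  have h2 : (0 : ℝ) ≤ 1 / p₂ := by positivity
  have h3 : (0 : ℝ) ≤ 1 / p₃ := by positivity
  have c2 := carlesonConst_ne_top hp₂
  have c3 := carlesonConst_ne_top hp₃
  simp only [classConst]
  refine ENNReal.mul_ne_top (ENNReal.mul_ne_top (by norm_num) (ENNReal.add_ne_top.2 ⟨?_, ?_⟩)) ?_
  · exact ENNReal.rpow_ne_top_of_nonneg h2 c2
  · exact ENNReal.rpow_ne_top_of_nonneg h3 c3
  · exact ENNReal.rpow_ne_top_of_nonneg h1 (by simp [c2, c3])

/-- When `f₁` has the smallest energy on every cube, its energies over `S₂ ∪ S₃` are paid for by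
those of `f₂` over `S₂` and of `f₃` over `S₃`. -/
theorem sum_le_of_energy_le {𝒟 : Set (Set X)} (h𝒟 : IsLaminar 𝒟) {lam : Set X → ℝ≥0∞}
    {μ₁ μ₂ μ₃ : Measure X} (hμ₁ : ∀ Q ∈ 𝒟, μ₁ Q ≠ ∞) (hμ₂ : ∀ Q ∈ 𝒟, μ₂ Q ≠ ∞)
    (hμ₃ : ∀ Q ∈ 𝒟, μ₃ Q ≠ ∞) {p₁ p₂ p₃ r : ℝ} (hpr : p₁.HolderConjugate r) (hp₂ : 1 < p₂)
    (hp₃ : 1 < p₃) (h₁₂ : 1 ≤ 1 / p₁ + 1 / p₂) (h₁₃ : 1 ≤ 1 / p₁ + 1 / p₃) {T : ℝ≥0∞}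
    (hT : TestingBound 𝒟 lam μ₁ μ₂ μ₃ r p₂ p₃ T) {f₁ f₂ f₃ : X → ℝ≥0∞} (hf₁ : Measurable f₁)
    (hf₂ : Measurable f₂) (hf₃ : Measurable f₃) (hn₁ : ∫⁻ x, f₁ x ^ p₁ ∂μ₁ ≤ 1)
    (hn₂ : ∫⁻ x, f₂ x ^ p₂ ∂μ₂ ≤ 1) (hn₃ : ∫⁻ x, f₃ x ^ p₃ ∂μ₃ ≤ 1)
    {A : Finset (Set X)} (hA : (A : Set (Set X)) ⊆ 𝒟)
    (hpos₂ : ∀ Q ∈ A, avg μ₂ f₂ Q ≠ 0) (hpos₃ : ∀ Q ∈ A, avg μ₃ f₃ Q ≠ 0)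
    (ha₂ : ∀ Q ∈ A, avg μ₁ f₁ Q ^ p₁ * μ₁ Q ≤ avg μ₂ f₂ Q ^ p₂ * μ₂ Q)
    (ha₃ : ∀ Q ∈ A, avg μ₁ f₁ Q ^ p₁ * μ₁ Q ≤ avg μ₃ f₃ Q ^ p₃ * μ₃ Q) :
    ∑ Q ∈ A, lam Q * ((∫⁻ x in Q, f₁ x ∂μ₁) * ((∫⁻ x in Q, f₂ x ∂μ₂) * ∫⁻ x in Q, f₃ x ∂μ₃)) ≤
      classConst p₁ p₂ p₃ * T := by
  obtain ⟨S₂, hS₂, hP₂⟩ := exists_isPrincipal hp₂ (h𝒟.mono hA) (fun Q hQ => hμ₂ Q (hA hQ)) hf₂ hn₂ hpos₂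
  obtain ⟨S₃, hS₃, hP₃⟩ := exists_isPrincipal hp₃ (h𝒟.mono hA) (fun Q hQ => hμ₃ Q (hA hQ)) hf₃ hn₃ hpos₃
  refine sum_le_of_principal h𝒟 hμ₁ hμ₂ hμ₃ hpr hp₂ hp₃ h₁₂ h₁₃ hT hf₁ hf₂ hf₃ hn₁ hn₂ hn₃ hA
    (fun Q hQ => hA (hS₂ hQ)) (fun Q hQ => hA (hS₃ hQ)) hP₂ hP₃ ?_
  calc ∑ F ∈ S₂ ∪ S₃, avg μ₁ f₁ F ^ p₁ * μ₁ F
      ≤ ∑ F ∈ S₂, avg μ₁ f₁ F ^ p₁ * μ₁ F + ∑ F ∈ S₃, avg μ₁ f₁ F ^ p₁ * μ₁ F := by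
        rw [← Finset.sum_union_inter]; exact le_self_add
    _ ≤ _ := add_le_add
        ((Finset.sum_le_sum fun F hF => ha₂ F (hS₂ hF)).trans hP₂.sum_le)
        ((Finset.sum_le_sum fun F hF => ha₃ F (hS₃ hF)).trans hP₃.sum_le)

/-- The constant in the dyadic trilinear inequality. -/
def trilinearConst (p₁ p₂ p₃ : ℝ) : ℝ≥0∞ :=
  classConst p₁ p₂ p₃ + classConst p₂ p₁ p₃ + classConst p₃ p₁ p₂

theorem trilinearConst_ne_top {p₁ p₂ p₃ : ℝ} (hp₁ : 1 < p₁) (hp₂ : 1 < p₂) (hp₃ : 1 < p₃) :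
    trilinearConst p₁ p₂ p₃ ≠ ∞ := by
  simp [trilinearConst, classConst_ne_top, hp₁, hp₂, hp₃]

theorem le_add_ite {P Q R : Prop} [Decidable P] [Decidable Q] [Decidable R] (h : P ∨ Q ∨ R) (x : ℝ≥0∞) :
    x ≤ (if P then x else 0) + (if Q then x else 0) + (if R then x else 0) := by
  rcases h with h | h | h
  · rw [if_pos h, add_assoc]; exact le_self_add
  · rw [if_pos h, add_right_comm]; exact le_add_self
  · rw [if_pos h]; exact le_add_self

theorem trilinear_le_of_unit {𝒟 : Set (Set X)} (h𝒟 : IsLaminar 𝒟) {lam : Set X → ℝ≥0∞}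
    {μ₁ μ₂ μ₃ : Measure X} (hμ₁ : ∀ Q ∈ 𝒟, μ₁ Q ≠ ∞) (hμ₂ : ∀ Q ∈ 𝒟, μ₂ Q ≠ ∞)
    (hμ₃ : ∀ Q ∈ 𝒟, μ₃ Q ≠ ∞) {p₁ p₂ p₃ r₁ r₂ r₃ : ℝ} (hpr₁ : p₁.HolderConjugate r₁)
    (hpr₂ : p₂.HolderConjugate r₂) (hpr₃ : p₃.HolderConjugate r₃)
    (h₁₂ : 1 ≤ 1 / p₁ + 1 / p₂) (h₁₃ : 1 ≤ 1 / p₁ + 1 / p₃) (h₂₃ : 1 ≤ 1 / p₂ + 1 / p₃)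
    {T₁ T₂ T₃ : ℝ≥0∞} (hT₁ : TestingBound 𝒟 lam μ₁ μ₂ μ₃ r₁ p₂ p₃ T₁)
    (hT₂ : TestingBound 𝒟 lam μ₂ μ₁ μ₃ r₂ p₁ p₃ T₂)
    (hT₃ : TestingBound 𝒟 lam μ₃ μ₁ μ₂ r₃ p₁ p₂ T₃) {f₁ f₂ f₃ : X → ℝ≥0∞} (hf₁ : Measurable f₁)
    (hf₂ : Measurable f₂) (hf₃ : Measurable f₃) (hn₁ : ∫⁻ x, f₁ x ^ p₁ ∂μ₁ ≤ 1)
    (hn₂ : ∫⁻ x, f₂ x ^ p₂ ∂μ₂ ≤ 1) (hn₃ : ∫⁻ x, f₃ x ^ p₃ ∂μ₃ ≤ 1)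
    {A : Finset (Set X)} (hA : (A : Set (Set X)) ⊆ 𝒟) :
    ∑ Q ∈ A, lam Q * ((∫⁻ x in Q, f₁ x ∂μ₁) * ((∫⁻ x in Q, f₂ x ∂μ₂) * ∫⁻ x in Q, f₃ x ∂μ₃)) ≤
      trilinearConst p₁ p₂ p₃ * (T₁ + T₂ + T₃) := by
  set g : Set X → ℝ≥0∞ := fun Q => lam Q * ((∫⁻ x in Q, f₁ x ∂μ₁) *
    ((∫⁻ x in Q, f₂ x ∂μ₂) * ∫⁻ x in Q, f₃ x ∂μ₃)) with hg
  set a₁ : Set X → ℝ≥0∞ := fun Q => avg μ₁ f₁ Q ^ p₁ * μ₁ Q with ha₁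
  set a₂ : Set X → ℝ≥0∞ := fun Q => avg μ₂ f₂ Q ^ p₂ * μ₂ Q with ha₂
  set a₃ : Set X → ℝ≥0∞ := fun Q => avg μ₃ f₃ Q ^ p₃ * μ₃ Q with ha₃
  -- Cubes with a vanishing average contribute nothing, and they have no dyadic level on which a
  -- stopping family could be built.
  set A' := A.filter fun Q => avg μ₁ f₁ Q ≠ 0 ∧ avg μ₂ f₂ Q ≠ 0 ∧ avg μ₃ f₃ Q ≠ 0 with hA'
  have hA'𝒟 : ∀ (P : Set X → Prop) [DecidablePred P], ((A'.filter P : Finset (Set X)) : Set (Set X)) ⊆ 𝒟 := by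
    intro P _ Q hQ
    exact hA (Finset.mem_filter.1 (Finset.mem_filter.1 hQ).1).1
  have hzero : ∑ Q ∈ A, g Q = ∑ Q ∈ A', g Q := by
    refine (Finset.sum_filter_of_ne fun Q hQ hne => ?_).symm
    refine ⟨fun h => hne ?_, fun h => hne ?_, fun h => hne ?_⟩
    · simp only [hg, ← avg_mul (hμ₁ Q (hA hQ)), h]; simp
    · simp only [hg, ← avg_mul (hμ₂ Q (hA hQ)), h]; simp
    · simp only [hg, ← avg_mul (hμ₃ Q (hA hQ)), h]; simp
  have hsplit : ∑ Q ∈ A', g Q ≤ ∑ Q ∈ A'.filter (fun Q => a₁ Q ≤ a₂ Q ∧ a₁ Q ≤ a₃ Q), g Q +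
      ∑ Q ∈ A'.filter (fun Q => a₂ Q ≤ a₁ Q ∧ a₂ Q ≤ a₃ Q), g Q +
      ∑ Q ∈ A'.filter (fun Q => a₃ Q ≤ a₁ Q ∧ a₃ Q ≤ a₂ Q), g Q := by
    clear_value A'
    rw [Finset.sum_filter, Finset.sum_filter, Finset.sum_filter, ← Finset.sum_add_distrib,
      ← Finset.sum_add_distrib]
    refine Finset.sum_le_sum fun Q _ => ?_
    refine le_add_ite ?_ _
    rcases le_total (a₁ Q) (a₂ Q) with h | h
    · rcases le_total (a₁ Q) (a₃ Q) with h' | h'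
      · exact Or.inl ⟨h, h'⟩
      · exact Or.inr (Or.inr ⟨h', h'.trans h⟩)
    · rcases le_total (a₂ Q) (a₃ Q) with h' | h'
      · exact Or.inr (Or.inl ⟨h, h'⟩)
      · exact Or.inr (Or.inr ⟨h'.trans h, h'⟩)
  have hmem : ∀ (P : Set X → Prop) [DecidablePred P], ∀ Q ∈ A'.filter P, (avg μ₁ f₁ Q ≠ 0 ∧ avg μ₂ f₂ Q ≠ 0 ∧
      avg μ₃ f₃ Q ≠ 0) ∧ P Q := fun P _ Q hQ =>
    ⟨(Finset.mem_filter.1 (Finset.mem_filter.1 hQ).1).2, (Finset.mem_filter.1 hQ).2⟩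
  have b₁ := sum_le_of_energy_le h𝒟 hμ₁ hμ₂ hμ₃ hpr₁ hpr₂.lt hpr₃.lt h₁₂ h₁₃ hT₁ hf₁ hf₂ hf₃ hn₁ hn₂
    hn₃ (hA'𝒟 fun Q => a₁ Q ≤ a₂ Q ∧ a₁ Q ≤ a₃ Q) (fun Q hQ => (hmem _ Q hQ).1.2.1)
    (fun Q hQ => (hmem _ Q hQ).1.2.2) (fun Q hQ => (hmem _ Q hQ).2.1)
    (fun Q hQ => (hmem _ Q hQ).2.2)
  have b₂ := sum_le_of_energy_le h𝒟 hμ₂ hμ₁ hμ₃ hpr₂ hpr₁.lt hpr₃.lt (by linarith) h₂₃ hT₂ hf₂ hf₁ hf₃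
    hn₂ hn₁ hn₃ (hA'𝒟 fun Q => a₂ Q ≤ a₁ Q ∧ a₂ Q ≤ a₃ Q) (fun Q hQ => (hmem _ Q hQ).1.1)
    (fun Q hQ => (hmem _ Q hQ).1.2.2) (fun Q hQ => (hmem _ Q hQ).2.1)
    (fun Q hQ => (hmem _ Q hQ).2.2)
  have b₃ := sum_le_of_energy_le h𝒟 hμ₃ hμ₁ hμ₂ hpr₃ hpr₁.lt hpr₂.lt (by linarith) (by linarith) hT₃
    hf₃ hf₁ hf₂ hn₃ hn₁ hn₂ (hA'𝒟 fun Q => a₃ Q ≤ a₁ Q ∧ a₃ Q ≤ a₂ Q)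
    (fun Q hQ => (hmem _ Q hQ).1.1) (fun Q hQ => (hmem _ Q hQ).1.2.1)
    (fun Q hQ => (hmem _ Q hQ).2.1) (fun Q hQ => (hmem _ Q hQ).2.2)
  have e₂ : ∀ Q, lam Q * ((∫⁻ x in Q, f₂ x ∂μ₂) * ((∫⁻ x in Q, f₁ x ∂μ₁) *
    ∫⁻ x in Q, f₃ x ∂μ₃)) = g Q := fun Q => by simp only [hg]; ring
  have e₃ : ∀ Q, lam Q * ((∫⁻ x in Q, f₃ x ∂μ₃) * ((∫⁻ x in Q, f₁ x ∂μ₁) *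
    ∫⁻ x in Q, f₂ x ∂μ₂)) = g Q := fun Q => by simp only [hg]; ring
  simp only [e₂] at b₂
  simp only [e₃] at b₃
  calc ∑ Q ∈ A, g Q ≤ _ := hzero.trans_le hsplit
    _ ≤ classConst p₁ p₂ p₃ * T₁ + classConst p₂ p₁ p₃ * T₂ + classConst p₃ p₁ p₂ * T₃ :=
        add_le_add (add_le_add b₁ b₂) b₃
    _ ≤ trilinearConst p₁ p₂ p₃ * T₁ + trilinearConst p₁ p₂ p₃ * T₂ +
          trilinearConst p₁ p₂ p₃ * T₃ := by
        gcongr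
        · rw [trilinearConst, add_assoc]; exact le_self_add
        · rw [trilinearConst, add_right_comm]; exact le_add_self
        · rw [trilinearConst]; exact le_add_self
    _ = _ := by ring

/-- Homogeneity in each function: the normalization is removed one variable at a time, the others
being absorbed in the coefficients. -/
theorem trilinear_le {𝒟 : Set (Set X)} (h𝒟 : IsLaminar 𝒟) {lam : Set X → ℝ≥0∞}
    {μ₁ μ₂ μ₃ : Measure X} (hμ₁ : ∀ Q ∈ 𝒟, μ₁ Q ≠ ∞) (hμ₂ : ∀ Q ∈ 𝒟, μ₂ Q ≠ ∞)
    (hμ₃ : ∀ Q ∈ 𝒟, μ₃ Q ≠ ∞) {p₁ p₂ p₃ r₁ r₂ r₃ : ℝ} (hpr₁ : p₁.HolderConjugate r₁)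
    (hpr₂ : p₂.HolderConjugate r₂) (hpr₃ : p₃.HolderConjugate r₃)
    (h₁₂ : 1 ≤ 1 / p₁ + 1 / p₂) (h₁₃ : 1 ≤ 1 / p₁ + 1 / p₃) (h₂₃ : 1 ≤ 1 / p₂ + 1 / p₃)
    {T₁ T₂ T₃ : ℝ≥0∞} (hT₁ : TestingBound 𝒟 lam μ₁ μ₂ μ₃ r₁ p₂ p₃ T₁)
    (hT₂ : TestingBound 𝒟 lam μ₂ μ₁ μ₃ r₂ p₁ p₃ T₂)
    (hT₃ : TestingBound 𝒟 lam μ₃ μ₁ μ₂ r₃ p₁ p₂ T₃) {f₁ f₂ f₃ : X → ℝ≥0∞} (hf₁ : Measurable f₁)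
    (hf₂ : Measurable f₂) (hf₃ : Measurable f₃) (hn₁ : ∫⁻ x, f₁ x ^ p₁ ∂μ₁ ≠ ∞)
    (hn₂ : ∫⁻ x, f₂ x ^ p₂ ∂μ₂ ≠ ∞) (hn₃ : ∫⁻ x, f₃ x ^ p₃ ∂μ₃ ≠ ∞)
    {A : Finset (Set X)} (hA : (A : Set (Set X)) ⊆ 𝒟) :
    ∑ Q ∈ A, lam Q * ((∫⁻ x in Q, f₁ x ∂μ₁) * ((∫⁻ x in Q, f₂ x ∂μ₂) * ∫⁻ x in Q, f₃ x ∂μ₃)) ≤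
      trilinearConst p₁ p₂ p₃ * (T₁ + T₂ + T₃) * (∫⁻ x, f₁ x ^ p₁ ∂μ₁) ^ (1 / p₁) *
        (∫⁻ x, f₂ x ^ p₂ ∂μ₂) ^ (1 / p₂) * (∫⁻ x, f₃ x ^ p₃ ∂μ₃) ^ (1 / p₃) := by
  have e₁ : ∀ g₁ g₂ g₃ : X → ℝ≥0∞, ∀ Q, lam Q * ((∫⁻ x in Q, g₁ x ∂μ₁) *
      ((∫⁻ x in Q, g₂ x ∂μ₂) * ∫⁻ x in Q, g₃ x ∂μ₃)) =
      lam Q * ((∫⁻ x in Q, g₂ x ∂μ₂) * ∫⁻ x in Q, g₃ x ∂μ₃) * ∫⁻ x in Q, g₁ x ∂μ₁ := by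
    intros; ring
  have e₂ : ∀ g₁ g₂ g₃ : X → ℝ≥0∞, ∀ Q, lam Q * ((∫⁻ x in Q, g₁ x ∂μ₁) *
      ((∫⁻ x in Q, g₂ x ∂μ₂) * ∫⁻ x in Q, g₃ x ∂μ₃)) =
      lam Q * ((∫⁻ x in Q, g₁ x ∂μ₁) * ∫⁻ x in Q, g₃ x ∂μ₃) * ∫⁻ x in Q, g₂ x ∂μ₂ := by
    intros; ring
  have e₃ : ∀ g₁ g₂ g₃ : X → ℝ≥0∞, ∀ Q, lam Q * ((∫⁻ x in Q, g₁ x ∂μ₁) *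
      ((∫⁻ x in Q, g₂ x ∂μ₂) * ∫⁻ x in Q, g₃ x ∂μ₃)) =
      lam Q * ((∫⁻ x in Q, g₁ x ∂μ₁) * ∫⁻ x in Q, g₂ x ∂μ₂) * ∫⁻ x in Q, g₃ x ∂μ₃ := by
    intros; ring
  have s₃ := sum_mul_setLIntegral_le_of_unit hpr₃.lt A (μ := μ₃)
    (fun Q => lam Q * ((∫⁻ x in Q, f₁ x ∂μ₁) * ∫⁻ x in Q, f₂ x ∂μ₂))
    (trilinearConst p₁ p₂ p₃ * (T₁ + T₂ + T₃) * (∫⁻ x, f₁ x ^ p₁ ∂μ₁) ^ (1 / p₁) *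
        (∫⁻ x, f₂ x ^ p₂ ∂μ₂) ^ (1 / p₂)) ?_ hf₃ hn₃
  · simpa only [← e₃] using s₃
  intro g₃ hg₃ hu₃
  have s₂ := sum_mul_setLIntegral_le_of_unit hpr₂.lt A (μ := μ₂)
    (fun Q => lam Q * ((∫⁻ x in Q, f₁ x ∂μ₁) * ∫⁻ x in Q, g₃ x ∂μ₃))
    (trilinearConst p₁ p₂ p₃ * (T₁ + T₂ + T₃) * (∫⁻ x, f₁ x ^ p₁ ∂μ₁) ^ (1 / p₁)) ?_ hf₂ hn₂
  · simpa only [← e₃, ← e₂] using s₂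
  intro g₂ hg₂ hu₂
  have s₁ := sum_mul_setLIntegral_le_of_unit hpr₁.lt A (μ := μ₁)
    (fun Q => lam Q * ((∫⁻ x in Q, g₂ x ∂μ₂) * ∫⁻ x in Q, g₃ x ∂μ₃))
    (trilinearConst p₁ p₂ p₃ * (T₁ + T₂ + T₃)) ?_ hf₁ hn₁
  · simpa only [← e₁, ← e₂] using s₁
  intro g₁ hg₁ hu₁
  simp only [← e₁]
  exact trilinear_le_of_unit h𝒟 hμ₁ hμ₂ hμ₃ hpr₁ hpr₂ hpr₃ h₁₂ h₁₃ h₂₃ hT₁ hT₂ hT₃ hg₁ hg₂ hg₃ hu₁ hu₂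
    hu₃ hA

end

/-! ### Dyadic strong type, and the localized dyadic inequality. -/

section

open scoped Classical

/-- The absorption step of every duality argument below; `I ≠ ∞` is what permits division by `I ^ (1
/ r)`. -/
theorem rpow_le_of_le_mul_rpow {I Y : ℝ≥0∞} {q r : ℝ} (hqr : q.HolderConjugate r) (hI : I ≠ ∞)
    (h : I ≤ Y * I ^ (1 / r)) : I ^ (1 / q) ≤ Y := by
  rcases eq_or_ne I 0 with h0 | h0
  · rw [h0, ENNReal.zero_rpow_of_pos (one_div_pos.2 hqr.pos)]; exact zero_le
  have hne : I ^ (1 / r) ≠ 0 := by simp [h0, hI]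
  have hnt : I ^ (1 / r) ≠ ∞ := ENNReal.rpow_ne_top_of_nonneg (one_div_nonneg.2 hqr.symm.nonneg) hI
  rw [← ENNReal.mul_le_mul_iff_left hne hnt]
  refine le_trans (le_of_eq ?_) h
  rw [← ENNReal.rpow_add _ _ h0 hI, one_div, one_div, hqr.inv_add_inv_eq_one, ENNReal.rpow_one]

variable {X : Type*} [MeasurableSpace X]

/-- The dyadic sum with coefficients `c` over the sets in `A`. -/
def dyadicSum (c : Set X → ℝ≥0∞) (A : Finset (Set X)) (x : X) : ℝ≥0∞ :=
  ∑ Q ∈ A, c Q * Q.indicator 1 x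

theorem measurable_dyadicSum {A : Finset (Set X)} (hA : ∀ Q ∈ A, MeasurableSet Q)
    (c : Set X → ℝ≥0∞) : Measurable (dyadicSum c A) :=
  Finset.measurable_fun_sum _ fun Q hQ => (measurable_one.indicator (hA Q hQ)).const_mul _

omit [MeasurableSpace X] in
theorem dyadicSum_le (c : Set X → ℝ≥0∞) (A : Finset (Set X)) (x : X) :
    dyadicSum c A x ≤ ∑ Q ∈ A, c Q := by
  refine Finset.sum_le_sum fun Q _ => ?_
  by_cases hx : x ∈ Q <;> simp [hx]

omit [MeasurableSpace X] in
theorem dyadicSum_eq_zero {c : Set X → ℝ≥0∞} {A : Finset (Set X)} {x : X} (hx : x ∉ ⋃ Q ∈ A, Q) :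
    dyadicSum c A x = 0 := by
  refine Finset.sum_eq_zero fun Q hQ => ?_
  have : x ∉ Q := fun h => hx (Set.mem_biUnion hQ h)
  simp [this]

theorem lintegral_dyadicSum_mul {A : Finset (Set X)} (hA : ∀ Q ∈ A, MeasurableSet Q)
    (c : Set X → ℝ≥0∞) {μ : Measure X} {g : X → ℝ≥0∞} (hg : Measurable g) :
    ∫⁻ x, dyadicSum c A x * g x ∂μ = ∑ Q ∈ A, c Q * ∫⁻ x in Q, g x ∂μ := by
  have e : ∀ x, dyadicSum c A x * g x = ∑ Q ∈ A, c Q * Q.indicator g x := fun x => by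
    rw [dyadicSum, Finset.sum_mul]
    refine Finset.sum_congr rfl fun Q _ => ?_
    by_cases hx : x ∈ Q <;> simp [hx]
  simp_rw [e]
  rw [lintegral_finsetSum' _ fun Q hQ => ((hg.indicator (hA Q hQ)).const_mul _).aemeasurable]
  refine Finset.sum_congr rfl fun Q hQ => ?_
  rw [lintegral_const_mul _ (hg.indicator (hA Q hQ)), lintegral_indicator (hA Q hQ)]

/-- A finite dyadic sum is bounded and lives on a set of finite measure. This gives the a priori
finiteness needed for absorption, and is why only finite families are treated at first. -/
theorem lintegral_dyadicSum_rpow_ne_top {A : Finset (Set X)} (hA : ∀ Q ∈ A, MeasurableSet Q)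
    {c : Set X → ℝ≥0∞} (hc : ∀ Q ∈ A, c Q ≠ ∞) {μ : Measure X} (hμ : ∀ Q ∈ A, μ Q ≠ ∞) {q : ℝ}
    (hq : 0 < q) : ∫⁻ x, dyadicSum c A x ^ q ∂μ ≠ ∞ := by
  have hm : MeasurableSet (⋃ Q ∈ A, Q) := Finset.measurableSet_biUnion _ hA
  have hle : ∫⁻ x, dyadicSum c A x ^ q ∂μ ≤ (∑ Q ∈ A, c Q) ^ q * μ (⋃ Q ∈ A, Q) := by
    rw [← lintegral_indicator_const hm]
    refine lintegral_mono fun x => ?_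
    by_cases hx : x ∈ ⋃ Q ∈ A, Q
    · rw [Set.indicator_of_mem hx]
      exact ENNReal.rpow_le_rpow (dyadicSum_le c A x) hq.le
    · rw [dyadicSum_eq_zero hx, ENNReal.zero_rpow_of_pos hq]
      exact zero_le
  refine ne_top_of_le_ne_top (ENNReal.mul_ne_top ?_ ?_) hle
  · exact ENNReal.rpow_ne_top_of_nonneg hq.le (ENNReal.sum_ne_top.2 hc)
  · exact ((measure_biUnion_finset_le A fun Q => Q).trans_lt
      (ENNReal.sum_lt_top.2 fun Q hQ => (hμ Q hQ).lt_top)).ne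

/-- The coefficients of the dyadic bilinear operator. -/
def bilinearCoeff (lam : Set X → ℝ≥0∞) (μ₁ μ₂ : Measure X) (f₁ f₂ : X → ℝ≥0∞) (Q : Set X) : ℝ≥0∞ :=
  lam Q * ((∫⁻ x in Q, f₁ x ∂μ₁) * ∫⁻ x in Q, f₂ x ∂μ₂)

/-- The trilinear bound is applied with third function `U ^ (q - 1)`, the extremizer in the duality
of `L^q` and `L^q'`. -/
theorem dyadic_strong_le {𝒟 : Set (Set X)} (h𝒟 : IsLaminar 𝒟) {lam : Set X → ℝ≥0∞}
    (hlam : ∀ Q ∈ 𝒟, lam Q ≠ ∞)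
    {μ₁ μ₂ w : Measure X} (hμ₁ : ∀ Q ∈ 𝒟, μ₁ Q ≠ ∞) (hμ₂ : ∀ Q ∈ 𝒟, μ₂ Q ≠ ∞)
    (hw : ∀ Q ∈ 𝒟, w Q ≠ ∞) {p₁ p₂ q r₁ r₂ q' : ℝ} (hpr₁ : p₁.HolderConjugate r₁)
    (hpr₂ : p₂.HolderConjugate r₂) (hq : q.HolderConjugate q')
    (h₁₂ : 1 ≤ 1 / p₁ + 1 / p₂) (h₁₃ : 1 ≤ 1 / p₁ + 1 / q') (h₂₃ : 1 ≤ 1 / p₂ + 1 / q')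
    {T₁ T₂ T : ℝ≥0∞} (hT₁ : TestingBound 𝒟 lam μ₁ μ₂ w r₁ p₂ q' T₁)
    (hT₂ : TestingBound 𝒟 lam μ₂ μ₁ w r₂ p₁ q' T₂)
    (hT : TestingBound 𝒟 lam w μ₁ μ₂ q p₁ p₂ T) {f₁ f₂ : X → ℝ≥0∞} (hf₁ : Measurable f₁)
    (hf₂ : Measurable f₂) (hn₁ : ∫⁻ x, f₁ x ^ p₁ ∂μ₁ ≠ ∞) (hn₂ : ∫⁻ x, f₂ x ^ p₂ ∂μ₂ ≠ ∞)
    {A : Finset (Set X)} (hA : (A : Set (Set X)) ⊆ 𝒟) :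
    (∫⁻ x, dyadicSum (bilinearCoeff lam μ₁ μ₂ f₁ f₂) A x ^ q ∂w) ^ (1 / q) ≤
      trilinearConst p₁ p₂ q' * (T₁ + T₂ + T) * (∫⁻ x, f₁ x ^ p₁ ∂μ₁) ^ (1 / p₁) *
        (∫⁻ x, f₂ x ^ p₂ ∂μ₂) ^ (1 / p₂) := by
  have hAm : ∀ Q ∈ A, MeasurableSet Q := fun Q hQ => h𝒟.measurableSet Q (hA hQ)
  set U := dyadicSum (bilinearCoeff lam μ₁ μ₂ f₁ f₂) A with hU
  have hUm : Measurable U := measurable_dyadicSum hAm _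
  have hUt : ∫⁻ x, U x ^ q ∂w ≠ ∞ := by
    refine lintegral_dyadicSum_rpow_ne_top hAm (fun Q hQ => ?_) (fun Q hQ => hw Q (hA hQ)) hq.pos
    exact ENNReal.mul_ne_top (hlam Q (hA hQ)) (ENNReal.mul_ne_top
      (setLIntegral_ne_top hf₁ (hμ₁ Q (hA hQ)) hpr₁.lt hn₁)
      (setLIntegral_ne_top hf₂ (hμ₂ Q (hA hQ)) hpr₂.lt hn₂))
  have hpow : ∀ x, (U x ^ (q - 1)) ^ q' = U x ^ q := fun x => by
    rw [← ENNReal.rpow_mul, hq.sub_one_mul_conj]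
  have hmul : ∀ x, U x * U x ^ (q - 1) = U x ^ q := fun x => by
    have : U x ^ (1 : ℝ) * U x ^ (q - 1) = U x ^ q := by
      rw [← ENNReal.rpow_add_of_nonneg _ _ (by norm_num) hq.sub_one_pos.le]
      congr 1; ring
    rw [← this, ENNReal.rpow_one]
  refine rpow_le_of_le_mul_rpow hq hUt ?_
  have htri := trilinear_le h𝒟 hμ₁ hμ₂ hw hpr₁ hpr₂ hq.symm h₁₂ h₁₃ h₂₃ hT₁ hT₂ hT hf₁ hf₂
    (hUm.pow_const (q - 1)) hn₁ hn₂ (by simpa only [hpow] using hUt) hA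
  simp only [hpow] at htri
  refine le_trans (le_of_eq ?_) htri
  have := lintegral_dyadicSum_mul hAm (bilinearCoeff lam μ₁ μ₂ f₁ f₂) (μ := w)
    (hUm.pow_const (q - 1))
  rw [← hU] at this
  simp only [hmul] at this
  rw [this]
  refine Finset.sum_congr rfl fun Q _ => ?_
  rw [bilinearCoeff]; ring

/-- The constant in the localized dyadic inequality. -/
def localConst (p₁ p₂ : ℝ) : ℝ≥0∞ :=
  4 * (carlesonConst p₂ ^ (1 / p₂) + 1) * (1 + (carlesonConst p₂ + 1)) ^ (1 / p₁)

theorem localConst_ne_top {p₁ p₂ : ℝ} (hp₁ : 1 < p₁) (hp₂ : 1 < p₂) : localConst p₁ p₂ ≠ ∞ := by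
  have h1 : (0 : ℝ) ≤ 1 / p₁ := by positivity
  have h2 : (0 : ℝ) ≤ 1 / p₂ := by positivity
  have c2 := carlesonConst_ne_top hp₂
  simp only [localConst]
  refine ENNReal.mul_ne_top (ENNReal.mul_ne_top (by norm_num) (ENNReal.add_ne_top.2 ⟨?_, by simp⟩)) ?_
  · exact ENNReal.rpow_ne_top_of_nonneg h2 c2
  · exact ENNReal.rpow_ne_top_of_nonneg h1 (by simp [c2])

/-- The third function is the indicator of `Q₀` normalized in `L^q'(w)`; its averages on subsets of
`Q₀` are constant or zero, so `{Q₀}` serves as its stopping family. No energy comparison with it is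
needed: the only extra energy of `f₁` is the one on `Q₀`, which is at most `1`. -/
theorem local_le_of_energy_le {𝒟 : Set (Set X)} (h𝒟 : IsLaminar 𝒟) {lam : Set X → ℝ≥0∞}
    {μ₁ μ₂ w : Measure X} (hμ₁ : ∀ Q ∈ 𝒟, μ₁ Q ≠ ∞) (hμ₂ : ∀ Q ∈ 𝒟, μ₂ Q ≠ ∞)
    (hw : ∀ Q ∈ 𝒟, w Q ≠ ∞) {p₁ p₂ q' r : ℝ} (hpr : p₁.HolderConjugate r) (hp₂ : 1 < p₂)
    (hq' : 1 < q') (h₁₂ : 1 ≤ 1 / p₁ + 1 / p₂) (h₁₃ : 1 ≤ 1 / p₁ + 1 / q') {T : ℝ≥0∞}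
    (hT : TestingBound 𝒟 lam μ₁ μ₂ w r p₂ q' T) {f₁ f₂ : X → ℝ≥0∞} (hf₁ : Measurable f₁)
    (hf₂ : Measurable f₂) (hn₁ : ∫⁻ x, f₁ x ^ p₁ ∂μ₁ ≤ 1) (hn₂ : ∫⁻ x, f₂ x ^ p₂ ∂μ₂ ≤ 1)
    {Q₀ : Set X} (hQ₀ : Q₀ ∈ 𝒟) (hwQ₀ : w Q₀ ≠ 0) {A : Finset (Set X)} (hA : (A : Set (Set X)) ⊆ 𝒟)
    (hAQ₀ : ∀ Q ∈ A, Q ⊆ Q₀) (hpos₂ : ∀ Q ∈ A, avg μ₂ f₂ Q ≠ 0)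
    (ha₂ : ∀ Q ∈ A, avg μ₁ f₁ Q ^ p₁ * μ₁ Q ≤ avg μ₂ f₂ Q ^ p₂ * μ₂ Q) :
    ∑ Q ∈ A, lam Q * ((∫⁻ x in Q, f₁ x ∂μ₁) * ((∫⁻ x in Q, f₂ x ∂μ₂) * w Q)) ≤
      localConst p₁ p₂ * T * w Q₀ ^ (1 / q') := by
  have hq'0 : 0 < q' := by linarith
  have hm₀ := h𝒟.measurableSet Q₀ hQ₀
  obtain ⟨S₂, hS₂, hP₂⟩ := exists_isPrincipal hp₂ (h𝒟.mono hA) (fun Q hQ => hμ₂ Q (hA hQ)) hf₂ hn₂ hpos₂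
  set v := w Q₀ ^ (1 / q') with hv
  have hv0 : v ≠ 0 := by simp [hv, hwQ₀, hw Q₀ hQ₀]
  have hvt : v ≠ ∞ := ENNReal.rpow_ne_top_of_nonneg (one_div_nonneg.2 hq'0.le) (hw Q₀ hQ₀)
  have hvq : v⁻¹ ^ q' * w Q₀ = 1 := by
    rw [ENNReal.inv_rpow, hv, ← ENNReal.rpow_mul, one_div_mul_cancel hq'0.ne', ENNReal.rpow_one,
      ENNReal.inv_mul_cancel hwQ₀ (hw Q₀ hQ₀)]
  set f₃ : X → ℝ≥0∞ := Q₀.indicator fun _ => v⁻¹ with hf₃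
  have hf₃m : Measurable f₃ := measurable_const.indicator hm₀
  have hint : ∀ Q, Q ⊆ Q₀ → ∫⁻ x in Q, f₃ x ∂w = v⁻¹ * w Q := by
    intro Q hQ
    rw [hf₃, lintegral_indicator hm₀, Measure.restrict_restrict hm₀, Set.inter_eq_right.2 hQ,
      setLIntegral_const]
  have hn₃ : ∫⁻ x, f₃ x ^ q' ∂w ≤ 1 := by
    have : ∀ x, f₃ x ^ q' = Q₀.indicator (fun _ => v⁻¹ ^ q') x := fun x => by
      by_cases hx : x ∈ Q₀ <;> simp [hf₃, hx, hq'0]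
    simp_rw [this]
    rw [lintegral_indicator_const hm₀, hvq]
  have havg : avg w f₃ Q₀ = v⁻¹ := by
    rw [avg, hint Q₀ le_rfl, ENNReal.mul_div_cancel_right hwQ₀ (hw Q₀ hQ₀)]
  have hP₃ : IsPrincipal w f₃ q' A {Q₀} 1 := by
    refine ⟨fun Q hQ => ⟨Q₀, by simp, hAQ₀ Q hQ, ?_⟩, by simp, by simp [havg, hvq]⟩
    rw [havg, avg, hint Q (hAQ₀ Q hQ)]
    -- For `w Q = 0` the quotient is `0`, so only an inequality with `1` is available.
    calc v⁻¹ * w Q / w Q = v⁻¹ * (w Q / w Q) := mul_div_assoc _ _ _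
      _ ≤ v⁻¹ * 1 := by gcongr; exact ENNReal.div_self_le_one
      _ ≤ 2 * v⁻¹ := by rw [mul_comm]; gcongr; norm_num
  have hmain := sum_le_of_principal h𝒟 hμ₁ hμ₂ hw hpr hp₂ hq' h₁₂ h₁₃ hT hf₁ hf₂ hf₃m hn₁ hn₂ hn₃ hA
    (fun Q hQ => hA (hS₂ hQ)) (by simpa using hQ₀) hP₂ hP₃ (K₁ := carlesonConst p₂ + 1) (by
      calc ∑ F ∈ S₂ ∪ {Q₀}, avg μ₁ f₁ F ^ p₁ * μ₁ F
          ≤ ∑ F ∈ S₂, avg μ₁ f₁ F ^ p₁ * μ₁ F + ∑ F ∈ {Q₀}, avg μ₁ f₁ F ^ p₁ * μ₁ F := by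
            rw [← Finset.sum_union_inter]; exact le_self_add
        _ ≤ _ := by
            refine add_le_add
              ((Finset.sum_le_sum fun F hF => ha₂ F (hS₂ hF)).trans hP₂.sum_le) ?_
            rw [Finset.sum_singleton]
            exact (avg_rpow_mul_le hf₁ (hμ₁ Q₀ hQ₀) hpr.lt).trans
              ((setLIntegral_le_lintegral _ _).trans hn₁))
  rw [ENNReal.one_rpow, ← localConst] at hmain
  calc ∑ Q ∈ A, lam Q * ((∫⁻ x in Q, f₁ x ∂μ₁) * ((∫⁻ x in Q, f₂ x ∂μ₂) * w Q))
      = (∑ Q ∈ A, lam Q * ((∫⁻ x in Q, f₁ x ∂μ₁) *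
          ((∫⁻ x in Q, f₂ x ∂μ₂) * ∫⁻ x in Q, f₃ x ∂w))) * v := by
        rw [Finset.sum_mul]
        refine Finset.sum_congr rfl fun Q hQ => ?_
        rw [hint Q (hAQ₀ Q hQ)]
        calc _ = lam Q * ((∫⁻ x in Q, f₁ x ∂μ₁) * ((∫⁻ x in Q, f₂ x ∂μ₂) * ((v⁻¹ * v) * w Q))) := by
              rw [ENNReal.inv_mul_cancel hv0 hvt, one_mul]
          _ = _ := by ring
    _ ≤ localConst p₁ p₂ * T * v := by gcongr

/-- Only two classes of cubes occur, according to the smaller of the energies of `f₁` and `f₂`, so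
the testing condition integrated against `w` never enters. -/
theorem local_le_of_unit {𝒟 : Set (Set X)} (h𝒟 : IsLaminar 𝒟) {lam : Set X → ℝ≥0∞}
    {μ₁ μ₂ w : Measure X} (hμ₁ : ∀ Q ∈ 𝒟, μ₁ Q ≠ ∞) (hμ₂ : ∀ Q ∈ 𝒟, μ₂ Q ≠ ∞)
    (hw : ∀ Q ∈ 𝒟, w Q ≠ ∞) {p₁ p₂ q' r₁ r₂ : ℝ} (hpr₁ : p₁.HolderConjugate r₁)
    (hpr₂ : p₂.HolderConjugate r₂)
    (hq' : 1 < q') (h₁₂ : 1 ≤ 1 / p₁ + 1 / p₂) (h₁₃ : 1 ≤ 1 / p₁ + 1 / q')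
    (h₂₃ : 1 ≤ 1 / p₂ + 1 / q') {T₁ T₂ : ℝ≥0∞}
    (hT₁ : TestingBound 𝒟 lam μ₁ μ₂ w r₁ p₂ q' T₁)
    (hT₂ : TestingBound 𝒟 lam μ₂ μ₁ w r₂ p₁ q' T₂) {f₁ f₂ : X → ℝ≥0∞} (hf₁ : Measurable f₁)
    (hf₂ : Measurable f₂) (hn₁ : ∫⁻ x, f₁ x ^ p₁ ∂μ₁ ≤ 1) (hn₂ : ∫⁻ x, f₂ x ^ p₂ ∂μ₂ ≤ 1)
    {Q₀ : Set X} (hQ₀ : Q₀ ∈ 𝒟) {A : Finset (Set X)} (hA : (A : Set (Set X)) ⊆ 𝒟)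
    (hAQ₀ : ∀ Q ∈ A, Q ⊆ Q₀) :
    ∑ Q ∈ A, lam Q * ((∫⁻ x in Q, f₁ x ∂μ₁) * ((∫⁻ x in Q, f₂ x ∂μ₂) * w Q)) ≤
      (localConst p₁ p₂ + localConst p₂ p₁) * (T₁ + T₂) * w Q₀ ^ (1 / q') := by
  by_cases hwQ₀ : w Q₀ = 0
  · rw [Finset.sum_eq_zero]
    · exact zero_le
    · intro Q hQ
      simp [measure_mono_null (hAQ₀ Q hQ) hwQ₀]
  set g : Set X → ℝ≥0∞ := fun Q => lam Q * ((∫⁻ x in Q, f₁ x ∂μ₁) *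
    ((∫⁻ x in Q, f₂ x ∂μ₂) * w Q)) with hg
  set a₁ : Set X → ℝ≥0∞ := fun Q => avg μ₁ f₁ Q ^ p₁ * μ₁ Q with ha₁
  set a₂ : Set X → ℝ≥0∞ := fun Q => avg μ₂ f₂ Q ^ p₂ * μ₂ Q with ha₂
  set B₁ := A.filter fun Q => avg μ₂ f₂ Q ≠ 0 ∧ a₁ Q ≤ a₂ Q with hB₁
  set B₂ := A.filter fun Q => avg μ₁ f₁ Q ≠ 0 ∧ a₂ Q ≤ a₁ Q with hB₂
  have hB₁' : ∀ Q ∈ B₁, Q ∈ A ∧ avg μ₂ f₂ Q ≠ 0 ∧ a₁ Q ≤ a₂ Q := fun Q hQ => Finset.mem_filter.1 hQ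
  have hB₂' : ∀ Q ∈ B₂, Q ∈ A ∧ avg μ₁ f₁ Q ≠ 0 ∧ a₂ Q ≤ a₁ Q := fun Q hQ => Finset.mem_filter.1 hQ
  have b₁ := local_le_of_energy_le h𝒟 hμ₁ hμ₂ hw hpr₁ hpr₂.lt hq' h₁₂ h₁₃ hT₁ hf₁ hf₂ hn₁ hn₂ hQ₀ hwQ₀
    (A := B₁) (fun Q hQ => hA (hB₁' Q hQ).1) (fun Q hQ => hAQ₀ Q (hB₁' Q hQ).1)
    (fun Q hQ => (hB₁' Q hQ).2.1) (fun Q hQ => (hB₁' Q hQ).2.2)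
  have b₂ := local_le_of_energy_le h𝒟 hμ₂ hμ₁ hw hpr₂ hpr₁.lt hq' (by linarith) h₂₃ hT₂ hf₂ hf₁ hn₂ hn₁
    hQ₀ hwQ₀ (A := B₂) (fun Q hQ => hA (hB₂' Q hQ).1) (fun Q hQ => hAQ₀ Q (hB₂' Q hQ).1)
    (fun Q hQ => (hB₂' Q hQ).2.1) (fun Q hQ => (hB₂' Q hQ).2.2)
  have e₂ : ∀ Q, lam Q * ((∫⁻ x in Q, f₂ x ∂μ₂) * ((∫⁻ x in Q, f₁ x ∂μ₁) * w Q)) = g Q :=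
    fun Q => by simp only [hg]; ring
  simp only [e₂] at b₂
  calc ∑ Q ∈ A, g Q ≤ ∑ Q ∈ B₁, g Q + ∑ Q ∈ B₂, g Q := by
        rw [hB₁, hB₂, Finset.sum_filter, Finset.sum_filter, ← Finset.sum_add_distrib]
        refine Finset.sum_le_sum fun Q hQ => ?_
        by_cases h1 : avg μ₁ f₁ Q = 0
        · have : g Q = 0 := by simp only [hg, ← avg_mul (hμ₁ Q (hA hQ)), h1]; simp
          simp [this]
        by_cases h2 : avg μ₂ f₂ Q = 0
        · have : g Q = 0 := by simp only [hg, ← avg_mul (hμ₂ Q (hA hQ)), h2]; simp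
          simp [this]
        rcases le_total (a₁ Q) (a₂ Q) with h | h
        · rw [if_pos ⟨h2, h⟩]; exact le_self_add
        · rw [if_pos (c := _ ∧ a₂ Q ≤ a₁ Q) ⟨h1, h⟩]; exact le_add_self
    _ ≤ localConst p₁ p₂ * T₁ * w Q₀ ^ (1 / q') + localConst p₂ p₁ * T₂ * w Q₀ ^ (1 / q') :=
        add_le_add b₁ b₂
    _ ≤ (localConst p₁ p₂ + localConst p₂ p₁) * T₁ * w Q₀ ^ (1 / q') +
          (localConst p₁ p₂ + localConst p₂ p₁) * T₂ * w Q₀ ^ (1 / q') := by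
        gcongr
        · exact le_self_add
        · exact le_add_self
    _ = _ := by ring

/-- Applying the unit bound to `f₁`, `f₂` cut off to `Q₀` keeps the norms on the right local, which
makes the bound summable over disjoint cubes. -/
theorem local_le {𝒟 : Set (Set X)} (h𝒟 : IsLaminar 𝒟) {lam : Set X → ℝ≥0∞}
    {μ₁ μ₂ w : Measure X} (hμ₁ : ∀ Q ∈ 𝒟, μ₁ Q ≠ ∞) (hμ₂ : ∀ Q ∈ 𝒟, μ₂ Q ≠ ∞)
    (hw : ∀ Q ∈ 𝒟, w Q ≠ ∞) {p₁ p₂ q' r₁ r₂ : ℝ} (hpr₁ : p₁.HolderConjugate r₁)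
    (hpr₂ : p₂.HolderConjugate r₂)
    (hq' : 1 < q') (h₁₂ : 1 ≤ 1 / p₁ + 1 / p₂) (h₁₃ : 1 ≤ 1 / p₁ + 1 / q')
    (h₂₃ : 1 ≤ 1 / p₂ + 1 / q') {T₁ T₂ : ℝ≥0∞}
    (hT₁ : TestingBound 𝒟 lam μ₁ μ₂ w r₁ p₂ q' T₁)
    (hT₂ : TestingBound 𝒟 lam μ₂ μ₁ w r₂ p₁ q' T₂) {f₁ f₂ : X → ℝ≥0∞} (hf₁ : Measurable f₁)
    (hf₂ : Measurable f₂) (hn₁ : ∫⁻ x, f₁ x ^ p₁ ∂μ₁ ≠ ∞) (hn₂ : ∫⁻ x, f₂ x ^ p₂ ∂μ₂ ≠ ∞)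
    {Q₀ : Set X} (hQ₀ : Q₀ ∈ 𝒟) {A : Finset (Set X)} (hA : (A : Set (Set X)) ⊆ 𝒟)
    (hAQ₀ : ∀ Q ∈ A, Q ⊆ Q₀) :
    ∑ Q ∈ A, bilinearCoeff lam μ₁ μ₂ f₁ f₂ Q * w Q ≤
      (localConst p₁ p₂ + localConst p₂ p₁) * (T₁ + T₂) * w Q₀ ^ (1 / q') *
        (∫⁻ x in Q₀, f₁ x ^ p₁ ∂μ₁) ^ (1 / p₁) * (∫⁻ x in Q₀, f₂ x ^ p₂ ∂μ₂) ^ (1 / p₂) := by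
  have hm₀ := h𝒟.measurableSet Q₀ hQ₀
  have hpow : ∀ (f : X → ℝ≥0∞) (p : ℝ), 0 < p → ∀ x, Q₀.indicator f x ^ p =
      Q₀.indicator (fun x => f x ^ p) x := by
    intro f p hp x
    by_cases hx : x ∈ Q₀ <;> simp [hx, hp]
  have hnorm : ∀ (μ : Measure X) (f : X → ℝ≥0∞) (p : ℝ), 0 < p →
      ∫⁻ x, Q₀.indicator f x ^ p ∂μ = ∫⁻ x in Q₀, f x ^ p ∂μ := by
    intro μ f p hp
    simp_rw [hpow f p hp]
    rw [lintegral_indicator hm₀]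
  have hint : ∀ (μ : Measure X) (f : X → ℝ≥0∞), ∀ Q ∈ A,
      ∫⁻ x in Q, Q₀.indicator f x ∂μ = ∫⁻ x in Q, f x ∂μ := by
    intro μ f Q hQ
    rw [lintegral_indicator hm₀, Measure.restrict_restrict hm₀, Set.inter_eq_right.2 (hAQ₀ Q hQ)]
  have e₁ : ∀ g₁ g₂ : X → ℝ≥0∞, ∀ Q, lam Q * ((∫⁻ x in Q, g₁ x ∂μ₁) *
      ((∫⁻ x in Q, g₂ x ∂μ₂) * w Q)) =
      lam Q * ((∫⁻ x in Q, g₂ x ∂μ₂) * w Q) * ∫⁻ x in Q, g₁ x ∂μ₁ := by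
    intros; ring
  have e₂ : ∀ g₁ g₂ : X → ℝ≥0∞, ∀ Q, lam Q * ((∫⁻ x in Q, g₁ x ∂μ₁) *
      ((∫⁻ x in Q, g₂ x ∂μ₂) * w Q)) =
      lam Q * ((∫⁻ x in Q, g₁ x ∂μ₁) * w Q) * ∫⁻ x in Q, g₂ x ∂μ₂ := by
    intros; ring
  set K := (localConst p₁ p₂ + localConst p₂ p₁) * (T₁ + T₂) * w Q₀ ^ (1 / q') with hK
  have s₂ := sum_mul_setLIntegral_le_of_unit hpr₂.lt A (μ := μ₂)
    (fun Q => lam Q * ((∫⁻ x in Q, Q₀.indicator f₁ x ∂μ₁) * w Q))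
    (K * (∫⁻ x, Q₀.indicator f₁ x ^ p₁ ∂μ₁) ^ (1 / p₁)) ?_ (hf₂.indicator hm₀)
    (by rw [hnorm _ _ _ hpr₂.pos]; exact ne_top_of_le_ne_top hn₂ (setLIntegral_le_lintegral _ _))
  · rw [hnorm _ _ _ hpr₂.pos, hnorm _ _ _ hpr₁.pos] at s₂
    refine le_trans (le_of_eq ?_) s₂
    refine Finset.sum_congr rfl fun Q hQ => ?_
    rw [hint _ _ Q hQ, hint _ _ Q hQ, bilinearCoeff]; ring
  intro g₂ hg₂ hu₂
  have s₁ := sum_mul_setLIntegral_le_of_unit hpr₁.lt A (μ := μ₁)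
    (fun Q => lam Q * ((∫⁻ x in Q, g₂ x ∂μ₂) * w Q)) K ?_ (hf₁.indicator hm₀)
    (by rw [hnorm _ _ _ hpr₁.pos]; exact ne_top_of_le_ne_top hn₁ (setLIntegral_le_lintegral _ _))
  · simpa only [← e₁, ← e₂] using s₁
  intro g₁ hg₁ hu₁
  simp only [← e₁]
  exact local_le_of_unit h𝒟 hμ₁ hμ₂ hw hpr₁ hpr₂ hq' h₁₂ h₁₃ h₂₃ hT₁ hT₂ hg₁ hg₂ hu₁ hu₂ hQ₀ hA hAQ₀

end

/-! ### The maximum principle and dyadic weak type. -/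

section

open scoped Classical

variable {X : Type*} [MeasurableSpace X]

/-- The maximum principle for dyadic sums: on the maximal sets where the sum exceeds `t`, the
localized sum exceeds `t` wherever the whole sum exceeds `2 * t`. -/
theorem exists_maximal_cover {A : Finset (Set X)} (hA : IsLaminar (A : Set (Set X)))
    (c : Set X → ℝ≥0∞) (t : ℝ≥0) :
    ∃ J ⊆ A, Set.PairwiseDisjoint (J : Set (Set X)) id ∧
      (∀ Q ∈ J, ∀ x ∈ Q, (t : ℝ≥0∞) < dyadicSum c A x) ∧
      ∀ x, 2 * (t : ℝ≥0∞) < dyadicSum c A x →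
        ∃ Q ∈ J, x ∈ Q ∧ (t : ℝ≥0∞) ≤ dyadicSum c (A.filter fun R => R ⊆ Q) x := by
  have hsum : ∀ (B : Finset (Set X)) x, dyadicSum c B x = ∑ R ∈ B.filter (fun R => x ∈ R), c R := by
    intro B x
    rw [dyadicSum, Finset.sum_filter]
    refine Finset.sum_congr rfl fun R _ => ?_
    by_cases hx : x ∈ R <;> simp [hx]
  -- `s Q` is the part of the dyadic sum that is present at every point of `Q`.
  set s : Set X → ℝ≥0∞ := fun Q => ∑ R ∈ A.filter (fun R => Q ⊆ R), c R with hs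
  set E := A.filter fun Q => (t : ℝ≥0∞) < s Q with hE
  set J := E.filter fun Q => ∀ R ∈ E, Q ⊆ R → R ⊆ Q with hJ
  have hJE : ∀ Q ∈ J, Q ∈ A ∧ (t : ℝ≥0∞) < s Q := fun Q hQ =>
    Finset.mem_filter.1 (Finset.mem_filter.1 hQ).1
  refine ⟨J, fun Q hQ => (hJE Q hQ).1, ?_, ?_, ?_⟩
  · intro P hP Q hQ hne
    rcases hA.nested P (hJE P hP).1 Q (hJE Q hQ).1 with h | h | h
    · exact absurd (h.antisymm ((Finset.mem_filter.1 hP).2 Q (Finset.mem_filter.1 hQ).1 h)) hne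
    · exact absurd (((Finset.mem_filter.1 hQ).2 P (Finset.mem_filter.1 hP).1 h).antisymm h) hne
    · exact h
  · intro Q hQ x hx
    refine (hJE Q hQ).2.trans_le ?_
    rw [hsum]
    refine Finset.sum_le_sum_of_subset fun R hR => ?_
    rw [Finset.mem_filter] at hR ⊢
    exact ⟨hR.1, hR.2 hx⟩
  · intro x hx
    have hne : (A.filter fun R => x ∈ R).Nonempty := by
      rw [Finset.nonempty_iff_ne_empty]
      intro h
      rw [hsum, h] at hx
      simp at hx
    obtain ⟨Q₁, hQ₁⟩ := hne
    obtain ⟨Q₀, _, hQ₀⟩ := (A.filter fun R => x ∈ R).exists_le_minimal hQ₁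
    have hQ₀m := Finset.mem_filter.1 hQ₀.prop
    -- `Q₀` is the smallest member through `x`, so the whole sum at `x` equals `s Q₀`.
    have hfil : A.filter (fun R => x ∈ R) = A.filter fun R => Q₀ ⊆ R := by
      ext R
      simp only [Finset.mem_filter]
      refine and_congr_right fun hR => ⟨fun hxR => ?_, fun h => h hQ₀m.2⟩
      rcases hA.subset_or_subset hQ₀m.1 hR hQ₀m.2 hxR with h | h
      · exact h
      · exact hQ₀.le_of_le (Finset.mem_filter.2 ⟨hR, hxR⟩) h
    have hQ₀E : Q₀ ∈ E := by
      rw [hE, Finset.mem_filter]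
      refine ⟨hQ₀m.1, lt_of_le_of_lt ?_ (by rw [hsum, hfil] at hx; exact hx)⟩
      rw [two_mul]; exact le_self_add
    obtain ⟨Q, hQ₀Q, hQ⟩ := E.exists_le_maximal hQ₀E
    have hQJ : Q ∈ J := by
      rw [hJ, Finset.mem_filter]
      exact ⟨hQ.prop, fun R hR hQR => hQ.le_of_ge hR hQR⟩
    have hxQ : x ∈ Q := hQ₀Q hQ₀m.2
    refine ⟨Q, hQJ, hxQ, ?_⟩
    -- the strict ancestors of `Q` contribute at most `t`
    have hanc : ∑ R ∈ A.filter (fun R => Q ⊂ R), c R ≤ t := by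
      rcases (A.filter fun R => Q ⊂ R).eq_empty_or_nonempty with h | ⟨R₁, hR₁⟩
      · rw [h]; simp
      obtain ⟨R₀, _, hR₀⟩ := (A.filter fun R => Q ⊂ R).exists_le_minimal hR₁
      have hR₀m := Finset.mem_filter.1 hR₀.prop
      have hR₀E : R₀ ∉ E := fun h => hR₀m.2.2 (hQ.le_of_ge h hR₀m.2.1)
      have hR₀s : s R₀ ≤ t := by
        by_contra hcon
        exact hR₀E (Finset.mem_filter.2 ⟨hR₀m.1, not_le.1 hcon⟩)
      refine le_trans (Finset.sum_le_sum_of_subset fun R hR => ?_) hR₀s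
      rw [Finset.mem_filter] at hR ⊢
      refine ⟨hR.1, ?_⟩
      rcases hA.subset_or_subset hR₀m.1 hR.1 (hR₀m.2.1 hxQ) (hR.2.1 hxQ) with h | h
      · exact h
      · exact hR₀.le_of_le (Finset.mem_filter.2 hR) h
    have hsplit : dyadicSum c A x ≤ dyadicSum c (A.filter fun R => R ⊆ Q) x +
        ∑ R ∈ A.filter (fun R => Q ⊂ R), c R := by
      rw [hsum, hsum, Finset.sum_filter, Finset.sum_filter, Finset.sum_filter, Finset.sum_filter,
        ← Finset.sum_add_distrib]
      refine Finset.sum_le_sum fun R hR => ?_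
      by_cases hxR : x ∈ R
      · by_cases hRQ : R ⊆ Q
        · simp [hxR, hRQ]
        · have : Q ⊂ R := by
            rcases hA.subset_or_subset hR (hJE Q hQJ).1 hxR hxQ with h | h
            · exact absurd h hRQ
            · exact ⟨h, hRQ⟩
          simp [hxR, hRQ, this]
      · simp [hxR]
    have h2 : (t : ℝ≥0∞) + t ≤ dyadicSum c (A.filter fun R => R ⊆ Q) x + t := by
      rw [← two_mul]
      exact hx.le.trans (hsplit.trans (by gcongr))
    exact (ENNReal.add_le_add_iff_right ENNReal.coe_ne_top).1 h2

/-- On the maximal cubes of `{U > t}` the localized sums still exceed `t` wherever `U > 2t`.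
Chebyshev, `local_le` on each cube and Hölder over the disjoint cubes give the bound; the
localization of `f₁` is used for summation, while the norm of `f₂` is taken globally. -/
theorem dyadic_level_le {𝒟 : Set (Set X)} (h𝒟 : IsLaminar 𝒟) {lam : Set X → ℝ≥0∞}
    {μ₁ μ₂ w : Measure X} (hμ₁ : ∀ Q ∈ 𝒟, μ₁ Q ≠ ∞) (hμ₂ : ∀ Q ∈ 𝒟, μ₂ Q ≠ ∞)
    (hw : ∀ Q ∈ 𝒟, w Q ≠ ∞) {p₁ p₂ q' r₁ r₂ : ℝ} (hpr₁ : p₁.HolderConjugate r₁)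
    (hpr₂ : p₂.HolderConjugate r₂)
    (hq' : 1 < q') (h₁₂ : 1 ≤ 1 / p₁ + 1 / p₂) (h₁₃ : 1 ≤ 1 / p₁ + 1 / q')
    (h₂₃ : 1 ≤ 1 / p₂ + 1 / q') {T₁ T₂ : ℝ≥0∞}
    (hT₁ : TestingBound 𝒟 lam μ₁ μ₂ w r₁ p₂ q' T₁)
    (hT₂ : TestingBound 𝒟 lam μ₂ μ₁ w r₂ p₁ q' T₂) {f₁ f₂ : X → ℝ≥0∞} (hf₁ : Measurable f₁)
    (hf₂ : Measurable f₂) (hn₁ : ∫⁻ x, f₁ x ^ p₁ ∂μ₁ ≠ ∞) (hn₂ : ∫⁻ x, f₂ x ^ p₂ ∂μ₂ ≠ ∞)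
    {A : Finset (Set X)} (hA : (A : Set (Set X)) ⊆ 𝒟) (t : ℝ≥0) :
    t * w {x | 2 * (t : ℝ≥0∞) < dyadicSum (bilinearCoeff lam μ₁ μ₂ f₁ f₂) A x} ≤
      (localConst p₁ p₂ + localConst p₂ p₁) * (T₁ + T₂) * (∫⁻ x, f₁ x ^ p₁ ∂μ₁) ^ (1 / p₁) *
        (∫⁻ x, f₂ x ^ p₂ ∂μ₂) ^ (1 / p₂) *
        w {x | (t : ℝ≥0∞) < dyadicSum (bilinearCoeff lam μ₁ μ₂ f₁ f₂) A x} ^ (1 / q') := by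
  have hp₁0 := hpr₁.pos
  have hp₂0 := hpr₂.pos
  have hq'0 : 0 < q' := by linarith
  set c := bilinearCoeff lam μ₁ μ₂ f₁ f₂ with hc
  set K := (localConst p₁ p₂ + localConst p₂ p₁) * (T₁ + T₂) with hK
  obtain ⟨J, hJA, hJdis, hJsub, hJcov⟩ := exists_maximal_cover (h𝒟.mono hA) c t
  have hJm : ∀ Q ∈ J, MeasurableSet Q := fun Q hQ => h𝒟.measurableSet Q (hA (hJA hQ))
  have hfm : ∀ Q : Set X, ∀ R ∈ A.filter (fun R => R ⊆ Q), MeasurableSet R := fun Q R hR =>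
    h𝒟.measurableSet R (hA (Finset.mem_filter.1 hR).1)
  have hint : ∀ Q : Set X, ∫⁻ x, dyadicSum c (A.filter fun R => R ⊆ Q) x ∂w =
      ∑ R ∈ A.filter (fun R => R ⊆ Q), c R * w R := fun Q => by
    have := lintegral_dyadicSum_mul (hfm Q) c (μ := w) (measurable_const (a := (1 : ℝ≥0∞)))
    simpa using this
  calc t * w {x | 2 * (t : ℝ≥0∞) < dyadicSum c A x}
      ≤ t * w {x | (t : ℝ≥0∞) ≤ ∑ Q ∈ J, dyadicSum c (A.filter fun R => R ⊆ Q) x} := by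
        refine mul_le_mul_right (measure_mono fun x hx => ?_) _
        obtain ⟨Q, hQ, _, hle⟩ := hJcov x hx
        exact hle.trans (Finset.single_le_sum
          (f := fun Q => dyadicSum c (A.filter fun R => R ⊆ Q) x) (fun _ _ => zero_le) hQ)
    _ ≤ ∫⁻ x, ∑ Q ∈ J, dyadicSum c (A.filter fun R => R ⊆ Q) x ∂w :=
        mul_meas_ge_le_lintegral (Finset.measurable_fun_sum _ fun Q _ =>
          measurable_dyadicSum (hfm Q) c) _
    _ = ∑ Q ∈ J, ∑ R ∈ A.filter (fun R => R ⊆ Q), c R * w R := by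
        rw [lintegral_finsetSum' _ fun Q _ => (measurable_dyadicSum (hfm Q) c).aemeasurable]
        simp only [hint]
    _ ≤ ∑ Q ∈ J, K * (∫⁻ x, f₂ x ^ p₂ ∂μ₂) ^ (1 / p₂) *
          ((∫⁻ x in Q, f₁ x ^ p₁ ∂μ₁) ^ (1 / p₁) * w Q ^ (1 / q')) := by
        refine Finset.sum_le_sum fun Q hQ => ?_
        have := local_le h𝒟 hμ₁ hμ₂ hw hpr₁ hpr₂ hq' h₁₂ h₁₃ h₂₃ hT₁ hT₂ hf₁ hf₂ hn₁ hn₂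
          (hA (hJA hQ)) (A := A.filter fun R => R ⊆ Q)
          (fun R hR => hA (Finset.mem_filter.1 hR).1) (fun R hR => (Finset.mem_filter.1 hR).2)
        refine this.trans ?_
        calc _ ≤ K * w Q ^ (1 / q') * (∫⁻ x in Q, f₁ x ^ p₁ ∂μ₁) ^ (1 / p₁) *
              (∫⁻ x, f₂ x ^ p₂ ∂μ₂) ^ (1 / p₂) := by
              gcongr
              exact Measure.restrict_le_self
          _ = _ := by ring
    _ = K * (∫⁻ x, f₂ x ^ p₂ ∂μ₂) ^ (1 / p₂) *
          ∑ Q ∈ J, (∫⁻ x in Q, f₁ x ^ p₁ ∂μ₁) ^ (1 / p₁) * w Q ^ (1 / q') :=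
        (Finset.mul_sum _ _ _).symm
    _ ≤ K * (∫⁻ x, f₂ x ^ p₂ ∂μ₂) ^ (1 / p₂) *
          ((∑ Q ∈ J, ∫⁻ x in Q, f₁ x ^ p₁ ∂μ₁) ^ (1 / p₁) * (∑ Q ∈ J, w Q) ^ (1 / q')) := by
        gcongr
        exact sum_rpow_mul_rpow_le _ _ _ (one_div_pos.2 hp₁0) (one_div_pos.2 hq'0) h₁₃
    _ ≤ K * (∫⁻ x, f₂ x ^ p₂ ∂μ₂) ^ (1 / p₂) *
          ((∫⁻ x, f₁ x ^ p₁ ∂μ₁) ^ (1 / p₁) * w {x | (t : ℝ≥0∞) < dyadicSum c A x} ^ (1 / q')) := by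
        gcongr
        · exact (lintegral_biUnion_finset (t := id) hJdis hJm _).symm.trans_le
            (setLIntegral_le_lintegral _ _)
        · refine (measure_biUnion_finset (f := id) hJdis hJm).symm.trans_le
            (measure_mono fun x hx => ?_)
          obtain ⟨Q, hQ, hxQ⟩ := Set.mem_iUnion₂.1 hx
          exact hJsub Q hQ x hxQ
    _ = _ := by ring

/-- Multiplying the level set relation by `t ^ (q - 1)` bounds `M ^ q` by a multiple of `M ^ (q -
1)`, where `M` is the weak norm; finiteness of the family makes `M` finite and allows absorption. -/
theorem dyadic_weak_le {𝒟 : Set (Set X)} (h𝒟 : IsLaminar 𝒟) {lam : Set X → ℝ≥0∞}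
    (hlam : ∀ Q ∈ 𝒟, lam Q ≠ ∞)
    {μ₁ μ₂ w : Measure X} (hμ₁ : ∀ Q ∈ 𝒟, μ₁ Q ≠ ∞) (hμ₂ : ∀ Q ∈ 𝒟, μ₂ Q ≠ ∞)
    (hw : ∀ Q ∈ 𝒟, w Q ≠ ∞) {p₁ p₂ q r₁ r₂ q' : ℝ} (hpr₁ : p₁.HolderConjugate r₁)
    (hpr₂ : p₂.HolderConjugate r₂) (hq : q.HolderConjugate q')
    (h₁₂ : 1 ≤ 1 / p₁ + 1 / p₂) (h₁₃ : 1 ≤ 1 / p₁ + 1 / q') (h₂₃ : 1 ≤ 1 / p₂ + 1 / q')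
    {T₁ T₂ : ℝ≥0∞} (hT₁ : TestingBound 𝒟 lam μ₁ μ₂ w r₁ p₂ q' T₁)
    (hT₂ : TestingBound 𝒟 lam μ₂ μ₁ w r₂ p₁ q' T₂) {f₁ f₂ : X → ℝ≥0∞} (hf₁ : Measurable f₁)
    (hf₂ : Measurable f₂) (hn₁ : ∫⁻ x, f₁ x ^ p₁ ∂μ₁ ≠ ∞) (hn₂ : ∫⁻ x, f₂ x ^ p₂ ∂μ₂ ≠ ∞)
    {A : Finset (Set X)} (hA : (A : Set (Set X)) ⊆ 𝒟) (t : ℝ≥0) :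
    t * w {x | (t : ℝ≥0∞) < dyadicSum (bilinearCoeff lam μ₁ μ₂ f₁ f₂) A x} ^ (1 / q) ≤
      2 ^ q * ((localConst p₁ p₂ + localConst p₂ p₁) * (T₁ + T₂) *
        (∫⁻ x, f₁ x ^ p₁ ∂μ₁) ^ (1 / p₁) * (∫⁻ x, f₂ x ^ p₂ ∂μ₂) ^ (1 / p₂)) := by
  have hq0 := hq.pos
  set c := bilinearCoeff lam μ₁ μ₂ f₁ f₂ with hc
  set Y := (localConst p₁ p₂ + localConst p₂ p₁) * (T₁ + T₂) *
        (∫⁻ x, f₁ x ^ p₁ ∂μ₁) ^ (1 / p₁) * (∫⁻ x, f₂ x ^ p₂ ∂μ₂) ^ (1 / p₂) with hY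
  set m : ℝ≥0 → ℝ≥0∞ := fun t => t * w {x | (t : ℝ≥0∞) < dyadicSum c A x} ^ (1 / q) with hm
  set M := ⨆ t, m t with hM
  have hMt : M ≠ ∞ := by
    have hle : M ≤ (∑ Q ∈ A, c Q) * w (⋃ Q ∈ A, Q) ^ (1 / q) := by
      refine iSup_le fun t => ?_
      by_cases ht : (t : ℝ≥0∞) ≤ ∑ Q ∈ A, c Q
      · refine mul_le_mul' ht (ENNReal.rpow_le_rpow (measure_mono fun x hx => ?_)
          (one_div_nonneg.2 hq0.le))
        by_contra hcon
        rw [Set.mem_ofPred_eq, dyadicSum_eq_zero hcon] at hx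
        exact not_lt_zero hx
      · have : {x | (t : ℝ≥0∞) < dyadicSum c A x} = ∅ := by
          ext x
          simp only [Set.mem_ofPred_eq, Set.mem_empty_iff_false, iff_false, not_lt]
          exact (dyadicSum_le c A x).trans (not_le.1 ht).le
        simp only [hm, this, measure_empty, ENNReal.zero_rpow_of_pos (one_div_pos.2 hq0), mul_zero]
        exact zero_le
    refine ne_top_of_le_ne_top (ENNReal.mul_ne_top (ENNReal.sum_ne_top.2 fun Q hQ => ?_)
      (ENNReal.rpow_ne_top_of_nonneg (one_div_nonneg.2 hq0.le) ?_)) hle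
    · exact ENNReal.mul_ne_top (hlam Q (hA hQ)) (ENNReal.mul_ne_top
        (setLIntegral_ne_top hf₁ (hμ₁ Q (hA hQ)) hpr₁.lt hn₁)
        (setLIntegral_ne_top hf₂ (hμ₂ Q (hA hQ)) hpr₂.lt hn₂))
    · exact ((measure_biUnion_finset_le A fun Q => Q).trans_lt
        (ENNReal.sum_lt_top.2 fun Q hQ => (hw Q (hA hQ)).lt_top)).ne
  have hstep : ∀ s : ℝ≥0, m s ^ q ≤ 2 ^ q * Y * M ^ (q - 1) := by
    intro s
    set t : ℝ≥0 := s / 2 with ht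
    have hs : (s : ℝ≥0∞) = 2 * (t : ℝ≥0∞) := by
      rw [ht]
      have : s = 2 * (s / 2) := by rw [mul_div_cancel₀ s (two_ne_zero)]
      exact_mod_cast this
    have hlev := dyadic_level_le h𝒟 hμ₁ hμ₂ hw hpr₁ hpr₂ hq.symm.lt h₁₂ h₁₃ h₂₃ hT₁ hT₂ hf₁ hf₂ hn₁ hn₂
      hA t
    rw [← hc, ← hY, ← hs] at hlev
    have hpt : (t : ℝ≥0∞) ^ q = (t : ℝ≥0∞) ^ (q - 1) * t := by
      have : (t : ℝ≥0∞) ^ (q - 1) * (t : ℝ≥0∞) ^ (1 : ℝ) = (t : ℝ≥0∞) ^ q := by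
        rw [← ENNReal.rpow_add_of_nonneg _ _ hq.sub_one_pos.le (by norm_num)]
        congr 1; ring
      rw [← this, ENNReal.rpow_one]
    calc m s ^ q = 2 ^ q * (t : ℝ≥0∞) ^ (q - 1) * (t * w {x | (s : ℝ≥0∞) < dyadicSum c A x}) := by
          simp only [hm]
          rw [ENNReal.mul_rpow_of_nonneg _ _ hq0.le, ← ENNReal.rpow_mul, one_div_mul_cancel hq0.ne',
            ENNReal.rpow_one]
          nth_rewrite 1 [hs]
          rw [ENNReal.mul_rpow_of_nonneg _ _ hq0.le, hpt]
          ring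
      _ ≤ 2 ^ q * (t : ℝ≥0∞) ^ (q - 1) *
            (Y * w {x | (t : ℝ≥0∞) < dyadicSum c A x} ^ (1 / q')) := by gcongr
      _ = 2 ^ q * Y * m t ^ (q - 1) := by
          simp only [hm]
          rw [ENNReal.mul_rpow_of_nonneg _ _ hq.sub_one_pos.le, ← ENNReal.rpow_mul]
          have : 1 / q * (q - 1) = 1 / q' := by
            have := hq.inv_add_inv_eq_one
            rw [mul_sub, one_div_mul_cancel hq0.ne', one_div, one_div]; linarith
          rw [this]; ring
      _ ≤ 2 ^ q * Y * M ^ (q - 1) := by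
          gcongr
          · exact hq.sub_one_pos.le
          · exact le_iSup m t
  have hMq : M ^ q ≤ 2 ^ q * Y * (M ^ q) ^ (1 / q') := by
    have e : (M ^ q) ^ (1 / q') = M ^ (q - 1) := by
      rw [← ENNReal.rpow_mul]
      congr 1
      have := hq.inv_add_inv_eq_one
      rw [one_div, show q'⁻¹ = 1 - q⁻¹ by linarith, mul_sub, mul_inv_cancel₀ hq0.ne', mul_one]
    rw [e, ← ENNReal.le_rpow_inv_iff hq0]
    refine iSup_le fun s => ?_
    rw [ENNReal.le_rpow_inv_iff hq0]
    exact hstep s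
  have := rpow_le_of_le_mul_rpow hq (ENNReal.rpow_ne_top_of_nonneg hq0.le hMt) hMq
  rw [← ENNReal.rpow_mul, mul_one_div_cancel hq0.ne', ENNReal.rpow_one] at this
  exact (le_iSup m t).trans this

end

/-! ### Shifted dyadic grids and the dyadic model of the kernel. -/

section

open scoped Classical

variable {n : ℕ}

/-- The translation of the `k`-th generation, in units of the side length. -/
def shift (τ : Bool) (k : ℤ) : ℝ := if τ then (-1) ^ k / 3 else 0

/-- The generation `k` index of a coordinate. -/
def cell (τ : Bool) (k : ℤ) (u : ℝ) : ℤ := ⌊u * 2 ^ k - shift τ k⌋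

/-- The dyadic cube of side length `2 ^ (-k)` with index `m` in the grid with shift `τ`. -/
def gridCube (τ : Fin n → Bool) (k : ℤ) (m : Fin n → ℤ) : Set (EuclideanSpace ℝ (Fin n)) :=
  cube (WithLp.toLp 2 fun i => (m i + shift (τ i) k) * 2 ^ (-k)) (2 ^ (-k))

theorem mem_gridCube {τ : Fin n → Bool} {k : ℤ} {m : Fin n → ℤ} {x : EuclideanSpace ℝ (Fin n)} :
    x ∈ gridCube τ k m ↔ ∀ i, cell (τ i) k (x i) = m i := by
  have hk : (0 : ℝ) < 2 ^ k := by positivity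
  refine forall_congr' fun i => ?_
  rw [cell, Int.floor_eq_iff]
  simp only [zpow_neg]
  have e : ((m i : ℝ) + shift (τ i) k) * (2 ^ k)⁻¹ + (2 ^ k)⁻¹ =
      ((m i : ℝ) + shift (τ i) k + 1) * (2 ^ k)⁻¹ := by ring
  rw [e, ← div_eq_mul_inv, ← div_eq_mul_inv, div_le_iff₀ hk, lt_div_iff₀ hk]
  constructor <;> rintro ⟨h1, h2⟩ <;> constructor <;> linarith

theorem neg_one_zpow_cases (k : ℤ) : ((-1 : ℝ) ^ k = 1 ∧ (-1 : ℝ) ^ (k + 1) = -1) ∨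
    ((-1 : ℝ) ^ k = -1 ∧ (-1 : ℝ) ^ (k + 1) = 1) := by
  rw [zpow_add_one₀ (by norm_num)]
  rcases Int.even_or_odd k with h | h
  · left; simp [h.neg_one_zpow]
  · right; simp [h.neg_one_zpow]

/-- Twice the shift of one generation differs from the next shift by an integer (`2/3 = -1/3 + 1`),
so the cells of generation `k` are unions of two cells of generation `k + 1`. This is why the shift
alternates in sign. -/
theorem cell_eq_of_cell_succ_eq {τ : Bool} {k : ℤ} {u v : ℝ} (h : cell τ (k + 1) u = cell τ (k + 1) v) :
    cell τ k u = cell τ k v := by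
  obtain ⟨e, he⟩ : ∃ e : ℤ, 2 * shift τ k = shift τ (k + 1) - e := by
    rcases τ with _ | _
    · exact ⟨0, by simp [shift]⟩
    · rcases neg_one_zpow_cases k with h | h
      · exact ⟨-1, by simp only [shift, h, if_true]; norm_num⟩
      · exact ⟨1, by simp only [shift, h, if_true]; norm_num⟩
  have key : ∀ u : ℝ, cell τ k u = (cell τ (k + 1) u + e) / 2 := by
    intro u
    rw [cell, Int.floor_eq_iff]
    set c := cell τ (k + 1) u with hc
    have h1 : (c : ℝ) ≤ u * 2 ^ (k + 1) - shift τ (k + 1) := Int.floor_le _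
    have h2 : u * 2 ^ (k + 1) - shift τ (k + 1) < c + 1 := Int.lt_floor_add_one _
    rw [zpow_add_one₀ (by norm_num)] at h1 h2
    have h3 : 2 * ((c + e) / 2) ≤ c + e := Int.mul_ediv_self_le (by norm_num)
    have h4 : c + e + 1 ≤ 2 * ((c + e) / 2) + 2 := by omega
    have h3' : 2 * (((c + e) / 2 : ℤ) : ℝ) ≤ c + e := by exact_mod_cast h3
    have h4' : (c : ℝ) + e + 1 ≤ 2 * (((c + e) / 2 : ℤ) : ℝ) + 2 := by exact_mod_cast h4
    constructor <;> linarith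
  rw [key, key, h]

theorem cell_eq_of_cell_eq {τ : Bool} {k l : ℤ} (hkl : k ≤ l) {u v : ℝ} (h : cell τ l u = cell τ l v) :
    cell τ k u = cell τ k v := by
  obtain ⟨j, rfl⟩ := Int.le.dest hkl
  induction j with
  | zero => simpa using h
  | succ j ih =>
    refine ih (by omega) (cell_eq_of_cell_succ_eq ?_)
    convert h using 2 <;> push_cast <;> ring

theorem cell_mono (τ : Bool) (k : ℤ) : Monotone (cell τ k) := by
  intro u v h
  refine Int.floor_le_floor ?_
  have : (0 : ℝ) < 2 ^ k := by positivity
  gcongr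

/-- The one-third trick. After rescaling, the interval has length below `1/3`. If its endpoints are
separated by an integer `N`, it lies within distance less than `1/3` of `N` and so misses the
lattice shifted by `1/3` in either direction. -/
theorem exists_cell_eq_of_lt {k : ℤ} {a b : ℝ} (hab : a ≤ b) (h : 3 * (b - a) < 2 ^ (-k)) :
    ∃ τ, cell τ k a = cell τ k b := by
  have hk : (0 : ℝ) < 2 ^ k := by positivity
  set u := a * 2 ^ k with hu
  set v := b * 2 ^ k with hv
  have huv : u ≤ v := mul_le_mul_of_nonneg_right hab hk.le
  have h1 : v - u < 1 / 3 := by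
    have := mul_lt_mul_of_pos_right h hk
    rw [zpow_neg, inv_mul_cancel₀ hk.ne'] at this
    linarith
  by_cases hfl : ⌊u⌋ = ⌊v⌋
  · exact ⟨false, by simpa [cell, shift] using hfl⟩
  refine ⟨true, ?_⟩
  have hlt : ⌊u⌋ < ⌊v⌋ := lt_of_le_of_ne (Int.floor_le_floor huv) hfl
  have hN : u < ⌊v⌋ := Int.floor_lt.1 hlt
  have hN' : (⌊v⌋ : ℝ) ≤ v := Int.floor_le v
  simp only [cell, shift, if_true]
  rcases neg_one_zpow_cases k with he | he
  · rw [he.1]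
    have e1 : ⌊u - 1 / 3⌋ = ⌊v⌋ - 1 := by
      rw [Int.floor_eq_iff]; push_cast; constructor <;> linarith
    have e2 : ⌊v - 1 / 3⌋ = ⌊v⌋ - 1 := by
      rw [Int.floor_eq_iff]; push_cast; constructor <;> linarith
    rw [e1, e2]
  · rw [he.1]
    have e1 : ⌊u - -1 / 3⌋ = ⌊v⌋ := by
      rw [Int.floor_eq_iff]; constructor <;> linarith
    have e2 : ⌊v - -1 / 3⌋ = ⌊v⌋ := by
      rw [Int.floor_eq_iff]; constructor <;> linarith
    rw [e1, e2]

/-- The shift is chosen separately in each coordinate, hence `2 ^ n` grids. The spread of the three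
points in a coordinate is at most the sum of the two distances from `x`. -/
theorem exists_gridCube_mem {k : ℤ} {x y z : EuclideanSpace ℝ (Fin n)}
    (h : 3 * (dist x y + dist x z) < 2 ^ (-k)) :
    ∃ τ m, x ∈ gridCube τ k m ∧ y ∈ gridCube τ k m ∧ z ∈ gridCube τ k m := by
  have hco : ∀ (u v : EuclideanSpace ℝ (Fin n)) i, |u i - v i| ≤ dist u v := fun u v i => by
    rw [dist_eq_norm]
    simpa using PiLp.norm_apply_le (u - v) i
  have hex : ∀ i, ∃ τ, cell τ k (y i) = cell τ k (x i) ∧ cell τ k (z i) = cell τ k (x i) := by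
    intro i
    have h1 := abs_le.1 (hco x y i)
    have h2 := abs_le.1 (hco x z i)
    have d1 : 0 ≤ dist x y := dist_nonneg
    have d2 : 0 ≤ dist x z := dist_nonneg
    set a := min (x i) (min (y i) (z i)) with ha
    set b := max (x i) (max (y i) (z i)) with hb
    have hax : a ≤ x i := min_le_left _ _
    have hay : a ≤ y i := (min_le_right _ _).trans (min_le_left _ _)
    have haz : a ≤ z i := (min_le_right _ _).trans (min_le_right _ _)
    have hbx : x i ≤ b := le_max_left _ _
    have hby : y i ≤ b := (le_max_left _ _).trans (le_max_right _ _)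
    have hbz : z i ≤ b := (le_max_right _ _).trans (le_max_right _ _)
    have hba : b - a ≤ dist x y + dist x z := by
      have hb' : b ≤ a + (dist x y + dist x z) := by
        have ha' : ∀ c, c ≤ x i + (dist x y + dist x z) → c ≤ y i + (dist x y + dist x z) →
            c ≤ z i + (dist x y + dist x z) → c ≤ a + (dist x y + dist x z) := by
          intro c h1 h2 h3
          rw [← sub_le_iff_le_add]
          exact le_min (by linarith) (le_min (by linarith) (by linarith))
        refine max_le (ha' _ ?_ ?_ ?_) (max_le (ha' _ ?_ ?_ ?_) (ha' _ ?_ ?_ ?_)) <;> linarith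
      linarith
    obtain ⟨τ, hτ⟩ := exists_cell_eq_of_lt (k := k) (hax.trans hbx) (by linarith)
    have aux : ∀ c, a ≤ c → c ≤ b → cell τ k c = cell τ k a := fun c h1 h2 =>
      le_antisymm ((cell_mono τ k h2).trans hτ.ge) (cell_mono τ k h1)
    exact ⟨τ, by rw [aux _ hay hby, aux _ hax hbx], by rw [aux _ haz hbz, aux _ hax hbx]⟩
  choose τ hτ using hex
  refine ⟨τ, fun i => cell (τ i) k (x i), ?_, ?_, ?_⟩ <;> rw [mem_gridCube] <;> intro i
  · rfl
  · exact (hτ i).1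
  · exact (hτ i).2

/-- The dyadic grid with shift `τ`. -/
def grid (τ : Fin n → Bool) : Set (Set (EuclideanSpace ℝ (Fin n))) :=
  Set.range fun p : ℤ × (Fin n → ℤ) => gridCube τ p.1 p.2

theorem grid_countable (τ : Fin n → Bool) : (grid τ).Countable := Set.countable_range _

theorem measurableSet_cube (a : EuclideanSpace ℝ (Fin n)) (l : ℝ) : MeasurableSet (cube a l) := by
  have : cube a l = ⋂ i, ((fun x : EuclideanSpace ℝ (Fin n) => x i) ⁻¹' Set.Ico (a i) (a i + l)) := by
    ext x; simp [cube]
  rw [this]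
  exact MeasurableSet.iInter fun i => (by fun_prop : Measurable fun x : EuclideanSpace ℝ (Fin n) => x i)
    measurableSet_Ico

theorem isLaminar_grid (τ : Fin n → Bool) : IsLaminar (grid τ) := by
  have aux : ∀ k l : ℤ, k ≤ l → ∀ m m' : Fin n → ℤ, ∀ x, x ∈ gridCube τ k m → x ∈ gridCube τ l m' →
      gridCube τ l m' ⊆ gridCube τ k m := by
    intro k l hkl m m' x hx hx' y hy
    rw [mem_gridCube] at hx hx' hy ⊢
    intro i
    rw [← hx i]
    exact cell_eq_of_cell_eq hkl ((hy i).trans (hx' i).symm)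
  refine ⟨?_, ?_, ?_⟩
  · rintro Q ⟨p, rfl⟩
    exact measurableSet_cube _ _
  · rintro Q ⟨p, rfl⟩
    refine ⟨WithLp.toLp 2 fun i => (p.2 i + shift (τ i) p.1) * 2 ^ (-p.1), fun i => ⟨le_rfl, ?_⟩⟩
    have : (0 : ℝ) < 2 ^ (-p.1) := by positivity
    linarith
  · rintro P ⟨⟨k, m⟩, rfl⟩ Q ⟨⟨l, m'⟩, rfl⟩
    by_cases hdis : Disjoint (gridCube τ k m) (gridCube τ l m')
    · exact Or.inr (Or.inr hdis)
    obtain ⟨x, hx, hx'⟩ := Set.not_disjoint_iff.1 hdis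
    rcases le_total k l with h | h
    · exact Or.inr (Or.inl (aux k l h m m' x hx hx'))
    · exact Or.inl (aux l k h m' m x hx' hx)

/-- This makes the generation of a dyadic cube depend only on the set. In dimension zero all cubes
coincide and it fails. -/
theorem side_le_of_cube_subset (hn : 0 < n) {a a' : EuclideanSpace ℝ (Fin n)} {l l' : ℝ} (hl : 0 < l)
    (h : cube a l ⊆ cube a' l') : l ≤ l' := by
  by_contra! hcon
  have ha : a ∈ cube a' l' := h fun i => ⟨le_rfl, by linarith⟩
  have hi := ha ⟨0, hn⟩
  have hl' : 0 < l' := by linarith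
  have hb : (WithLp.toLp 2 fun i => a i + l' : EuclideanSpace ℝ (Fin n)) ∈ cube a' l' :=
    h fun i => ⟨by simp; linarith, by simp; linarith⟩
  have hb' := (hb ⟨0, hn⟩).2
  simp only at hb'
  linarith

/-- The generation of a dyadic cube. -/
def level (Q : Set (EuclideanSpace ℝ (Fin n))) : ℤ :=
  if h : ∃ (k : ℤ) (τ : Fin n → Bool) (m : Fin n → ℤ), Q = gridCube τ k m then h.choose else 0

theorem level_gridCube (hn : 0 < n) (τ : Fin n → Bool) (k : ℤ) (m : Fin n → ℤ) :
    level (gridCube τ k m) = k := by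
  have h : ∃ (k' : ℤ) (τ' : Fin n → Bool) (m' : Fin n → ℤ), gridCube τ k m = gridCube τ' k' m' :=
    ⟨k, τ, m, rfl⟩
  rw [level, dif_pos h]
  obtain ⟨τ', m', he⟩ := h.choose_spec
  have h1 := side_le_of_cube_subset hn (by positivity) he.subset
  have h2 := side_le_of_cube_subset hn (by positivity) he.superset
  rw [zpow_le_zpow_iff_right₀ (by norm_num)] at h1 h2
  omega

/-- The weight of a dyadic cube: its side length to the power `-s`. -/
def cubeWeight (s : ℝ) (Q : Set (EuclideanSpace ℝ (Fin n))) : ℝ≥0∞ := ((2 : ℝ≥0∞) ^ level Q) ^ s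

theorem cubeWeight_ne_top {s : ℝ} (hs : 0 < s) (Q : Set (EuclideanSpace ℝ (Fin n))) :
    cubeWeight s Q ≠ ∞ :=
  ENNReal.rpow_ne_top_of_nonneg hs.le (ENNReal.zpow_ne_top (by norm_num) (by norm_num) _)

theorem dist_le_of_mem_cube {a x y : EuclideanSpace ℝ (Fin n)} {l : ℝ} (hl : 0 ≤ l) (hx : x ∈ cube a l)
    (hy : y ∈ cube a l) : dist x y ≤ √n * l := by
  rw [EuclideanSpace.dist_eq]
  have h : ∀ i, dist (x i) (y i) ^ 2 ≤ l ^ 2 := by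
    intro i
    rw [Real.dist_eq]
    refine pow_le_pow_left₀ (abs_nonneg _) (abs_le.2 ⟨?_, ?_⟩) 2 <;>
      linarith [(hx i).1, (hx i).2, (hy i).1, (hy i).2]
  calc √(∑ i, dist (x i) (y i) ^ 2) ≤ √(∑ _i : Fin n, l ^ 2) :=
        Real.sqrt_le_sqrt (Finset.sum_le_sum fun i _ => h i)
    _ = √n * l := by
      rw [Finset.sum_const, Finset.card_univ, Fintype.card_fin, nsmul_eq_mul,
        Real.sqrt_mul (Nat.cast_nonneg n), Real.sqrt_sq hl]

/-- The indicator function of `Q × Q × Q`. -/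
def tripleIndicator (Q : Set (EuclideanSpace ℝ (Fin n))) (x y z : EuclideanSpace ℝ (Fin n)) : ℝ≥0∞ :=
  Q.indicator 1 x * (Q.indicator 1 y * Q.indicator 1 z)

theorem tripleIndicator_eq (Q : Set (EuclideanSpace ℝ (Fin n))) (x y z : EuclideanSpace ℝ (Fin n)) :
    tripleIndicator Q x y z = if x ∈ Q ∧ y ∈ Q ∧ z ∈ Q then 1 else 0 := by
  by_cases hx : x ∈ Q <;> by_cases hy : y ∈ Q <;> by_cases hz : z ∈ Q <;>
    simp [tripleIndicator, hx, hy, hz]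

theorem two_zpow_eq_ofReal (k : ℤ) : (2 : ℝ≥0∞) ^ k = ENNReal.ofReal ((2 : ℝ) ^ k) := by
  have h : ((2 : ℝ) ^ k) = (((2 : ℝ≥0) ^ k : ℝ≥0) : ℝ) := by push_cast; rfl
  rw [h, ENNReal.ofReal_coe_nnreal, ENNReal.coe_zpow (by norm_num)]
  rfl

/-- The constant in the domination of the dyadic kernels by the kernel. -/
def lowerConst (n : ℕ) (α : ℝ) : ℝ≥0∞ :=
  geomConst (2 * n - α) * ENNReal.ofReal (2 * √n) ^ (2 * (n : ℝ) - α)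

theorem lowerConst_ne_top {α : ℝ} (hα : α < 2 * (n : ℝ)) : lowerConst n α ≠ ∞ :=
  ENNReal.mul_ne_top (geomConst_ne_top (by linarith))
    (ENNReal.rpow_ne_top_of_nonneg (by linarith) ENNReal.ofReal_ne_top)

/-- Each generation of a grid has one cube through `x`, so the sum is geometric in the level. A cube
of side `2 ^ (-k)` containing all three points has `dist x y + dist x z ≤ 2 * √n * 2 ^ (-k)`, which
caps the levels. -/
theorem sum_cubeWeight_le_kernel (hn : 0 < n) {α : ℝ} (hα : α < 2 * (n : ℝ)) {τ : Fin n → Bool}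
    {B : Finset (Set (EuclideanSpace ℝ (Fin n)))}
    (hB : (B : Set (Set (EuclideanSpace ℝ (Fin n)))) ⊆ grid τ) (x y z : EuclideanSpace ℝ (Fin n)) :
    ∑ Q ∈ B, cubeWeight (2 * n - α) Q * tripleIndicator Q x y z ≤
      lowerConst n α * kernel α x y z := by
  set s := 2 * (n : ℝ) - α with hs
  have hs0 : 0 < s := by linarith
  set d := dist x y + dist x z with hd
  set B' := B.filter fun Q => x ∈ Q ∧ y ∈ Q ∧ z ∈ Q with hB'
  have hinj : Set.InjOn level (B' : Set (Set (EuclideanSpace ℝ (Fin n)))) := by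
    intro P hP Q hQ hPQ
    rw [Finset.mem_coe, hB', Finset.mem_filter] at hP hQ
    obtain ⟨⟨k, m⟩, rfl⟩ := hB hP.1
    obtain ⟨⟨l, m'⟩, rfl⟩ := hB hQ.1
    simp only [level_gridCube hn] at hPQ
    subst hPQ
    have : m = m' := by
      funext i
      exact ((mem_gridCube.1 hP.2.1) i).symm.trans ((mem_gridCube.1 hQ.2.1) i)
    rw [this]
  calc ∑ Q ∈ B, cubeWeight s Q * tripleIndicator Q x y z = ∑ Q ∈ B', ((2 : ℝ≥0∞) ^ level Q) ^ s := by
        rw [hB', Finset.sum_filter]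
        refine Finset.sum_congr rfl fun Q _ => ?_
        rw [tripleIndicator_eq, cubeWeight]
        split_ifs <;> simp
    _ = ∑ k ∈ B'.image level, ((2 : ℝ≥0∞) ^ k) ^ s :=
        (Finset.sum_image (f := fun k : ℤ => ((2 : ℝ≥0∞) ^ k) ^ s) hinj).symm
    _ ≤ geomConst s * (ENNReal.ofReal (2 * √n) / ENNReal.ofReal d) ^ s := by
        refine sum_zpow_rpow_le hs0 _ _ fun k hk => ?_
        obtain ⟨Q, hQ, rfl⟩ := Finset.mem_image.1 hk
        rw [hB', Finset.mem_filter] at hQ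
        obtain ⟨hQB, hx, hy, hz⟩ := hQ
        obtain ⟨⟨k, m⟩, rfl⟩ := hB hQB
        simp only [level_gridCube hn] at hx hy hz ⊢
        have hpos : 0 < 2 * √(n : ℝ) := by positivity
        rw [ENNReal.le_div_iff_mul_le (Or.inr (ENNReal.ofReal_pos.2 hpos).ne')
          (Or.inl ENNReal.ofReal_ne_top)]
        have h1 := dist_le_of_mem_cube (by positivity) hx hy
        have h2 := dist_le_of_mem_cube (by positivity) hx hz
        have hk : (0 : ℝ) < 2 ^ k := by positivity
        rw [two_zpow_eq_ofReal, ← ENNReal.ofReal_mul hk.le]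
        refine ENNReal.ofReal_le_ofReal ?_
        have hdk : d ≤ 2 * √n * 2 ^ (-k) := by rw [hd]; linarith
        calc (2 : ℝ) ^ k * d ≤ 2 ^ k * (2 * √n * 2 ^ (-k)) := by gcongr
          _ = 2 * √n := by rw [zpow_neg]; field_simp
    _ = lowerConst n α * kernel α x y z := by
        rw [lowerConst, kernel, div_eq_mul_inv, ENNReal.mul_rpow_of_nonneg _ _ hs0.le,
          ENNReal.inv_rpow, ← ENNReal.rpow_neg]
        ring

/-- The constant in the domination of the kernel by the dyadic kernels. -/
def upperConst (n : ℕ) (α : ℝ) : ℝ≥0∞ := 6 ^ (2 * (n : ℝ) - α)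

theorem upperConst_ne_top {α : ℝ} (hα : α < 2 * (n : ℝ)) : upperConst n α ≠ ∞ :=
  ENNReal.rpow_ne_top_of_nonneg (by linarith) (by norm_num)

/-- Off the diagonal, one cube of side between `3 * d` and `6 * d` containing the three points is
enough; this gives the constant `6 ^ s`. -/
theorem kernel_le_sum_cubeWeight (hn : 0 < n) {α : ℝ} (hα : α < 2 * (n : ℝ))
    (x y z : EuclideanSpace ℝ (Fin n)) :
    kernel α x y z ≤ upperConst n α * ∑ τ : Fin n → Bool, ∑' Q : grid τ,
      cubeWeight (2 * n - α) (Q : Set (EuclideanSpace ℝ (Fin n))) *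
        tripleIndicator (Q : Set (EuclideanSpace ℝ (Fin n))) x y z := by
  set s := 2 * (n : ℝ) - α with hs
  have hs0 : 0 < s := by linarith
  set d := dist x y + dist x z with hd
  have hd0 : 0 ≤ d := add_nonneg dist_nonneg dist_nonneg
  set W := ∑ τ : Fin n → Bool, ∑' Q : grid τ,
      cubeWeight s (Q : Set (EuclideanSpace ℝ (Fin n))) *
        tripleIndicator (Q : Set (EuclideanSpace ℝ (Fin n))) x y z with hW
  have hk : ∀ k : ℤ, 3 * d < 2 ^ (-k) → ((2 : ℝ≥0∞) ^ k) ^ s ≤ W := by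
    intro k hk
    obtain ⟨τ, m, hx, hy, hz⟩ := exists_gridCube_mem hk
    have h1 : ((2 : ℝ≥0∞) ^ k) ^ s = cubeWeight s (gridCube τ k m) *
        tripleIndicator (gridCube τ k m) x y z := by
      rw [cubeWeight, level_gridCube hn, tripleIndicator_eq, if_pos ⟨hx, hy, hz⟩, mul_one]
    rw [h1]
    refine le_trans ?_ (Finset.single_le_sum (f := fun τ : Fin n → Bool => ∑' Q : grid τ,
      cubeWeight s (Q : Set (EuclideanSpace ℝ (Fin n))) *
        tripleIndicator (Q : Set (EuclideanSpace ℝ (Fin n))) x y z) (fun _ _ => zero_le)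
        (Finset.mem_univ τ))
    exact ENNReal.le_tsum (f := fun Q : grid τ =>
      cubeWeight s (Q : Set (EuclideanSpace ℝ (Fin n))) *
        tripleIndicator (Q : Set (EuclideanSpace ℝ (Fin n))) x y z) ⟨gridCube τ k m, ⟨(k, m), rfl⟩⟩
  rcases hd0.eq_or_lt with h0 | hpos
  -- On the diagonal `d = 0` there are admissible cubes of every generation, so `W` is infinite like
  -- the kernel.
  · have htop : W = ∞ := by
      by_contra hne
      obtain ⟨N, hN⟩ := ENNReal.exists_nat_gt
        (ENNReal.rpow_ne_top_of_nonneg (inv_nonneg.2 hs0.le) hne)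
      have h1 := hk (N : ℤ) (by rw [← h0, mul_zero]; positivity)
      rw [← ENNReal.le_rpow_inv_iff hs0] at h1
      have h2 : (N : ℝ≥0∞) ≤ 2 ^ (N : ℤ) := by
        rw [zpow_natCast]
        exact_mod_cast Nat.lt_two_pow_self.le
      exact absurd (hN.trans_le (h2.trans h1)) (lt_irrefl _)
    rw [htop, upperConst, ENNReal.mul_top]
    · exact le_top
    · exact (ENNReal.rpow_pos (by norm_num) (by norm_num)).ne'
  · obtain ⟨j, hj1, hj2⟩ := exists_mem_Ico_zpow (x := 3 * d) (y := (2 : ℝ)) (by linarith) (by norm_num)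
    have h1 := hk (-(j + 1)) (by simpa using hj2)
    calc kernel α x y z = 6 ^ s * (ENNReal.ofReal (6 * d)⁻¹) ^ s := by
          rw [kernel, ← hs, ← hd, ENNReal.ofReal_inv_of_pos (by linarith), ENNReal.inv_rpow,
            ENNReal.ofReal_mul (by norm_num), ENNReal.mul_rpow_of_nonneg _ _ hs0.le,
            ENNReal.mul_inv (Or.inl ?_) (Or.inl ?_), ← mul_assoc, ENNReal.rpow_neg]
          · norm_num
            rw [ENNReal.mul_inv_cancel, one_mul]
            · exact (ENNReal.rpow_pos (by norm_num) (by norm_num)).ne'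
            · exact ENNReal.rpow_ne_top_of_nonneg hs0.le (by norm_num)
          · exact (ENNReal.rpow_pos (by norm_num) (by norm_num)).ne'
          · exact ENNReal.rpow_ne_top_of_nonneg hs0.le (by norm_num)
      _ ≤ 6 ^ s * ((2 : ℝ≥0∞) ^ (-(j + 1))) ^ s := by
          gcongr
          rw [two_zpow_eq_ofReal]
          refine ENNReal.ofReal_le_ofReal ?_
          rw [zpow_neg]
          refine inv_anti₀ (by positivity) ?_
          rw [zpow_add_one₀ (by norm_num)]
          linarith
      _ ≤ upperConst n α * W := by rw [upperConst]; gcongr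

end

/-! ### Transfer between the dyadic sums and the integral operator. -/

section

open scoped Classical

variable {n : ℕ}

theorem cube_measure_ne_top (μ : Measure (EuclideanSpace ℝ (Fin n))) [IsLocallyFiniteMeasure μ]
    (a : EuclideanSpace ℝ (Fin n)) (l : ℝ) : μ (cube a l) ≠ ∞ := by
  refine (Bornology.IsBounded.measure_lt_top (Metric.isBounded_iff.2 ⟨√n * max l 0, ?_⟩)).ne
  intro x hx y hy
  have h : cube a l ⊆ cube a (max l 0) := fun z hz i =>
    ⟨(hz i).1, (hz i).2.trans_le (add_le_add le_rfl (le_max_left _ _))⟩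
  exact dist_le_of_mem_cube (le_max_right _ _) (h hx) (h hy)

theorem grid_measure_ne_top (μ : Measure (EuclideanSpace ℝ (Fin n))) [IsLocallyFiniteMeasure μ]
    {τ : Fin n → Bool} : ∀ Q ∈ grid τ, μ Q ≠ ∞ := by
  rintro Q ⟨p, rfl⟩
  exact cube_measure_ne_top μ _ _

/-- The full dyadic sum over a grid. -/
def gridSum (τ : Fin n → Bool) (c : Set (EuclideanSpace ℝ (Fin n)) → ℝ≥0∞)
    (x : EuclideanSpace ℝ (Fin n)) : ℝ≥0∞ :=
  ∑' Q : grid τ, c Q * (Q : Set (EuclideanSpace ℝ (Fin n))).indicator 1 x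

/-- A finite set of members of a grid, as a finite set of sets. -/
def subfamily {τ : Fin n → Bool} (s : Finset (grid τ)) : Finset (Set (EuclideanSpace ℝ (Fin n))) :=
  s.map (Function.Embedding.subtype _)

theorem subfamily_subset {τ : Fin n → Bool} (s : Finset (grid τ)) :
    (subfamily s : Set (Set (EuclideanSpace ℝ (Fin n)))) ⊆ grid τ := by
  intro Q hQ
  obtain ⟨P, _, rfl⟩ := Finset.mem_map.1 hQ
  exact P.2

theorem gridSum_eq_iSup (τ : Fin n → Bool) (c : Set (EuclideanSpace ℝ (Fin n)) → ℝ≥0∞)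
    (x : EuclideanSpace ℝ (Fin n)) :
    gridSum τ c x = ⨆ s : Finset (grid τ), dyadicSum c (subfamily s) x := by
  rw [gridSum, ENNReal.tsum_eq_iSup_sum]
  simp [dyadicSum, subfamily]

theorem dyadicSum_subfamily_mono {τ : Fin n → Bool} (c : Set (EuclideanSpace ℝ (Fin n)) → ℝ≥0∞) :
    Monotone fun s : Finset (grid τ) => dyadicSum c (subfamily s) := by
  intro s t hst x
  exact Finset.sum_le_sum_of_subset (Finset.map_subset_map.2 hst)

theorem measurable_dyadicSum_subfamily {τ : Fin n → Bool} (s : Finset (grid τ))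
    (c : Set (EuclideanSpace ℝ (Fin n)) → ℝ≥0∞) : Measurable (dyadicSum c (subfamily s)) :=
  measurable_dyadicSum (fun Q hQ => (isLaminar_grid τ).measurableSet Q (subfamily_subset s hQ)) c

instance (τ : Fin n → Bool) : Countable (grid τ) := (grid_countable τ).to_subtype

theorem measurable_gridSum (τ : Fin n → Bool) (c : Set (EuclideanSpace ℝ (Fin n)) → ℝ≥0∞) :
    Measurable (gridSum τ c) := by
  have : gridSum τ c = fun x => ⨆ s : Finset (grid τ), dyadicSum c (subfamily s) x := by
    ext x; exact gridSum_eq_iSup τ c x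
  rw [this]
  exact Measurable.iSup fun s => measurable_dyadicSum_subfamily s c

theorem lintegral_gridSum_rpow_le {τ : Fin n → Bool} {c : Set (EuclideanSpace ℝ (Fin n)) → ℝ≥0∞}
    {w : Measure (EuclideanSpace ℝ (Fin n))} {q : ℝ} (hq : 0 < q) {Y : ℝ≥0∞}
    (h : ∀ A : Finset (Set (EuclideanSpace ℝ (Fin n))),
      (A : Set (Set (EuclideanSpace ℝ (Fin n)))) ⊆ grid τ →
      (∫⁻ x, dyadicSum c A x ^ q ∂w) ^ (1 / q) ≤ Y) :
    ∫⁻ x, gridSum τ c x ^ q ∂w ≤ Y ^ q := by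
  have e : ∀ x, gridSum τ c x ^ q = ⨆ s : Finset (grid τ), dyadicSum c (subfamily s) x ^ q :=
    fun x => by
      rw [gridSum_eq_iSup]
      exact (ENNReal.orderIsoRpow q hq).map_iSup _
  simp_rw [e]
  rw [lintegral_iSup_directed (fun s => ((measurable_dyadicSum_subfamily s c).pow_const q).aemeasurable)]
  · refine iSup_le fun s => ?_
    have := h (subfamily s) (subfamily_subset s)
    rwa [one_div, ENNReal.rpow_inv_le_iff hq] at this
  · refine Monotone.directed_le fun s t hst x => ?_
    exact ENNReal.rpow_le_rpow (dyadicSum_subfamily_mono c hst x) hq.le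

theorem gridSum_weak_le {τ : Fin n → Bool} {c : Set (EuclideanSpace ℝ (Fin n)) → ℝ≥0∞}
    {w : Measure (EuclideanSpace ℝ (Fin n))} {q : ℝ} (hq : 0 < q) {Y : ℝ≥0∞} (t : ℝ≥0)
    (h : ∀ A : Finset (Set (EuclideanSpace ℝ (Fin n))),
      (A : Set (Set (EuclideanSpace ℝ (Fin n)))) ⊆ grid τ →
      t * w {x | (t : ℝ≥0∞) < dyadicSum c A x} ^ (1 / q) ≤ Y) :
    t * w {x | (t : ℝ≥0∞) < gridSum τ c x} ^ (1 / q) ≤ Y := by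
  have e : {x | (t : ℝ≥0∞) < gridSum τ c x} =
      ⋃ s : Finset (grid τ), {x | (t : ℝ≥0∞) < dyadicSum c (subfamily s) x} := by
    ext x
    simp only [Set.mem_ofPred_eq, Set.mem_iUnion, gridSum_eq_iSup, lt_iSup_iff]
  rw [e, Directed.measure_iUnion]
  · have hi := (ENNReal.orderIsoRpow (1 / q) (one_div_pos.2 hq)).map_iSup
      fun s : Finset (grid τ) => w {x | (t : ℝ≥0∞) < dyadicSum c (subfamily s) x}
    simp only [ENNReal.orderIsoRpow_apply] at hi
    rw [hi, ENNReal.mul_iSup]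
    exact iSup_le fun s => h (subfamily s) (subfamily_subset s)
  · refine Monotone.directed_le fun s t' hst x hx => ?_
    exact lt_of_lt_of_le hx (dyadicSum_subfamily_mono c hst x)

theorem lintegral_tripleIndicator_mul {σ₁ σ₂ : Measure (EuclideanSpace ℝ (Fin n))} [SFinite σ₁]
    [SFinite σ₂] {Q : Set (EuclideanSpace ℝ (Fin n))} (hQ : MeasurableSet Q)
    {f₁ f₂ : EuclideanSpace ℝ (Fin n) → ℝ≥0∞} (hf₁ : Measurable f₁) (hf₂ : Measurable f₂)
    (x : EuclideanSpace ℝ (Fin n)) :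
    ∫⁻ y, tripleIndicator Q x y.1 y.2 * (f₁ y.1 * f₂ y.2) ∂(σ₁.prod σ₂) =
      (∫⁻ y in Q, f₁ y ∂σ₁) * (∫⁻ y in Q, f₂ y ∂σ₂) * Q.indicator 1 x := by
  have e : ∀ y : EuclideanSpace ℝ (Fin n) × EuclideanSpace ℝ (Fin n),
      tripleIndicator Q x y.1 y.2 * (f₁ y.1 * f₂ y.2) =
        Q.indicator 1 x * (Q.indicator f₁ y.1 * Q.indicator f₂ y.2) := by
    intro y
    by_cases h1 : y.1 ∈ Q <;> by_cases h2 : y.2 ∈ Q <;> simp [tripleIndicator, h1, h2]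
  simp_rw [e]
  have ht : Q.indicator (1 : EuclideanSpace ℝ (Fin n) → ℝ≥0∞) x ≠ ∞ := by
    by_cases hx : x ∈ Q <;> simp [hx]
  rw [lintegral_const_mul' _ _ ht, lintegral_prod_mul (hf₁.indicator hQ).aemeasurable
    (hf₂.indicator hQ).aemeasurable, lintegral_indicator hQ, lintegral_indicator hQ, mul_comm]

theorem measurable_tripleIndicator {Q : Set (EuclideanSpace ℝ (Fin n))} (hQ : MeasurableSet Q)
    (x : EuclideanSpace ℝ (Fin n)) : Measurable
      fun y : EuclideanSpace ℝ (Fin n) × EuclideanSpace ℝ (Fin n) => tripleIndicator Q x y.1 y.2 :=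
  (((measurable_one.indicator hQ).comp measurable_fst).mul
    ((measurable_one.indicator hQ).comp measurable_snd)).const_mul _

theorem fracIntNonneg_le_gridSum (hn : 0 < n) {α : ℝ} (hα : α < 2 * (n : ℝ))
    {σ₁ σ₂ : Measure (EuclideanSpace ℝ (Fin n))} [SFinite σ₁] [SFinite σ₂]
    {f₁ f₂ : EuclideanSpace ℝ (Fin n) → ℝ≥0∞} (hf₁ : Measurable f₁) (hf₂ : Measurable f₂)
    (x : EuclideanSpace ℝ (Fin n)) :
    fracIntNonneg α σ₁ σ₂ f₁ f₂ x ≤ upperConst n α * ∑ τ : Fin n → Bool,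
      gridSum τ (bilinearCoeff (cubeWeight (2 * n - α)) σ₁ σ₂ f₁ f₂) x := by
  set lam : Set (EuclideanSpace ℝ (Fin n)) → ℝ≥0∞ := cubeWeight (2 * n - α) with hlam
  have hm : ∀ (τ : Fin n → Bool) (Q : grid τ), Measurable
      fun y : EuclideanSpace ℝ (Fin n) × EuclideanSpace ℝ (Fin n) =>
        lam Q * (tripleIndicator (Q : Set (EuclideanSpace ℝ (Fin n))) x y.1 y.2 *
          (f₁ y.1 * f₂ y.2)) := fun τ Q =>
    ((measurable_tripleIndicator ((isLaminar_grid τ).measurableSet Q Q.2) x).mul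
      ((hf₁.comp measurable_fst).mul (hf₂.comp measurable_snd))).const_mul _
  calc fracIntNonneg α σ₁ σ₂ f₁ f₂ x
      ≤ ∫⁻ y, upperConst n α * ∑ τ : Fin n → Bool, ∑' Q : grid τ, lam Q *
          (tripleIndicator (Q : Set (EuclideanSpace ℝ (Fin n))) x y.1 y.2 * (f₁ y.1 * f₂ y.2))
          ∂(σ₁.prod σ₂) := by
        refine lintegral_mono fun y => ?_
        refine (mul_le_mul_left (kernel_le_sum_cubeWeight hn hα x y.1 y.2) _).trans (le_of_eq ?_)
        rw [mul_assoc, Finset.sum_mul]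
        simp_rw [← ENNReal.tsum_mul_right, mul_assoc]
        rfl
    _ = upperConst n α * ∑ τ : Fin n → Bool, ∑' Q : grid τ, lam Q *
          ∫⁻ y, tripleIndicator (Q : Set (EuclideanSpace ℝ (Fin n))) x y.1 y.2 *
            (f₁ y.1 * f₂ y.2) ∂(σ₁.prod σ₂) := by
        rw [lintegral_const_mul' _ _ (upperConst_ne_top hα), lintegral_finsetSum' _
          fun τ _ => (Measurable.tsum (hm τ)).aemeasurable]
        congr 1
        refine Finset.sum_congr rfl fun τ _ => ?_
        rw [lintegral_tsum fun Q => (hm τ Q).aemeasurable]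
        refine tsum_congr fun Q => ?_
        rw [lintegral_const_mul' _ _ (cubeWeight_ne_top (by linarith) _)]
    _ = _ := by
        congr 1
        refine Finset.sum_congr rfl fun τ _ => tsum_congr fun Q => ?_
        rw [lintegral_tripleIndicator_mul ((isLaminar_grid τ).measurableSet Q Q.2) hf₁ hf₂,
          bilinearCoeff]
        ring

theorem fracIntNonneg_indicator_eq_zero {α : ℝ} {μ ν : Measure (EuclideanSpace ℝ (Fin n))}
    [SFinite μ] [SFinite ν] {F : Set (EuclideanSpace ℝ (Fin n))} (hF : MeasurableSet F)
    (h : μ F = 0 ∨ ν F = 0) (x : EuclideanSpace ℝ (Fin n)) :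
    fracIntNonneg α μ ν (F.indicator 1) (F.indicator 1) x = 0 := by
  have e : ∀ y : EuclideanSpace ℝ (Fin n) × EuclideanSpace ℝ (Fin n),
      kernel α x y.1 y.2 * (F.indicator 1 y.1 * F.indicator 1 y.2) =
        (F ×ˢ F).indicator (fun y => kernel α x y.1 y.2) y := by
    intro y
    by_cases h1 : y.1 ∈ F <;> by_cases h2 : y.2 ∈ F <;> simp [Set.indicator, h1, h2]
  rw [fracIntNonneg]
  simp_rw [e]
  rw [lintegral_indicator (hF.prod hF), setLIntegral_measure_zero]
  rw [Measure.prod_prod]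
  rcases h with h | h <;> simp [h]

theorem testConst_bound {α r s t : ℝ} (hr : 0 < r)
    {μ ν ρ : Measure (EuclideanSpace ℝ (Fin n))} [IsLocallyFiniteMeasure μ]
    [IsLocallyFiniteMeasure ν] (hs : 0 < s) (ht : 0 < t) (a : EuclideanSpace ℝ (Fin n)) {l : ℝ}
    (hl : 0 < l) :
    (∫⁻ x in cube a l,
        fracIntNonneg α μ ν ((cube a l).indicator 1) ((cube a l).indicator 1) x ^ r ∂ρ) ^ (1 / r) ≤
      testConst α r s t μ ν ρ * (μ (cube a l) ^ (1 / s) * ν (cube a l) ^ (1 / t)) := by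
  set F := cube a l with hF
  have hμ : μ F ≠ ∞ := cube_measure_ne_top μ a l
  have hν : ν F ≠ ∞ := cube_measure_ne_top ν a l
  -- With a vanishing denominator the quotient says nothing about the numerator, which is shown to
  -- vanish too.
  by_cases h0 : μ F = 0 ∨ ν F = 0
  · have hz := fracIntNonneg_indicator_eq_zero (α := α) (F := F) (measurableSet_cube a l) h0
    simp only [hz]
    rw [ENNReal.zero_rpow_of_pos hr, lintegral_zero, ENNReal.zero_rpow_of_pos (one_div_pos.2 hr)]
    exact zero_le
  · push Not at h0
    have hden0 : μ F ^ (1 / s) * ν F ^ (1 / t) ≠ 0 := by simp [h0, hμ, hν]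
    have hdent : μ F ^ (1 / s) * ν F ^ (1 / t) ≠ ∞ := ENNReal.mul_ne_top
      (ENNReal.rpow_ne_top_of_nonneg (one_div_nonneg.2 hs.le) hμ)
      (ENNReal.rpow_ne_top_of_nonneg (one_div_nonneg.2 ht.le) hν)
    rw [← ENNReal.div_le_iff hden0 hdent]
    exact le_iSup_of_le a (le_iSup_of_le l (le_iSup_of_le hl le_rfl))

/-- The dyadic sum over cubes inside `F` is dominated pointwise by the operator applied to
indicators of `F`, so dyadic testing follows from testing on cubes. -/
theorem testingBound_of_testConst (hn : 0 < n) {α r s t : ℝ} (hα : α < 2 * (n : ℝ)) (hr : 0 < r)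
    (hs : 0 < s) (ht : 0 < t) (μ ν ρ : Measure (EuclideanSpace ℝ (Fin n)))
    [IsLocallyFiniteMeasure μ] [IsLocallyFiniteMeasure ν] (τ : Fin n → Bool) :
    TestingBound (grid τ) (cubeWeight (2 * n - α)) ρ μ ν r s t
      (lowerConst n α * testConst α r s t μ ν ρ) := by
  rintro F ⟨⟨k, m⟩, rfl⟩ B hB hBF
  set F := gridCube τ k m with hF
  have hFm : MeasurableSet F := measurableSet_cube _ _
  set lam : Set (EuclideanSpace ℝ (Fin n)) → ℝ≥0∞ := cubeWeight (2 * n - α) with hlam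
  have hBm : ∀ Q ∈ B, MeasurableSet Q := fun Q hQ => (isLaminar_grid τ).measurableSet Q (hB hQ)
  set I := fracIntNonneg α μ ν (F.indicator 1) (F.indicator 1) with hI
  have hpt : ∀ x, ∑ Q ∈ B, lam Q * (μ Q * ν Q) * Q.indicator 1 x ≤ lowerConst n α * I x := by
    intro x
    have h1 : ∀ Q ∈ B, lam Q * (μ Q * ν Q) * Q.indicator 1 x =
        ∫⁻ y, lam Q * tripleIndicator Q x y.1 y.2 * (F.indicator 1 y.1 * F.indicator 1 y.2)
          ∂(μ.prod ν) := by
      intro Q hQ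
      simp_rw [mul_assoc (lam Q)]
      have hm1 : Measurable (F.indicator (1 : EuclideanSpace ℝ (Fin n) → ℝ≥0∞)) :=
        measurable_one.indicator hFm
      rw [lintegral_const_mul, lintegral_tripleIndicator_mul (hBm Q hQ) hm1 hm1,
        lintegral_indicator hFm, lintegral_indicator hFm, Measure.restrict_restrict hFm,
        Measure.restrict_restrict hFm, Set.inter_eq_right.2 (hBF Q hQ)]
      · simp
      · exact (measurable_tripleIndicator (hBm Q hQ) x).mul
          ((hm1.comp measurable_fst).mul (hm1.comp measurable_snd))
    rw [Finset.sum_congr rfl h1, ← lintegral_finsetSum']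
    · rw [hI, fracIntNonneg, ← lintegral_const_mul' _ _ (lowerConst_ne_top hα)]
      refine lintegral_mono fun y => ?_
      rw [← Finset.sum_mul]
      exact (mul_le_mul' (sum_cubeWeight_le_kernel hn hα hB x y.1 y.2) le_rfl).trans
        (mul_assoc _ _ _).le
    · intro Q hQ
      have hm1 : Measurable (F.indicator (1 : EuclideanSpace ℝ (Fin n) → ℝ≥0∞)) :=
        measurable_one.indicator hFm
      exact (((measurable_tripleIndicator (hBm Q hQ) x).const_mul _).mul
          ((hm1.comp measurable_fst).mul (hm1.comp measurable_snd))).aemeasurable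
  calc (∫⁻ x in F, (∑ Q ∈ B, lam Q * (μ Q * ν Q) * Q.indicator 1 x) ^ r ∂ρ) ^ (1 / r)
      ≤ (∫⁻ x in F, (lowerConst n α * I x) ^ r ∂ρ) ^ (1 / r) := by
        gcongr with x
        exact hpt x
    _ = lowerConst n α * (∫⁻ x in F, I x ^ r ∂ρ) ^ (1 / r) := by
        simp_rw [ENNReal.mul_rpow_of_nonneg _ _ hr.le]
        rw [lintegral_const_mul' _ _ (ENNReal.rpow_ne_top_of_nonneg hr.le (lowerConst_ne_top hα)),
          ENNReal.mul_rpow_of_nonneg _ _ (one_div_nonneg.2 hr.le), ← ENNReal.rpow_mul,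
          mul_one_div_cancel hr.ne', ENNReal.rpow_one]
    _ ≤ _ := by
        rw [mul_assoc]
        gcongr
        exact testConst_bound hr hs ht _ (by positivity)

theorem sum_rpow_le_of_le_one {ι : Type*} (A : Finset ι) (a : ι → ℝ≥0∞) {s : ℝ} (hs0 : 0 < s)
    (hs1 : s ≤ 1) : (∑ i ∈ A, a i) ^ s ≤ ∑ i ∈ A, a i ^ s := by
  induction A using Finset.induction_on with
  | empty => simp [hs0]
  | insert i A hi ih =>
    rw [Finset.sum_insert hi, Finset.sum_insert hi]
    exact (ENNReal.rpow_add_le_add_rpow _ _ hs0.le hs1).trans (add_le_add le_rfl ih)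

/-- The number of shifted grids. -/
def gridCount (n : ℕ) : ℝ≥0 := Fintype.card (Fin n → Bool)

theorem gridCount_pos : 0 < gridCount n := by
  simp [gridCount]

theorem strong_of_gridSum {α q : ℝ} (hα : α < 2 * (n : ℝ)) (hq : 1 ≤ q)
    {w : Measure (EuclideanSpace ℝ (Fin n))} {c : Set (EuclideanSpace ℝ (Fin n)) → ℝ≥0∞}
    {I : EuclideanSpace ℝ (Fin n) → ℝ≥0∞} {Y : ℝ≥0∞}
    (hI : ∀ x, I x ≤ upperConst n α * ∑ τ : Fin n → Bool, gridSum τ c x)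
    (h : ∀ τ : Fin n → Bool, ∫⁻ x, gridSum τ c x ^ q ∂w ≤ Y ^ q) :
    (∫⁻ x, I x ^ q ∂w) ^ (1 / q) ≤ upperConst n α * gridCount n * Y := by
  have hq0 : 0 < q := by linarith
  set N : ℝ≥0∞ := (gridCount n : ℝ≥0∞) with hN
  have hN0 : N ≠ 0 := by simpa [hN] using gridCount_pos.ne'
  have hNt : N ≠ ∞ := ENNReal.coe_ne_top
  rw [one_div, ENNReal.rpow_inv_le_iff hq0]
  calc ∫⁻ x, I x ^ q ∂w
      ≤ ∫⁻ x, upperConst n α ^ q * (N ^ (q - 1) * ∑ τ : Fin n → Bool, gridSum τ c x ^ q) ∂w := by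
        refine lintegral_mono fun x => ?_
        refine (ENNReal.rpow_le_rpow (hI x) hq0.le).trans ?_
        rw [ENNReal.mul_rpow_of_nonneg _ _ hq0.le]
        gcongr
        refine (ENNReal.rpow_sum_le_const_mul_sum_rpow _ _ hq).trans (le_of_eq ?_)
        simp [hN, gridCount]
    _ = upperConst n α ^ q * (N ^ (q - 1) * ∑ τ : Fin n → Bool, ∫⁻ x, gridSum τ c x ^ q ∂w) := by
        rw [lintegral_const_mul' _ _ (ENNReal.rpow_ne_top_of_nonneg hq0.le (upperConst_ne_top hα)),
          lintegral_const_mul' _ _ (ENNReal.rpow_ne_top_of_nonneg (by linarith) hNt),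
          lintegral_finsetSum' _ fun τ _ => ((measurable_gridSum τ c).pow_const q).aemeasurable]
    _ ≤ upperConst n α ^ q * (N ^ (q - 1) * ∑ _τ : Fin n → Bool, Y ^ q) := by
        gcongr with τ _
        exact h τ
    _ = (upperConst n α * N * Y) ^ q := by
        have e : (∑ _τ : Fin n → Bool, Y ^ q) = N * Y ^ q := by
          rw [Finset.sum_const, nsmul_eq_mul]; simp [hN, gridCount]
        have e2 : N ^ (q - 1) * N = N ^ q := by
          have : N ^ (q - 1) * N ^ (1 : ℝ) = N ^ q := by
            rw [← ENNReal.rpow_add _ _ hN0 hNt]; congr 1; ring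
          rw [← this, ENNReal.rpow_one]
        rw [e, ← mul_assoc (N ^ (q - 1)), e2, ENNReal.mul_rpow_of_nonneg _ _ hq0.le,
          ENNReal.mul_rpow_of_nonneg _ _ hq0.le]
        ring

/-- If `I x > t`, then one of the grid sums exceeds `t` divided by the constant and the number of
grids. The number of grids enters a second time through the sum of the level set measures. -/
theorem weak_of_gridSum {α q : ℝ} (hα : α < 2 * (n : ℝ)) (hq : 1 ≤ q)
    {w : Measure (EuclideanSpace ℝ (Fin n))} {c : Set (EuclideanSpace ℝ (Fin n)) → ℝ≥0∞}
    {I : EuclideanSpace ℝ (Fin n) → ℝ≥0∞} {Y : ℝ≥0∞}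
    (hI : ∀ x, I x ≤ upperConst n α * ∑ τ : Fin n → Bool, gridSum τ c x)
    (h : ∀ (τ : Fin n → Bool) (t : ℝ≥0), t * w {x | (t : ℝ≥0∞) < gridSum τ c x} ^ (1 / q) ≤ Y)
    (t : ℝ≥0) :
    t * w {x | (t : ℝ≥0∞) < I x} ^ (1 / q) ≤ upperConst n α * gridCount n * (gridCount n * Y) := by
  have hq0 : 0 < q := by linarith
  set N := gridCount n with hN
  obtain ⟨u, hu⟩ : ∃ u : ℝ≥0, (u : ℝ≥0∞) = upperConst n α :=
    ⟨_, ENNReal.coe_toNNReal (upperConst_ne_top hα)⟩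
  have hu0 : u ≠ 0 := by
    intro h0
    rw [h0, upperConst] at hu
    exact (ENNReal.rpow_pos (by norm_num) (by norm_num)).ne hu
  set v : ℝ≥0 := u * N with hv
  have hv0 : v ≠ 0 := mul_ne_zero hu0 gridCount_pos.ne'
  set s : ℝ≥0 := t / v with hs
  have hts : (t : ℝ≥0∞) = v * s := by
    rw [hs]; exact_mod_cast (mul_div_cancel₀ t hv0).symm
  have hsub : {x | (t : ℝ≥0∞) < I x} ⊆ ⋃ τ ∈ (Finset.univ : Finset (Fin n → Bool)),
      {x | (s : ℝ≥0∞) < gridSum τ c x} := by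
    intro x hx
    by_contra hcon
    simp only [Set.mem_iUnion, Set.mem_ofPred_eq, not_exists, not_lt] at hcon
    have h1 : I x ≤ v * s := by
      calc I x ≤ upperConst n α * ∑ τ : Fin n → Bool, gridSum τ c x := hI x
        _ ≤ upperConst n α * ∑ _τ : Fin n → Bool, (s : ℝ≥0∞) := by
          gcongr with τ hτ
          exact hcon τ hτ
        _ = v * s := by
          rw [Finset.sum_const, nsmul_eq_mul, ← hu, hv, ← mul_assoc]
          simp [hN, gridCount]
    rw [← hts] at h1
    exact absurd hx (not_lt.2 h1)
  calc t * w {x | (t : ℝ≥0∞) < I x} ^ (1 / q)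
      ≤ v * s * ∑ τ : Fin n → Bool, w {x | (s : ℝ≥0∞) < gridSum τ c x} ^ (1 / q) := by
        rw [hts]
        gcongr
        refine (ENNReal.rpow_le_rpow ?_ (one_div_nonneg.2 hq0.le)).trans
          (sum_rpow_le_of_le_one _ _ (one_div_pos.2 hq0) ((div_le_one hq0).2 hq))
        rw [← hts]
        exact (measure_mono hsub).trans (measure_biUnion_finset_le _ _)
    _ = v * ∑ τ : Fin n → Bool, s * w {x | (s : ℝ≥0∞) < gridSum τ c x} ^ (1 / q) := by
        rw [mul_assoc, Finset.mul_sum]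
    _ ≤ v * ∑ _τ : Fin n → Bool, Y := by
        gcongr with τ _
        exact h τ s
    _ = _ := by
        rw [Finset.sum_const, nsmul_eq_mul, ← hu, hv]
        simp [hN, gridCount]

end

/-! ### Necessity of the dual testing conditions: Kolmogorov's inequality and duality. -/

section

open scoped Classical

variable {n : ℕ}

theorem measurable_kernel (α : ℝ) : Measurable
    fun p : EuclideanSpace ℝ (Fin n) × EuclideanSpace ℝ (Fin n) × EuclideanSpace ℝ (Fin n) =>
      kernel α p.1 p.2.1 p.2.2 := by
  have h : Measurable
      fun p : EuclideanSpace ℝ (Fin n) × EuclideanSpace ℝ (Fin n) × EuclideanSpace ℝ (Fin n) =>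
        dist p.1 p.2.1 + dist p.1 p.2.2 := by fun_prop
  exact h.ennreal_ofReal.pow_const _

theorem kernel_swap (α : ℝ) (x y z : EuclideanSpace ℝ (Fin n)) : kernel α x y z = kernel α x z y := by
  rw [kernel, kernel, add_comm]

/-- By the triangle inequality, changing the distinguished point changes the sum of two distances by
at most a factor `2`. Thus the dual testing operators are comparable to the formal adjoints of
`I_α`. -/
theorem kernel_le_rotate {α : ℝ} (hα : α < 2 * (n : ℝ)) (x y z : EuclideanSpace ℝ (Fin n)) :
    kernel α y x z ≤ 2 ^ (2 * (n : ℝ) - α) * kernel α x y z := by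
  set s := 2 * (n : ℝ) - α with hs
  have hs0 : 0 < s := by linarith
  have h20 : (2 : ℝ≥0∞) ^ s ≠ 0 := (ENNReal.rpow_pos (by norm_num) (by norm_num)).ne'
  have h2t : (2 : ℝ≥0∞) ^ s ≠ ∞ := ENNReal.rpow_ne_top_of_nonneg hs0.le (by norm_num)
  have hd : ENNReal.ofReal (dist x y + dist x z) ≤ 2 * ENNReal.ofReal (dist y x + dist y z) := by
    have e : 2 * ENNReal.ofReal (dist y x + dist y z) =
        ENNReal.ofReal (2 * (dist y x + dist y z)) := by
      rw [ENNReal.ofReal_mul (by norm_num), ENNReal.ofReal_ofNat]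
    rw [e]
    refine ENNReal.ofReal_le_ofReal ?_
    have h1 := dist_triangle x y z
    have h2 := dist_comm x y
    have h3 : 0 ≤ dist y z := dist_nonneg
    linarith
  have h := ENNReal.inv_le_inv.2 (ENNReal.rpow_le_rpow hd hs0.le)
  rw [ENNReal.mul_rpow_of_nonneg _ _ hs0.le, ENNReal.mul_inv (Or.inl h20) (Or.inl h2t),
    ← ENNReal.rpow_neg (ENNReal.ofReal _), ← ENNReal.rpow_neg (ENNReal.ofReal _)] at h
  have h' := mul_le_mul_right h ((2 : ℝ≥0∞) ^ s)
  rwa [← mul_assoc, ENNReal.mul_inv_cancel h20 h2t, one_mul] at h'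

theorem measurable_kernel_mul (α : ℝ) {f₁ f₂ : EuclideanSpace ℝ (Fin n) → ℝ≥0∞}
    (hf₁ : Measurable f₁) (hf₂ : Measurable f₂) : Measurable
    fun p : EuclideanSpace ℝ (Fin n) × EuclideanSpace ℝ (Fin n) × EuclideanSpace ℝ (Fin n) =>
      kernel α p.1 p.2.1 p.2.2 * (f₁ p.2.1 * f₂ p.2.2) :=
  (measurable_kernel α).mul ((hf₁.comp (by fun_prop)).mul (hf₂.comp (by fun_prop)))

theorem measurable_fracIntNonneg (α : ℝ) (σ₁ σ₂ : Measure (EuclideanSpace ℝ (Fin n))) [SFinite σ₁]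
    [SFinite σ₂] {f₁ f₂ : EuclideanSpace ℝ (Fin n) → ℝ≥0∞} (hf₁ : Measurable f₁)
    (hf₂ : Measurable f₂) : Measurable (fracIntNonneg α σ₁ σ₂ f₁ f₂) :=
  (measurable_kernel_mul α hf₁ hf₂).lintegral_prod_right'

theorem measurable_lintegral_kernel_rotate (α : ℝ) (w σ₂ : Measure (EuclideanSpace ℝ (Fin n)))
    [SFinite w] [SFinite σ₂] {f₁ f₂ : EuclideanSpace ℝ (Fin n) → ℝ≥0∞} (hf₁ : Measurable f₁)
    (hf₂ : Measurable f₂) :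
    Measurable fun y => ∫⁻ p, kernel α p.1 y p.2 * (f₁ p.1 * f₂ p.2) ∂(w.prod σ₂) := by
  have hr : Measurable fun p : EuclideanSpace ℝ (Fin n) × EuclideanSpace ℝ (Fin n) ×
      EuclideanSpace ℝ (Fin n) => (p.2.1, p.1, p.2.2) := by fun_prop
  have hK := (measurable_kernel (n := n) α).comp hr
  have h₁ : Measurable fun p : EuclideanSpace ℝ (Fin n) × EuclideanSpace ℝ (Fin n) ×
      EuclideanSpace ℝ (Fin n) => f₁ p.2.1 := hf₁.comp (by fun_prop)
  have h₂ : Measurable fun p : EuclideanSpace ℝ (Fin n) × EuclideanSpace ℝ (Fin n) ×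
      EuclideanSpace ℝ (Fin n) => f₂ p.2.2 := hf₂.comp (by fun_prop)
  have h : Measurable fun p : EuclideanSpace ℝ (Fin n) × EuclideanSpace ℝ (Fin n) ×
      EuclideanSpace ℝ (Fin n) => kernel α p.2.1 p.1 p.2.2 * (f₁ p.2.1 * f₂ p.2.2) :=
    hK.mul (h₁.mul h₂)
  exact h.lintegral_prod_right'

theorem fracIntNonneg_swap (α : ℝ) (σ₁ σ₂ : Measure (EuclideanSpace ℝ (Fin n))) [SFinite σ₁]
    [SFinite σ₂] (f₁ f₂ : EuclideanSpace ℝ (Fin n) → ℝ≥0∞) (x : EuclideanSpace ℝ (Fin n)) :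
    fracIntNonneg α σ₁ σ₂ f₁ f₂ x = fracIntNonneg α σ₂ σ₁ f₂ f₁ x := by
  rw [fracIntNonneg, fracIntNonneg, ← lintegral_prod_swap]
  refine lintegral_congr fun y => ?_
  rw [kernel_swap, mul_comm (f₁ _)]
  rfl

theorem testConst_swap (α r s t : ℝ) (μ ν ρ : Measure (EuclideanSpace ℝ (Fin n))) [SFinite μ]
    [SFinite ν] : testConst α r s t μ ν ρ = testConst α r t s ν μ ρ := by
  simp only [testConst, fracIntNonneg_swap α μ ν]
  refine iSup_congr fun a => iSup_congr fun l => iSup_congr fun _ => ?_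
  rw [mul_comm (μ _ ^ _)]

theorem lintegral_triple_swap (w σ₁ σ₂ : Measure (EuclideanSpace ℝ (Fin n))) [SFinite w] [SFinite σ₁]
    [SFinite σ₂]
    {G : EuclideanSpace ℝ (Fin n) → EuclideanSpace ℝ (Fin n) → EuclideanSpace ℝ (Fin n) → ℝ≥0∞}
    (hG : Measurable fun p : EuclideanSpace ℝ (Fin n) × EuclideanSpace ℝ (Fin n) ×
      EuclideanSpace ℝ (Fin n) => G p.1 p.2.1 p.2.2) :
    ∫⁻ x, ∫⁻ p, G x p.1 p.2 ∂(σ₁.prod σ₂) ∂w = ∫⁻ y, ∫⁻ p, G p.1 y p.2 ∂(w.prod σ₂) ∂σ₁ := by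
  have h1 : ∀ x, ∫⁻ p, G x p.1 p.2 ∂(σ₁.prod σ₂) = ∫⁻ y, ∫⁻ z, G x y z ∂σ₂ ∂σ₁ := fun x =>
    lintegral_prod _ (hG.comp (by fun_prop :
      Measurable fun p : EuclideanSpace ℝ (Fin n) × EuclideanSpace ℝ (Fin n) => (x, p))).aemeasurable
  have h2 : ∀ y, ∫⁻ p, G p.1 y p.2 ∂(w.prod σ₂) = ∫⁻ x, ∫⁻ z, G x y z ∂σ₂ ∂w := fun y =>
    lintegral_prod _ (hG.comp (by fun_prop :
      Measurable fun p : EuclideanSpace ℝ (Fin n) × EuclideanSpace ℝ (Fin n) =>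
        (p.1, y, p.2))).aemeasurable
  simp_rw [h1, h2]
  refine lintegral_lintegral_swap ?_
  have h3 : Measurable fun q : (EuclideanSpace ℝ (Fin n) × EuclideanSpace ℝ (Fin n)) ×
      EuclideanSpace ℝ (Fin n) => G q.1.1 q.1.2 q.2 :=
    hG.comp (by fun_prop : Measurable fun q : (EuclideanSpace ℝ (Fin n) ×
      EuclideanSpace ℝ (Fin n)) × EuclideanSpace ℝ (Fin n) => (q.1.1, q.1.2, q.2))
  exact h3.lintegral_prod_right'.aemeasurable

/-- The constant in Kolmogorov's inequality. -/
def kolmogorovConst (q : ℝ) : ℝ≥0∞ := 1 + 2 * geomConst (q - 1)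

theorem kolmogorovConst_ne_top {q : ℝ} (hq : 1 < q) : kolmogorovConst q ≠ ∞ :=
  ENNReal.add_ne_top.2 ⟨by simp, ENNReal.mul_ne_top (by norm_num) (geomConst_ne_top (by linarith))⟩

/-- Above `δ`, the single layer with `2 ^ k * δ < a ≤ 2 ^ (k + 1) * δ` already dominates `a`. -/
theorem le_add_tsum_layers {a δ : ℝ≥0∞} (ha : a ≠ ∞) (hδ : δ ≠ 0) :
    a ≤ δ + ∑' k : ℕ, if 2 ^ k * δ < a then 2 * (2 ^ k * δ) else 0 := by
  by_cases hle : a ≤ δ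
  · exact hle.trans le_self_add
  have hex : ∃ k : ℕ, a ≤ 2 ^ (k + 1) * δ := by
    obtain ⟨N, hN⟩ := ENNReal.exists_nat_mul_gt hδ ha
    refine ⟨N, hN.le.trans ?_⟩
    gcongr
    exact_mod_cast (Nat.lt_two_pow_self (n := N)).le.trans (Nat.pow_le_pow_right (by norm_num) (by omega))
  set k := Nat.find hex with hk
  have hk1 : a ≤ 2 ^ (k + 1) * δ := Nat.find_spec hex
  have hk2 : 2 ^ k * δ < a := by
    by_cases h0 : k = 0
    · simpa [h0] using hle
    · obtain ⟨j, hj⟩ := Nat.exists_eq_succ_of_ne_zero h0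
      have := Nat.find_min hex (m := j) (by omega)
      rw [hj]
      exact not_le.1 this
  calc a ≤ 2 * (2 ^ k * δ) := by rw [← mul_assoc, ← pow_succ']; exact hk1
    _ = if 2 ^ k * δ < a then 2 * (2 ^ k * δ) else 0 := by rw [if_pos hk2]
    _ ≤ ∑' k : ℕ, if 2 ^ k * δ < a then 2 * (2 ^ k * δ) else 0 :=
        ENNReal.le_tsum (f := fun k : ℕ => if 2 ^ k * δ < a then 2 * (2 ^ k * δ) else 0) k
    _ ≤ _ := le_add_self

/-- Kolmogorov's inequality: local integrability of functions in weak `L^q`, `q > 1`. -/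
theorem setLIntegral_le_of_weak {X : Type*} [MeasurableSpace X] {w : Measure X} {q q' : ℝ}
    (hq : q.HolderConjugate q') {I : X → ℝ≥0∞} (hI : Measurable I) (hfin : ∀ᵐ x ∂w, I x < ∞)
    {B : ℝ≥0∞} (hB : ∀ t : ℝ≥0, t * w {x | (t : ℝ≥0∞) < I x} ^ (1 / q) ≤ B) {F : Set X}
    (hwF : w F ≠ ∞) :
    ∫⁻ x in F, I x ∂w ≤ kolmogorovConst q * B * w F ^ (1 / q') := by
  have hq0 := hq.pos
  have hq1 := hq.sub_one_pos
  rcases eq_or_ne (w F) 0 with h0 | h0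
  · rw [setLIntegral_measure_zero _ _ h0]; exact zero_le
  -- `B` may be `0` or `∞`; the bound is proved for finite positive `D ≥ B`, and `D` then decreases
  -- to `B`.
  have hpos : ∀ D : ℝ≥0∞, D ≠ 0 → D ≠ ∞ → B ≤ D →
      ∫⁻ x in F, I x ∂w ≤ kolmogorovConst q * D * w F ^ (1 / q') := by
    intro D hD0 hDt hBD
    set v := w F ^ (1 / q) with hv
    have hv0 : v ≠ 0 := by simp [hv, h0, hwF]
    have hvt : v ≠ ∞ := ENNReal.rpow_ne_top_of_nonneg (one_div_nonneg.2 hq0.le) hwF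
    -- With `δ = D / w(F) ^ (1/q)`, the weak bound at height `δ` is no better than `w F`; higher
    -- layers then decay like `2 ^ (-k (q - 1))`.
    obtain ⟨δ, hδ0, hδt, hDv⟩ : ∃ δ : ℝ≥0∞, δ ≠ 0 ∧ δ ≠ ∞ ∧ D = δ * v :=
      ⟨D * v⁻¹, mul_ne_zero hD0 (ENNReal.inv_ne_zero.2 hvt),
        ENNReal.mul_ne_top hDt (ENNReal.inv_ne_top.2 hv0),
        by rw [mul_assoc, ENNReal.inv_mul_cancel hv0 hvt, mul_one]⟩
    have hvq : v ^ q = w F := by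
      rw [hv, ← ENNReal.rpow_mul, one_div_mul_cancel hq0.ne', ENNReal.rpow_one]
    have hwv : v * w F ^ (1 / q') = w F := by
      rw [hv, ← ENNReal.rpow_add _ _ h0 hwF, one_div, one_div, hq.inv_add_inv_eq_one,
        ENNReal.rpow_one]
    have hlayer : ∀ k : ℕ, 2 ^ k * δ * w {x | 2 ^ k * δ < I x} ≤
        δ * w F * (2 ^ (-(q - 1))) ^ k := by
      intro k
      obtain ⟨t, ht⟩ : ∃ t : ℝ≥0, (t : ℝ≥0∞) = 2 ^ k * δ :=
        ⟨_, ENNReal.coe_toNNReal (ENNReal.mul_ne_top (by simp) hδt)⟩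
      have h1 := ENNReal.rpow_le_rpow ((hB t).trans hBD) hq0.le
      rw [ENNReal.mul_rpow_of_nonneg _ _ hq0.le, ← ENNReal.rpow_mul, one_div_mul_cancel hq0.ne',
        ENNReal.rpow_one, ht, hDv, ENNReal.mul_rpow_of_nonneg _ _ hq0.le,
        ENNReal.mul_rpow_of_nonneg _ _ hq0.le, hvq] at h1
      have hδq0 : δ ^ q ≠ 0 := by simp [hδ0, hδt]
      have hδqt : δ ^ q ≠ ∞ := ENNReal.rpow_ne_top_of_nonneg hq0.le hδt
      have h2 : ((2 : ℝ≥0∞) ^ k) ^ q * w {x | 2 ^ k * δ < I x} ≤ w F := by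
        rw [← ENNReal.mul_le_mul_iff_right hδq0 hδqt]
        refine le_trans (le_of_eq ?_) h1
        ring
      have e : (2 : ℝ≥0∞) ^ k = (2 ^ (-(q - 1))) ^ k * ((2 : ℝ≥0∞) ^ k) ^ q := by
        rw [← ENNReal.rpow_natCast, ← ENNReal.rpow_natCast, ← ENNReal.rpow_mul, ← ENNReal.rpow_mul,
          ← ENNReal.rpow_add _ _ (by norm_num) (by norm_num)]
        congr 1; ring
      calc 2 ^ k * δ * w {x | 2 ^ k * δ < I x}
          = δ * (2 ^ (-(q - 1))) ^ k * (((2 : ℝ≥0∞) ^ k) ^ q * w {x | 2 ^ k * δ < I x}) := by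
            nth_rewrite 1 [e]; ring
        _ ≤ δ * (2 ^ (-(q - 1))) ^ k * w F := by gcongr
        _ = _ := by ring
    have hms : ∀ k : ℕ, MeasurableSet {x | 2 ^ k * δ < I x} := fun k =>
      measurableSet_lt measurable_const hI
    calc ∫⁻ x in F, I x ∂w
        ≤ ∫⁻ x in F, (δ + ∑' k : ℕ, {x | 2 ^ k * δ < I x}.indicator (fun _ => 2 * (2 ^ k * δ)) x)
            ∂w := by
          refine lintegral_mono_ae ?_
          filter_upwards [ae_restrict_of_ae hfin] with x hx
          refine (le_add_tsum_layers hx.ne hδ0).trans (le_of_eq ?_)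
          simp only [Set.indicator, Set.mem_ofPred_eq]
      _ = δ * w F + ∑' k : ℕ, 2 * (2 ^ k * δ) * w.restrict F {x | 2 ^ k * δ < I x} := by
          rw [lintegral_add_left measurable_const, setLIntegral_const, lintegral_tsum fun k =>
            (measurable_const.indicator (hms k)).aemeasurable]
          congr 1
          exact tsum_congr fun k => lintegral_indicator_const (hms k) _
      _ ≤ δ * w F + ∑' k : ℕ, 2 * (δ * w F) * (2 ^ (-(q - 1))) ^ k := by
          refine add_le_add le_rfl (ENNReal.tsum_le_tsum fun k => ?_)
          calc _ ≤ 2 * (2 ^ k * δ * w {x | 2 ^ k * δ < I x}) := by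
                rw [mul_assoc 2]
                exact mul_le_mul_right (mul_le_mul_right (Measure.restrict_le_self _) _) _
            _ ≤ 2 * (δ * w F * (2 ^ (-(q - 1))) ^ k) := mul_le_mul_right (hlayer k) _
            _ = _ := by ring
      _ = kolmogorovConst q * (δ * w F) := by
          rw [ENNReal.tsum_mul_left, ENNReal.tsum_geometric, kolmogorovConst, geomConst]; ring
      _ = kolmogorovConst q * D * w F ^ (1 / q') := by
          rw [hDv]
          nth_rewrite 1 [← hwv]
          ring
  have hc0 : kolmogorovConst q * w F ^ (1 / q') ≠ 0 := by
    refine mul_ne_zero (by simp [kolmogorovConst]) ?_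
    simp [h0, hwF]
  have hct : kolmogorovConst q * w F ^ (1 / q') ≠ ∞ :=
    ENNReal.mul_ne_top (kolmogorovConst_ne_top hq.lt)
      (ENNReal.rpow_ne_top_of_nonneg (one_div_nonneg.2 hq.symm.nonneg) hwF)
  rw [mul_right_comm, mul_comm _ B, ← ENNReal.div_le_iff hc0 hct]
  refine le_of_forall_gt_imp_ge_of_dense fun D hD => ?_
  rcases eq_or_ne D ∞ with rfl | hDt
  · exact le_top
  rw [ENNReal.div_le_iff hc0 hct, mul_comm D, mul_right_comm]
  exact hpos D (pos_of_gt hD).ne' hDt hD.le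

/-- The weak type inequality for nonnegative functions. -/
def NonnegWeak (α p₁ p₂ q : ℝ) (σ₁ σ₂ w : Measure (EuclideanSpace ℝ (Fin n))) (N : ℝ≥0∞) : Prop :=
  ∀ φ₁ φ₂ : EuclideanSpace ℝ (Fin n) → ℝ≥0, Measurable φ₁ → Measurable φ₂ →
    ∫⁻ y, (φ₁ y : ℝ≥0∞) ^ p₁ ∂σ₁ ≠ ∞ → ∫⁻ y, (φ₂ y : ℝ≥0∞) ^ p₂ ∂σ₂ ≠ ∞ →
    (∀ᵐ x ∂w, fracIntNonneg α σ₁ σ₂ (fun y => φ₁ y) (fun y => φ₂ y) x < ∞) ∧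
    ∀ t : ℝ≥0, t * w {x | (t : ℝ≥0∞) < fracIntNonneg α σ₁ σ₂ (fun y => φ₁ y) (fun y => φ₂ y) x} ^
      (1 / q) ≤ N * ((∫⁻ y, (φ₁ y : ℝ≥0∞) ^ p₁ ∂σ₁) ^ (1 / p₁) *
        (∫⁻ y, (φ₂ y : ℝ≥0∞) ^ p₂ ∂σ₂) ^ (1 / p₂))

theorem NonnegWeak.swap {α p₁ p₂ q : ℝ} {σ₁ σ₂ w : Measure (EuclideanSpace ℝ (Fin n))} [SFinite σ₁]
    [SFinite σ₂] {N : ℝ≥0∞} (h : NonnegWeak α p₁ p₂ q σ₁ σ₂ w N) :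
    NonnegWeak α p₂ p₁ q σ₂ σ₁ w N := by
  intro φ₂ φ₁ hφ₂ hφ₁ hn₂ hn₁
  have := h φ₁ φ₂ hφ₁ hφ₂ hn₁ hn₂
  simp_rw [fracIntNonneg_swap α σ₁ σ₂] at this
  rwa [mul_comm (_ ^ (1 / p₂))]

/-- Duality against the extremizer `g ^ (r₁ - 1)`, where `g` truncates the adjoint applied to
indicators. Its `p₁`-norm is a power of the integral being estimated, and the truncation keeps that
integral finite, so it can be absorbed. -/
theorem lintegral_min_rpow_le {α p₁ p₂ q r₁ q' : ℝ} (hpr₁ : p₁.HolderConjugate r₁) (hp₂ : 0 < p₂)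
    (hq : q.HolderConjugate q') {σ₁ σ₂ w : Measure (EuclideanSpace ℝ (Fin n))}
    [IsLocallyFiniteMeasure σ₁] [IsLocallyFiniteMeasure σ₂] [IsLocallyFiniteMeasure w] {N : ℝ≥0∞}
    (h : NonnegWeak α p₁ p₂ q σ₁ σ₂ w N) (a : EuclideanSpace ℝ (Fin n)) (l : ℝ) (m : ℕ) :
    (∫⁻ y in cube a l, min (∫⁻ p, kernel α p.1 y p.2 * ((cube a l).indicator 1 p.1 *
      (cube a l).indicator 1 p.2) ∂(w.prod σ₂)) m ^ r₁ ∂σ₁) ^ (1 / r₁) ≤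
      kolmogorovConst q * N * (w (cube a l) ^ (1 / q') * σ₂ (cube a l) ^ (1 / p₂)) := by
  set F := cube a l with hF
  have hFm : MeasurableSet F := measurableSet_cube a l
  have hσ₁ : σ₁ F ≠ ∞ := cube_measure_ne_top σ₁ a l
  have hσ₂ : σ₂ F ≠ ∞ := cube_measure_ne_top σ₂ a l
  have hwF : w F ≠ ∞ := cube_measure_ne_top w a l
  have hr1 := hpr₁.symm.sub_one_pos
  have hr0 := hpr₁.symm.pos
  have hp0 := hpr₁.pos
  have h1m : Measurable (F.indicator (1 : EuclideanSpace ℝ (Fin n) → ℝ≥0∞)) :=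
    measurable_one.indicator hFm
  set H : EuclideanSpace ℝ (Fin n) → ℝ≥0∞ := fun y =>
    ∫⁻ p, kernel α p.1 y p.2 * (F.indicator 1 p.1 * F.indicator 1 p.2) ∂(w.prod σ₂) with hH
  have hHm : Measurable H := measurable_lintegral_kernel_rotate α w σ₂ h1m h1m
  set g : EuclideanSpace ℝ (Fin n) → ℝ≥0∞ := fun y => min (H y) m with hg
  have hgm : Measurable g := hHm.min measurable_const
  have hgt : ∀ y, g y ≠ ∞ := fun y => ne_top_of_le_ne_top (ENNReal.natCast_ne_top m) (min_le_right _ _)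
  set φ₁ : EuclideanSpace ℝ (Fin n) → ℝ≥0 := fun y =>
    (F.indicator (fun y => g y ^ (r₁ - 1)) y).toNNReal with hφ₁
  have hφ₁e : ∀ y, (φ₁ y : ℝ≥0∞) = F.indicator (fun y => g y ^ (r₁ - 1)) y := by
    intro y
    refine ENNReal.coe_toNNReal ?_
    by_cases hy : y ∈ F
    · rw [Set.indicator_of_mem hy]
      exact ENNReal.rpow_ne_top_of_nonneg hr1.le (hgt y)
    · simp [hy]
  set φ₂ : EuclideanSpace ℝ (Fin n) → ℝ≥0 := F.indicator 1 with hφ₂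
  have hφ₂e : ∀ y, (φ₂ y : ℝ≥0∞) = F.indicator 1 y := by
    intro y
    by_cases hy : y ∈ F <;> simp [hφ₂, hy]
  have hφ₁i : Measurable (F.indicator fun y => g y ^ (r₁ - 1)) := (hgm.pow_const _).indicator hFm
  have hφ₁m : Measurable φ₁ := hφ₁i.ennreal_toNNReal
  have hφ₂m : Measurable φ₂ := measurable_one.indicator hFm
  have hn₁ : ∫⁻ y, (φ₁ y : ℝ≥0∞) ^ p₁ ∂σ₁ = ∫⁻ y in F, g y ^ r₁ ∂σ₁ := by
    have : ∀ y, (φ₁ y : ℝ≥0∞) ^ p₁ = F.indicator (fun y => g y ^ r₁) y := by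
      intro y
      rw [hφ₁e]
      by_cases hy : y ∈ F
      · simp only [Set.indicator_of_mem hy]
        rw [← ENNReal.rpow_mul, hpr₁.symm.sub_one_mul_conj]
      · simp [hy, hp0]
    simp_rw [this]
    rw [lintegral_indicator hFm]
  have hn₂ : ∫⁻ y, (φ₂ y : ℝ≥0∞) ^ p₂ ∂σ₂ = σ₂ F := by
    have : ∀ y, (φ₂ y : ℝ≥0∞) ^ p₂ = F.indicator 1 y := by
      intro y
      rw [hφ₂e]
      by_cases hy : y ∈ F <;> simp [hy, hp₂]
    simp_rw [this]
    rw [lintegral_indicator_one hFm]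
  have hfin : ∫⁻ y in F, g y ^ r₁ ∂σ₁ ≠ ∞ := by
    have : ∫⁻ y in F, g y ^ r₁ ∂σ₁ ≤ ∫⁻ _ in F, (m : ℝ≥0∞) ^ r₁ ∂σ₁ :=
      lintegral_mono fun y => ENNReal.rpow_le_rpow (min_le_right _ _) hr0.le
    refine ne_top_of_le_ne_top ?_ this
    rw [setLIntegral_const]
    exact ENNReal.mul_ne_top (ENNReal.rpow_ne_top_of_nonneg hr0.le (ENNReal.natCast_ne_top m)) hσ₁
  obtain ⟨hae, hweak⟩ := h φ₁ φ₂ hφ₁m hφ₂m (by rwa [hn₁]) (by rwa [hn₂])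
  simp only [hφ₁e, hφ₂e] at hae hweak
  simp only [← hφ₁e, hn₁] at hweak
  have e2 : ∫⁻ y, F.indicator 1 y ^ p₂ ∂σ₂ = σ₂ F := by
    rw [← hn₂]; simp only [hφ₂e]
  simp only [e2, hφ₁e] at hweak
  set I := fracIntNonneg α σ₁ σ₂ (fun y => F.indicator (fun y => g y ^ (r₁ - 1)) y)
    (fun y => F.indicator 1 y) with hI
  have hIm : Measurable I := measurable_fracIntNonneg α σ₁ σ₂ hφ₁i h1m
  have hkol := setLIntegral_le_of_weak hq hIm hae hweak hwF
  have hfub : ∫⁻ x in F, I x ∂w = ∫⁻ y in F, g y ^ (r₁ - 1) * H y ∂σ₁ := by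
    have hswap := lintegral_triple_swap w σ₁ σ₂ (G := fun x y z => kernel α x y z *
      (F.indicator 1 x * (F.indicator (fun y => g y ^ (r₁ - 1)) y * F.indicator 1 z)))
      ((measurable_kernel α).mul ((h1m.comp (by fun_prop)).mul
        ((hφ₁i.comp (by fun_prop)).mul (h1m.comp (by fun_prop)))))
    rw [← lintegral_indicator hFm, ← lintegral_indicator hFm]
    refine (lintegral_congr fun x => ?_).trans (hswap.trans (lintegral_congr fun y => ?_))
    · by_cases hx : x ∈ F
      · simp only [Set.indicator_of_mem hx, Pi.one_apply, one_mul]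
        rfl
      · simp [hx]
    · by_cases hy : y ∈ F
      · simp only [Set.indicator_of_mem hy]
        rw [hH, ← lintegral_const_mul' _ _ (ENNReal.rpow_ne_top_of_nonneg hr1.le (hgt y))]
        refine lintegral_congr fun p => ?_
        ring
      · simp [hy]
  refine rpow_le_of_le_mul_rpow hpr₁.symm hfin ?_
  calc ∫⁻ y in F, g y ^ r₁ ∂σ₁ ≤ ∫⁻ y in F, g y ^ (r₁ - 1) * H y ∂σ₁ := by
        refine lintegral_mono fun y => ?_
        have : g y ^ r₁ = g y ^ (r₁ - 1) * g y := by
          have : g y ^ (r₁ - 1) * g y ^ (1 : ℝ) = g y ^ r₁ := by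
            rw [← ENNReal.rpow_add_of_nonneg _ _ hr1.le (by norm_num)]
            congr 1; ring
          rw [← this, ENNReal.rpow_one]
        simp only [this]
        gcongr
        exact min_le_left _ _
    _ = ∫⁻ x in F, I x ∂w := hfub.symm
    _ ≤ _ := hkol
    _ = _ := by ring

/-- The truncation is removed by monotone convergence, and `kernel_le_rotate` passes from the
adjoint to the operator in the testing constant. -/
theorem testConst_le_of_nonnegWeak {α p₁ p₂ q r₁ q' : ℝ} (hα : α < 2 * (n : ℝ))
    (hpr₁ : p₁.HolderConjugate r₁) (hp₂ : 0 < p₂)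
    (hq : q.HolderConjugate q') {σ₁ σ₂ w : Measure (EuclideanSpace ℝ (Fin n))}
    [IsLocallyFiniteMeasure σ₁] [IsLocallyFiniteMeasure σ₂] [IsLocallyFiniteMeasure w] {N : ℝ≥0∞}
    (h : NonnegWeak α p₁ p₂ q σ₁ σ₂ w N) :
    testConst α r₁ q' p₂ w σ₂ σ₁ ≤ 2 ^ (2 * (n : ℝ) - α) * kolmogorovConst q * N := by
  have hr0 := hpr₁.symm.pos
  refine iSup_le fun a => iSup_le fun l => iSup_le fun _ => ENNReal.div_le_of_le_mul ?_
  set F := cube a l with hF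
  set H : EuclideanSpace ℝ (Fin n) → ℝ≥0∞ := fun y =>
    ∫⁻ p, kernel α p.1 y p.2 * (F.indicator 1 p.1 * F.indicator 1 p.2) ∂(w.prod σ₂) with hH
  have hFm : MeasurableSet F := measurableSet_cube a l
  have h1m : Measurable (F.indicator (1 : EuclideanSpace ℝ (Fin n) → ℝ≥0∞)) :=
    measurable_one.indicator hFm
  have hHm : Measurable H := measurable_lintegral_kernel_rotate α w σ₂ h1m h1m
  set M : ℝ≥0∞ := 2 ^ (2 * (n : ℝ) - α) with hM
  have hMt : M ≠ ∞ := ENNReal.rpow_ne_top_of_nonneg (by linarith) (by norm_num)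
  have hpt : ∀ y, fracIntNonneg α w σ₂ (F.indicator 1) (F.indicator 1) y ≤ M * H y := by
    intro y
    rw [hH, ← lintegral_const_mul' _ _ hMt]
    refine lintegral_mono fun p => ?_
    rw [← mul_assoc M]
    exact mul_le_mul_left (kernel_le_rotate hα p.1 y p.2) _
  have hHr : ∫⁻ y in F, H y ^ r₁ ∂σ₁ ≤
      (kolmogorovConst q * N * (w F ^ (1 / q') * σ₂ F ^ (1 / p₂))) ^ r₁ := by
    have e : ∀ y, H y ^ r₁ = ⨆ m : ℕ, min (H y) m ^ r₁ := by
      intro y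
      have h1 : H y = ⨆ m : ℕ, min (H y) (m : ℝ≥0∞) := by
        rw [← inf_iSup_eq, ENNReal.iSup_natCast, inf_top_eq]
      nth_rewrite 1 [h1]
      exact (ENNReal.orderIsoRpow r₁ hr0).map_iSup _
    simp_rw [e]
    rw [lintegral_iSup]
    · refine iSup_le fun m => ?_
      have := lintegral_min_rpow_le hpr₁ hp₂ hq h a l m
      rwa [one_div r₁, ENNReal.rpow_inv_le_iff hr0] at this
    · exact fun m => (hHm.min measurable_const).pow_const _
    · intro m m' hmm y
      refine ENNReal.rpow_le_rpow (min_le_min le_rfl ?_) hr0.le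
      exact_mod_cast hmm
  calc (∫⁻ y in F, fracIntNonneg α w σ₂ (F.indicator 1) (F.indicator 1) y ^ r₁ ∂σ₁) ^ (1 / r₁)
      ≤ (∫⁻ y in F, (M * H y) ^ r₁ ∂σ₁) ^ (1 / r₁) := by
        gcongr with y
        exact hpt y
    _ = M * (∫⁻ y in F, H y ^ r₁ ∂σ₁) ^ (1 / r₁) := by
        simp_rw [ENNReal.mul_rpow_of_nonneg _ _ hr0.le]
        rw [lintegral_const_mul' _ _ (ENNReal.rpow_ne_top_of_nonneg hr0.le hMt),
          ENNReal.mul_rpow_of_nonneg _ _ (one_div_nonneg.2 hr0.le), ← ENNReal.rpow_mul,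
          mul_one_div_cancel hr0.ne', ENNReal.rpow_one]
    _ ≤ M * (kolmogorovConst q * N * (w F ^ (1 / q') * σ₂ F ^ (1 / p₂))) := by
        gcongr
        rw [one_div, ENNReal.rpow_inv_le_iff hr0]
        exact hHr
    _ = _ := by ring

end

/-! ### Passage to complex functions and the two halves of the characterization. -/

section

open scoped Classical

variable {n : ℕ}

/-- The constant in the sufficiency part of the strong type theorem. -/
def strongUpper (n : ℕ) (α p₁ p₂ q' : ℝ) : ℝ≥0∞ :=
  upperConst n α * gridCount n * trilinearConst p₁ p₂ q' * lowerConst n α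

theorem strongUpper_ne_top {α p₁ p₂ q' : ℝ} (hα : α < 2 * (n : ℝ)) (hp₁ : 1 < p₁) (hp₂ : 1 < p₂)
    (hq' : 1 < q') : strongUpper n α p₁ p₂ q' ≠ ∞ :=
  ENNReal.mul_ne_top (ENNReal.mul_ne_top (ENNReal.mul_ne_top (upperConst_ne_top hα)
    ENNReal.coe_ne_top) (trilinearConst_ne_top hp₁ hp₂ hq')) (lowerConst_ne_top hα)

/-- The constant in the sufficiency part of the weak type theorem. -/
def weakUpper (n : ℕ) (α p₁ p₂ q : ℝ) : ℝ≥0∞ :=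
  upperConst n α * gridCount n * gridCount n * 2 ^ q * (localConst p₁ p₂ + localConst p₂ p₁) *
    lowerConst n α

theorem weakUpper_ne_top {α p₁ p₂ q : ℝ} (hα : α < 2 * (n : ℝ)) (hp₁ : 1 < p₁) (hp₂ : 1 < p₂)
    (hq : 0 ≤ q) : weakUpper n α p₁ p₂ q ≠ ∞ := by
  have h1 := ENNReal.rpow_ne_top_of_nonneg hq (show (2 : ℝ≥0∞) ≠ ∞ by norm_num)
  exact ENNReal.mul_ne_top (ENNReal.mul_ne_top (ENNReal.mul_ne_top (ENNReal.mul_ne_top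
    (ENNReal.mul_ne_top (upperConst_ne_top hα) ENNReal.coe_ne_top) ENNReal.coe_ne_top) h1)
    (ENNReal.add_ne_top.2 ⟨localConst_ne_top hp₁ hp₂, localConst_ne_top hp₂ hp₁⟩))
    (lowerConst_ne_top hα)

theorem lintegral_fracIntNonneg_rpow_le (hn : 0 < n) {α p₁ p₂ q r₁ r₂ q' : ℝ}
    (hα : α < 2 * (n : ℝ)) (hpr₁ : p₁.HolderConjugate r₁) (hpr₂ : p₂.HolderConjugate r₂)
    (hq : q.HolderConjugate q') (h₁₂ : 1 ≤ 1 / p₁ + 1 / p₂) (h₁₃ : 1 ≤ 1 / p₁ + 1 / q')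
    (h₂₃ : 1 ≤ 1 / p₂ + 1 / q') (σ₁ σ₂ w : Measure (EuclideanSpace ℝ (Fin n)))
    [IsLocallyFiniteMeasure σ₁] [IsLocallyFiniteMeasure σ₂] [IsLocallyFiniteMeasure w]
    {f₁ f₂ : EuclideanSpace ℝ (Fin n) → ℝ≥0∞} (hf₁ : Measurable f₁) (hf₂ : Measurable f₂)
    (hn₁ : ∫⁻ x, f₁ x ^ p₁ ∂σ₁ ≠ ∞) (hn₂ : ∫⁻ x, f₂ x ^ p₂ ∂σ₂ ≠ ∞) :
    (∫⁻ x, fracIntNonneg α σ₁ σ₂ f₁ f₂ x ^ q ∂w) ^ (1 / q) ≤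
      strongUpper n α p₁ p₂ q' * (testConst α q p₁ p₂ σ₁ σ₂ w + testConst α r₁ q' p₂ w σ₂ σ₁ +
        testConst α r₂ p₁ q' σ₁ w σ₂) *
        ((∫⁻ x, f₁ x ^ p₁ ∂σ₁) ^ (1 / p₁) * (∫⁻ x, f₂ x ^ p₂ ∂σ₂) ^ (1 / p₂)) := by
  refine (strong_of_gridSum hα hq.lt.le (fracIntNonneg_le_gridSum hn hα hf₁ hf₂)
    fun τ => lintegral_gridSum_rpow_le hq.pos fun A hA =>
      dyadic_strong_le (isLaminar_grid τ) (fun Q _ => cubeWeight_ne_top (by linarith) Q)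
        (grid_measure_ne_top σ₁) (grid_measure_ne_top σ₂) (grid_measure_ne_top w) hpr₁ hpr₂ hq
        h₁₂ h₁₃ h₂₃
        -- `swap` is needed because `w` comes first in the testing constant `T₁*`, but last in the
        -- dyadic form.
        (testingBound_of_testConst hn hα hpr₁.symm.pos hq.symm.pos hpr₂.pos w σ₂ σ₁ τ).swap
        (testingBound_of_testConst hn hα hpr₂.symm.pos hpr₁.pos hq.symm.pos σ₁ w σ₂ τ)
        (testingBound_of_testConst hn hα hq.pos hpr₁.pos hpr₂.pos σ₁ σ₂ w τ)
        hf₁ hf₂ hn₁ hn₂ hA).trans (le_of_eq ?_)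
  rw [strongUpper]
  ring

theorem weak_fracIntNonneg_le (hn : 0 < n) {α p₁ p₂ q r₁ r₂ q' : ℝ}
    (hα : α < 2 * (n : ℝ)) (hpr₁ : p₁.HolderConjugate r₁) (hpr₂ : p₂.HolderConjugate r₂)
    (hq : q.HolderConjugate q') (h₁₂ : 1 ≤ 1 / p₁ + 1 / p₂) (h₁₃ : 1 ≤ 1 / p₁ + 1 / q')
    (h₂₃ : 1 ≤ 1 / p₂ + 1 / q') (σ₁ σ₂ w : Measure (EuclideanSpace ℝ (Fin n)))
    [IsLocallyFiniteMeasure σ₁] [IsLocallyFiniteMeasure σ₂] [IsLocallyFiniteMeasure w]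
    {f₁ f₂ : EuclideanSpace ℝ (Fin n) → ℝ≥0∞} (hf₁ : Measurable f₁) (hf₂ : Measurable f₂)
    (hn₁ : ∫⁻ x, f₁ x ^ p₁ ∂σ₁ ≠ ∞) (hn₂ : ∫⁻ x, f₂ x ^ p₂ ∂σ₂ ≠ ∞) (t : ℝ≥0) :
    t * w {x | (t : ℝ≥0∞) < fracIntNonneg α σ₁ σ₂ f₁ f₂ x} ^ (1 / q) ≤
      weakUpper n α p₁ p₂ q * (testConst α r₁ q' p₂ w σ₂ σ₁ + testConst α r₂ p₁ q' σ₁ w σ₂) *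
        ((∫⁻ x, f₁ x ^ p₁ ∂σ₁) ^ (1 / p₁) * (∫⁻ x, f₂ x ^ p₂ ∂σ₂) ^ (1 / p₂)) := by
  refine (weak_of_gridSum hα hq.lt.le (fracIntNonneg_le_gridSum hn hα hf₁ hf₂)
    (fun τ t => gridSum_weak_le hq.pos t fun A hA =>
      dyadic_weak_le (isLaminar_grid τ) (fun Q _ => cubeWeight_ne_top (by linarith) Q)
        (grid_measure_ne_top σ₁) (grid_measure_ne_top σ₂) (grid_measure_ne_top w) hpr₁ hpr₂ hq
        h₁₂ h₁₃ h₂₃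
        (testingBound_of_testConst hn hα hpr₁.symm.pos hq.symm.pos hpr₂.pos w σ₂ σ₁ τ).swap
        (testingBound_of_testConst hn hα hpr₂.symm.pos hpr₁.pos hq.symm.pos σ₁ w σ₂ τ)
        hf₁ hf₂ hn₁ hn₂ hA t) t).trans (le_of_eq ?_)
  rw [weakUpper]
  ring

theorem fracIntNonneg_congr (α : ℝ) {σ₁ σ₂ : Measure (EuclideanSpace ℝ (Fin n))} [SFinite σ₁]
    [SFinite σ₂] {f₁ f₂ g₁ g₂ : EuclideanSpace ℝ (Fin n) → ℝ≥0∞} (h₁ : f₁ =ᵐ[σ₁] g₁)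
    (h₂ : f₂ =ᵐ[σ₂] g₂) : fracIntNonneg α σ₁ σ₂ f₁ f₂ = fracIntNonneg α σ₁ σ₂ g₁ g₂ := by
  funext x
  refine lintegral_congr_ae ?_
  filter_upwards [Measure.quasiMeasurePreserving_fst (ν := σ₂) |>.ae_eq_comp h₁,
    Measure.quasiMeasurePreserving_snd (μ := σ₁) |>.ae_eq_comp h₂] with y hy₁ hy₂
  simp only [Function.comp_apply] at hy₁ hy₂
  rw [hy₁, hy₂]

theorem enorm_fracInt_le (α : ℝ) (σ₁ σ₂ : Measure (EuclideanSpace ℝ (Fin n)))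
    (f₁ f₂ : EuclideanSpace ℝ (Fin n) → ℂ) (x : EuclideanSpace ℝ (Fin n)) :
    ‖fracInt α σ₁ σ₂ f₁ f₂ x‖ₑ ≤
      fracIntNonneg α σ₁ σ₂ (fun y => ‖f₁ y‖ₑ) (fun y => ‖f₂ y‖ₑ) x := by
  refine (enorm_integral_le_lintegral_enorm _).trans (lintegral_mono fun y => ?_)
  simp only [enorm_mul]
  refine mul_le_mul_left ?_ _
  rw [← ofReal_norm, Complex.norm_real, Real.norm_of_nonneg ENNReal.toReal_nonneg]
  -- Only an inequality: the real-valued kernel is `0` where the extended one is `∞`.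
  exact ENNReal.ofReal_toReal_le

/-- Finiteness of the integral makes the integrand finite almost everywhere, so passing to real
values loses nothing. -/
theorem enorm_fracInt_eq (α : ℝ) (σ₁ σ₂ : Measure (EuclideanSpace ℝ (Fin n)))
    {φ₁ φ₂ : EuclideanSpace ℝ (Fin n) → ℝ≥0} (hφ₁ : Measurable φ₁) (hφ₂ : Measurable φ₂)
    {x : EuclideanSpace ℝ (Fin n)}
    (hx : fracIntNonneg α σ₁ σ₂ (fun y => φ₁ y) (fun y => φ₂ y) x < ∞) :
    ‖fracInt α σ₁ σ₂ (fun y => ((φ₁ y : ℝ) : ℂ)) (fun y => ((φ₂ y : ℝ) : ℂ)) x‖ₑ =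
      fracIntNonneg α σ₁ σ₂ (fun y => φ₁ y) (fun y => φ₂ y) x := by
  have hm : Measurable fun y : EuclideanSpace ℝ (Fin n) × EuclideanSpace ℝ (Fin n) =>
      kernel α x y.1 y.2 * ((φ₁ y.1 : ℝ≥0∞) * φ₂ y.2) := by
    have h := (measurable_kernel_mul α hφ₁.coe_nnreal_ennreal hφ₂.coe_nnreal_ennreal).comp
      (measurable_prodMk_left (x := x))
    exact h
  have h1 : fracInt α σ₁ σ₂ (fun y => ((φ₁ y : ℝ) : ℂ)) (fun y => ((φ₂ y : ℝ) : ℂ)) x =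
      (((fracIntNonneg α σ₁ σ₂ (fun y => φ₁ y) (fun y => φ₂ y) x).toReal : ℝ) : ℂ) := by
    rw [fracIntNonneg, ← integral_toReal hm.aemeasurable (ae_lt_top hm hx.ne), fracInt]
    refine Eq.trans ?_ integral_ofReal
    refine integral_congr_ae (Filter.Eventually.of_forall fun y => ?_)
    simp [ENNReal.toReal_mul]
  rw [h1, ← ofReal_norm, Complex.norm_real, Real.norm_of_nonneg ENNReal.toReal_nonneg,
    ENNReal.ofReal_toReal hx.ne]

theorem eLpNorm_ofReal_eq {X E : Type*} [MeasurableSpace X] [ENorm E] (σ : Measure X) {p : ℝ}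
    (hp : 0 < p) (f : X → E) :
    eLpNorm f (ENNReal.ofReal p) σ = (∫⁻ x, ‖f x‖ₑ ^ p ∂σ) ^ (1 / p) := by
  rw [eLpNorm_eq_lintegral_rpow_enorm_toReal (by simpa using hp) ENNReal.ofReal_ne_top,
    ENNReal.toReal_ofReal hp.le]

/-- The estimates above are for measurable functions; `fracIntNonneg_congr` shows that a measurable
representative gives the same operator at every point. -/
theorem exists_measurable_of_memLp {X : Type*} [MeasurableSpace X] {σ : Measure X} {p : ℝ}
    (hp : 0 < p) {f : X → ℂ} (hf : MemLp f (ENNReal.ofReal p) σ) :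
    ∃ g : X → ℝ≥0∞, Measurable g ∧ (fun y => ‖f y‖ₑ) =ᵐ[σ] g ∧ ∫⁻ y, g y ^ p ∂σ ≠ ∞ ∧
      (∫⁻ y, g y ^ p ∂σ) ^ (1 / p) = eLpNorm f (ENNReal.ofReal p) σ := by
  have hm := hf.1.enorm
  have he : ∫⁻ y, hm.mk _ y ^ p ∂σ = ∫⁻ y, ‖f y‖ₑ ^ p ∂σ :=
    lintegral_congr_ae (hm.ae_eq_mk.mono fun y hy => by simp only [← hy])
  refine ⟨hm.mk _, hm.measurable_mk, hm.ae_eq_mk, ?_, ?_⟩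
  · intro htop
    have := hf.2.ne
    rw [eLpNorm_ofReal_eq σ hp, ← he, htop] at this
    exact this (ENNReal.top_rpow_of_pos (by positivity))
  · rw [eLpNorm_ofReal_eq σ hp, he]

/-- The set where `I = ∞` lies in every level set, so a positive measure there would make the weak
norm infinite. Absolute convergence thus follows from the weak bound itself. -/
theorem ae_lt_top_of_weak {X : Type*} [MeasurableSpace X] {w : Measure X} {q : ℝ} (hq : 0 < q)
    {I : X → ℝ≥0∞} {B : ℝ≥0∞} (hB : B ≠ ∞)
    (h : ∀ t : ℝ≥0, t * w {x | (t : ℝ≥0∞) < I x} ^ (1 / q) ≤ B) : ∀ᵐ x ∂w, I x < ∞ := by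
  rw [ae_iff]
  by_contra h0
  have h1 : w {x | ¬ I x < ∞} ^ (1 / q) ≠ 0 := by
    rw [Ne, ENNReal.rpow_eq_zero_iff_of_pos (by positivity)]
    exact h0
  obtain ⟨N, hN⟩ := ENNReal.exists_nat_mul_gt h1 hB
  refine absurd (h N) (not_le.2 (hN.trans_le ?_))
  have hs : {x | ¬ I x < ∞} ⊆ {x | ((N : ℝ≥0) : ℝ≥0∞) < I x} := by
    intro x hx
    simp only [Set.mem_ofPred_eq, not_lt, top_le_iff] at hx ⊢
    rw [hx]
    exact ENNReal.coe_lt_top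
  push_cast at hs ⊢
  exact mul_le_mul_right (ENNReal.rpow_le_rpow (measure_mono hs) (by positivity)) _

theorem strongType_of_testConst (hn : 0 < n) {α p₁ p₂ q r₁ r₂ q' : ℝ}
    (hα : α < 2 * (n : ℝ)) (hpr₁ : p₁.HolderConjugate r₁) (hpr₂ : p₂.HolderConjugate r₂)
    (hq : q.HolderConjugate q') (h₁₂ : 1 ≤ 1 / p₁ + 1 / p₂) (h₁₃ : 1 ≤ 1 / p₁ + 1 / q')
    (h₂₃ : 1 ≤ 1 / p₂ + 1 / q') (σ₁ σ₂ w : Measure (EuclideanSpace ℝ (Fin n)))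
    [IsLocallyFiniteMeasure σ₁] [IsLocallyFiniteMeasure σ₂] [IsLocallyFiniteMeasure w] {N : ℝ≥0}
    (hN : strongUpper n α p₁ p₂ q' * (testConst α q p₁ p₂ σ₁ σ₂ w +
      testConst α r₁ q' p₂ w σ₂ σ₁ + testConst α r₂ p₁ q' σ₁ w σ₂) ≤ N) :
    StrongType α p₁ p₂ q σ₁ σ₂ w N := by
  intro f₁ f₂ hf₁ hf₂
  obtain ⟨g₁, hg₁, he₁, hn₁, hN₁⟩ := exists_measurable_of_memLp hpr₁.pos hf₁
  obtain ⟨g₂, hg₂, he₂, hn₂, hN₂⟩ := exists_measurable_of_memLp hpr₂.pos hf₂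
  have hI := fracIntNonneg_congr α he₁ he₂
  have hb := (lintegral_fracIntNonneg_rpow_le hn hα hpr₁ hpr₂ hq h₁₂ h₁₃ h₂₃ σ₁ σ₂ w hg₁ hg₂ hn₁
    hn₂).trans (mul_le_mul_left hN _)
  rw [hN₁, hN₂, ← hI] at hb
  constructor
  · have hfin : ∫⁻ x, fracIntNonneg α σ₁ σ₂ (fun y => ‖f₁ y‖ₑ) (fun y => ‖f₂ y‖ₑ) x ^ q ∂w ≠ ∞ := by
      intro htop
      rw [htop, ENNReal.top_rpow_of_pos (one_div_pos.2 hq.pos), top_le_iff] at hb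
      exact ENNReal.mul_ne_top ENNReal.coe_ne_top (ENNReal.mul_ne_top hf₁.2.ne hf₂.2.ne) hb
    have hm : Measurable fun x =>
        fracIntNonneg α σ₁ σ₂ (fun y => ‖f₁ y‖ₑ) (fun y => ‖f₂ y‖ₑ) x ^ q := by
      rw [hI]
      exact (measurable_fracIntNonneg α σ₁ σ₂ hg₁ hg₂).pow_const q
    filter_upwards [ae_lt_top hm hfin] with x hx
    rw [ENNReal.rpow_lt_top_iff_of_pos hq.pos] at hx
    exact hx
  · rw [eLpNorm_ofReal_eq w hq.pos]
    refine le_trans (ENNReal.rpow_le_rpow (lintegral_mono fun x => ?_)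
      (one_div_nonneg.2 hq.nonneg)) hb
    exact ENNReal.rpow_le_rpow (enorm_fracInt_le α σ₁ σ₂ f₁ f₂ x) hq.nonneg

theorem weakType_of_testConst (hn : 0 < n) {α p₁ p₂ q r₁ r₂ q' : ℝ}
    (hα : α < 2 * (n : ℝ)) (hpr₁ : p₁.HolderConjugate r₁) (hpr₂ : p₂.HolderConjugate r₂)
    (hq : q.HolderConjugate q') (h₁₂ : 1 ≤ 1 / p₁ + 1 / p₂) (h₁₃ : 1 ≤ 1 / p₁ + 1 / q')
    (h₂₃ : 1 ≤ 1 / p₂ + 1 / q') (σ₁ σ₂ w : Measure (EuclideanSpace ℝ (Fin n)))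
    [IsLocallyFiniteMeasure σ₁] [IsLocallyFiniteMeasure σ₂] [IsLocallyFiniteMeasure w] {N : ℝ≥0}
    (hN : weakUpper n α p₁ p₂ q * (testConst α r₁ q' p₂ w σ₂ σ₁ +
      testConst α r₂ p₁ q' σ₁ w σ₂) ≤ N) : WeakType α p₁ p₂ q σ₁ σ₂ w N := by
  intro f₁ f₂ hf₁ hf₂
  obtain ⟨g₁, hg₁, he₁, hn₁, hN₁⟩ := exists_measurable_of_memLp hpr₁.pos hf₁
  obtain ⟨g₂, hg₂, he₂, hn₂, hN₂⟩ := exists_measurable_of_memLp hpr₂.pos hf₂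
  have hI := fracIntNonneg_congr α he₁ he₂
  have hb := fun t => (weak_fracIntNonneg_le hn hα hpr₁ hpr₂ hq h₁₂ h₁₃ h₂₃ σ₁ σ₂ w hg₁ hg₂ hn₁
    hn₂ t).trans (mul_le_mul_left hN _)
  rw [hN₁, hN₂, ← hI] at hb
  constructor
  · exact ae_lt_top_of_weak hq.pos
      (ENNReal.mul_ne_top ENNReal.coe_ne_top (ENNReal.mul_ne_top hf₁.2.ne hf₂.2.ne)) hb
  · refine iSup_le fun t => le_trans (mul_le_mul_right (ENNReal.rpow_le_rpow (measure_mono ?_)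
      (one_div_nonneg.2 hq.nonneg)) _) (hb t)
    exact fun x hx => lt_of_lt_of_le hx (enorm_fracInt_le α σ₁ σ₂ f₁ f₂ x)

theorem enorm_coe_nnreal (a : ℝ≥0) : ‖((a : ℝ) : ℂ)‖ₑ = a := by
  rw [← ofReal_norm]
  simp

theorem memLp_coe_nnreal {X : Type*} [MeasurableSpace X] {σ : Measure X} {p : ℝ} (hp : 0 < p)
    {φ : X → ℝ≥0} (hφ : Measurable φ) (hn : ∫⁻ y, (φ y : ℝ≥0∞) ^ p ∂σ ≠ ∞) :
    MemLp (fun y => ((φ y : ℝ) : ℂ)) (ENNReal.ofReal p) σ ∧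
      eLpNorm (fun y => ((φ y : ℝ) : ℂ)) (ENNReal.ofReal p) σ =
        (∫⁻ y, (φ y : ℝ≥0∞) ^ p ∂σ) ^ (1 / p) := by
  have he : eLpNorm (fun y => ((φ y : ℝ) : ℂ)) (ENNReal.ofReal p) σ =
        (∫⁻ y, (φ y : ℝ≥0∞) ^ p ∂σ) ^ (1 / p) := by
    rw [eLpNorm_ofReal_eq σ hp]
    simp only [enorm_coe_nnreal]
  refine ⟨⟨(Complex.measurable_ofReal.comp hφ.coe_nnreal_real).aestronglyMeasurable, ?_⟩, he⟩
  rw [he]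
  exact ENNReal.rpow_lt_top_of_nonneg (by positivity) hn

theorem WeakType.nonnegWeak {α p₁ p₂ q : ℝ} (hp₁ : 0 < p₁) (hp₂ : 0 < p₂)
    {σ₁ σ₂ w : Measure (EuclideanSpace ℝ (Fin n))} {N : ℝ≥0}
    (h : WeakType α p₁ p₂ q σ₁ σ₂ w N) : NonnegWeak α p₁ p₂ q σ₁ σ₂ w N := by
  intro φ₁ φ₂ hφ₁ hφ₂ hn₁ hn₂
  obtain ⟨hm₁, he₁⟩ := memLp_coe_nnreal hp₁ hφ₁ hn₁
  obtain ⟨hm₂, he₂⟩ := memLp_coe_nnreal hp₂ hφ₂ hn₂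
  obtain ⟨hae, hb⟩ := h _ _ hm₁ hm₂
  simp only [ConvergesAt, enorm_coe_nnreal] at hae
  rw [he₁, he₂] at hb
  refine ⟨hae, fun t => le_trans (le_of_eq ?_) ((le_iSup _ t).trans hb)⟩
  congr 2
  refine measure_congr ?_
  filter_upwards [hae] with x hx
  refine propext ?_
  change (t : ℝ≥0∞) < _ ↔ (t : ℝ≥0∞) < _
  rw [enorm_fracInt_eq α σ₁ σ₂ hφ₁ hφ₂ hx]

theorem StrongType.lintegral_le {α p₁ p₂ q : ℝ} (hp₁ : 0 < p₁) (hp₂ : 0 < p₂) (hq : 0 < q)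
    {σ₁ σ₂ w : Measure (EuclideanSpace ℝ (Fin n))} {N : ℝ≥0}
    (h : StrongType α p₁ p₂ q σ₁ σ₂ w N) {φ₁ φ₂ : EuclideanSpace ℝ (Fin n) → ℝ≥0}
    (hφ₁ : Measurable φ₁) (hφ₂ : Measurable φ₂) (hn₁ : ∫⁻ y, (φ₁ y : ℝ≥0∞) ^ p₁ ∂σ₁ ≠ ∞)
    (hn₂ : ∫⁻ y, (φ₂ y : ℝ≥0∞) ^ p₂ ∂σ₂ ≠ ∞) :
    (∀ᵐ x ∂w, fracIntNonneg α σ₁ σ₂ (fun y => φ₁ y) (fun y => φ₂ y) x < ∞) ∧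
      (∫⁻ x, fracIntNonneg α σ₁ σ₂ (fun y => φ₁ y) (fun y => φ₂ y) x ^ q ∂w) ^ (1 / q) ≤
        N * ((∫⁻ y, (φ₁ y : ℝ≥0∞) ^ p₁ ∂σ₁) ^ (1 / p₁) *
          (∫⁻ y, (φ₂ y : ℝ≥0∞) ^ p₂ ∂σ₂) ^ (1 / p₂)) := by
  obtain ⟨hm₁, he₁⟩ := memLp_coe_nnreal hp₁ hφ₁ hn₁
  obtain ⟨hm₂, he₂⟩ := memLp_coe_nnreal hp₂ hφ₂ hn₂
  obtain ⟨hae, hb⟩ := h _ _ hm₁ hm₂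
  simp only [ConvergesAt, enorm_coe_nnreal] at hae
  rw [he₁, he₂, eLpNorm_ofReal_eq w hq] at hb
  refine ⟨hae, le_trans (le_of_eq ?_) hb⟩
  congr 1
  refine lintegral_congr_ae ?_
  filter_upwards [hae] with x hx
  rw [enorm_fracInt_eq α σ₁ σ₂ hφ₁ hφ₂ hx]

theorem StrongType.nonnegWeak {α p₁ p₂ q : ℝ} (hp₁ : 0 < p₁) (hp₂ : 0 < p₂) (hq : 0 < q)
    {σ₁ σ₂ w : Measure (EuclideanSpace ℝ (Fin n))} [SFinite σ₁] [SFinite σ₂] {N : ℝ≥0}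
    (h : StrongType α p₁ p₂ q σ₁ σ₂ w N) : NonnegWeak α p₁ p₂ q σ₁ σ₂ w N := by
  intro φ₁ φ₂ hφ₁ hφ₂ hn₁ hn₂
  obtain ⟨hae, hb⟩ := h.lintegral_le hp₁ hp₂ hq hφ₁ hφ₂ hn₁ hn₂
  refine ⟨hae, fun t => le_trans ?_ hb⟩
  have hm := (measurable_fracIntNonneg α σ₁ σ₂ hφ₁.coe_nnreal_ennreal
    hφ₂.coe_nnreal_ennreal).pow_const q
  have hcheb := mul_meas_ge_le_lintegral (μ := w) hm ((t : ℝ≥0∞) ^ q)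
  have h1 := ENNReal.rpow_le_rpow hcheb (one_div_nonneg.2 hq.le)
  rw [ENNReal.mul_rpow_of_nonneg _ _ (one_div_nonneg.2 hq.le), ← ENNReal.rpow_mul,
    mul_one_div_cancel hq.ne', ENNReal.rpow_one] at h1
  refine le_trans (mul_le_mul_right (ENNReal.rpow_le_rpow (measure_mono ?_)
    (one_div_nonneg.2 hq.le)) _) h1
  exact fun x hx => ENNReal.rpow_le_rpow (le_of_lt hx) hq.le

theorem StrongType.testConst_le {α p₁ p₂ q : ℝ} (hp₁ : 0 < p₁) (hp₂ : 0 < p₂) (hq : 0 < q)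
    {σ₁ σ₂ w : Measure (EuclideanSpace ℝ (Fin n))} [IsLocallyFiniteMeasure σ₁]
    [IsLocallyFiniteMeasure σ₂] {N : ℝ≥0}
    (h : StrongType α p₁ p₂ q σ₁ σ₂ w N) : testConst α q p₁ p₂ σ₁ σ₂ w ≤ N := by
  refine iSup_le fun a => iSup_le fun l => iSup_le fun _ => ENNReal.div_le_of_le_mul ?_
  set F := cube a l with hF
  have hFm : MeasurableSet F := measurableSet_cube a l
  set φ : EuclideanSpace ℝ (Fin n) → ℝ≥0 := F.indicator 1 with hφ
  have hφm : Measurable φ := measurable_one.indicator hFm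
  have hφe : ∀ y, (φ y : ℝ≥0∞) = F.indicator 1 y := by
    intro y
    by_cases hy : y ∈ F <;> simp [hφ, hy]
  have hnorm : ∀ (σ : Measure (EuclideanSpace ℝ (Fin n))) {p : ℝ}, 0 < p →
      ∫⁻ y, (φ y : ℝ≥0∞) ^ p ∂σ = σ F := by
    intro σ p hp
    have : ∀ y, (φ y : ℝ≥0∞) ^ p = F.indicator 1 y := by
      intro y
      rw [hφe]
      by_cases hy : y ∈ F <;> simp [hy, hp]
    simp_rw [this]
    rw [lintegral_indicator_one hFm]
  have hb := (h.lintegral_le hp₁ hp₂ hq hφm hφm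
    (by rw [hnorm σ₁ hp₁]; exact cube_measure_ne_top σ₁ a l)
    (by rw [hnorm σ₂ hp₂]; exact cube_measure_ne_top σ₂ a l)).2
  rw [hnorm σ₁ hp₁, hnorm σ₂ hp₂] at hb
  simp only [hφe] at hb
  exact (ENNReal.rpow_le_rpow (setLIntegral_le_lintegral _ _) (one_div_nonneg.2 hq.le)).trans hb

/-- The constant in the necessity of the dual testing conditions. -/
def dualConst (n : ℕ) (α q : ℝ) : ℝ≥0∞ := 2 ^ (2 * (n : ℝ) - α) * kolmogorovConst q

theorem dualConst_ne_top {α q : ℝ} (hα : α < 2 * (n : ℝ)) (hq : 1 < q) : dualConst n α q ≠ ∞ :=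
  ENNReal.mul_ne_top (ENNReal.rpow_ne_top_of_nonneg (by linarith) (by norm_num))
    (kolmogorovConst_ne_top hq)

theorem NonnegWeak.testConst_add_le {α p₁ p₂ q r₁ r₂ q' : ℝ} (hα : α < 2 * (n : ℝ))
    (hpr₁ : p₁.HolderConjugate r₁) (hpr₂ : p₂.HolderConjugate r₂) (hq : q.HolderConjugate q')
    {σ₁ σ₂ w : Measure (EuclideanSpace ℝ (Fin n))} [IsLocallyFiniteMeasure σ₁]
    [IsLocallyFiniteMeasure σ₂] [IsLocallyFiniteMeasure w] {N : ℝ≥0∞}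
    (h : NonnegWeak α p₁ p₂ q σ₁ σ₂ w N) :
    testConst α r₁ q' p₂ w σ₂ σ₁ + testConst α r₂ p₁ q' σ₁ w σ₂ ≤ 2 * dualConst n α q * N := by
  have h1 := testConst_le_of_nonnegWeak hα hpr₁ hpr₂.pos hq h
  have h2 := testConst_le_of_nonnegWeak hα hpr₂ hpr₁.pos hq h.swap
  rw [testConst_swap] at h2
  rw [mul_assoc, two_mul]
  exact add_le_add h1 h2

end

end BilinearFractional

end

/-! ### The theorem. -/

theorem theorem1p1 (n : ℕ) (α p₁ p₂ q : ℝ) (hα : 0 < α) (hαn : α < 2 * (n : ℝ))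
    (hp₁ : 1 < p₁) (hp₂ : 1 < p₂) (hq₁ : p₁ ≤ q) (hq₂ : p₂ ≤ q) (hp : p₁ * p₂ ≤ p₁ + p₂) :
    ∃ C : NNReal, 0 < C ∧
      ∀ (σ₁ σ₂ w : MeasureTheory.Measure (EuclideanSpace ℝ (Fin n)))
        [MeasureTheory.IsLocallyFiniteMeasure σ₁] [MeasureTheory.IsLocallyFiniteMeasure σ₂]
        [MeasureTheory.IsLocallyFiniteMeasure w],
        -- strong type
        ((∃ N : NNReal, BilinearFractional.StrongType α p₁ p₂ q σ₁ σ₂ w N) ↔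
          BilinearFractional.testT α p₁ p₂ q σ₁ σ₂ w < ∞ ∧
          BilinearFractional.testT₁ α p₁ p₂ q σ₁ σ₂ w < ∞ ∧
          BilinearFractional.testT₂ α p₁ p₂ q σ₁ σ₂ w < ∞) ∧
        (BilinearFractional.strongConst α p₁ p₂ q σ₁ σ₂ w ≤
          C * (BilinearFractional.testT α p₁ p₂ q σ₁ σ₂ w +
            BilinearFractional.testT₁ α p₁ p₂ q σ₁ σ₂ w +
            BilinearFractional.testT₂ α p₁ p₂ q σ₁ σ₂ w)) ∧
        (BilinearFractional.testT α p₁ p₂ q σ₁ σ₂ w +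
            BilinearFractional.testT₁ α p₁ p₂ q σ₁ σ₂ w +
            BilinearFractional.testT₂ α p₁ p₂ q σ₁ σ₂ w ≤
          C * BilinearFractional.strongConst α p₁ p₂ q σ₁ σ₂ w) ∧
        -- weak type
        ((∃ N : NNReal, BilinearFractional.WeakType α p₁ p₂ q σ₁ σ₂ w N) ↔
          BilinearFractional.testT₁ α p₁ p₂ q σ₁ σ₂ w < ∞ ∧
          BilinearFractional.testT₂ α p₁ p₂ q σ₁ σ₂ w < ∞) ∧
        (BilinearFractional.weakConst α p₁ p₂ q σ₁ σ₂ w ≤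
          C * (BilinearFractional.testT₁ α p₁ p₂ q σ₁ σ₂ w +
            BilinearFractional.testT₂ α p₁ p₂ q σ₁ σ₂ w)) ∧
        (BilinearFractional.testT₁ α p₁ p₂ q σ₁ σ₂ w +
            BilinearFractional.testT₂ α p₁ p₂ q σ₁ σ₂ w ≤
          C * BilinearFractional.weakConst α p₁ p₂ q σ₁ σ₂ w) := by
  open BilinearFractional in
  have hn : 0 < n := by
    rcases Nat.eq_zero_or_pos n with rfl | h
    · norm_num at hαn; linarith
    · exact h
  have hq : 1 < q := hp₁.trans_le hq₁
  have hpr₁ := Real.HolderConjugate.conjExponent hp₁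
  have hpr₂ := Real.HolderConjugate.conjExponent hp₂
  have hqq := Real.HolderConjugate.conjExponent hq
  have hp₁0 := hpr₁.pos
  have hp₂0 := hpr₂.pos
  have hq0 := hqq.pos
  -- The condition `p ≤ q` is the pairwise condition on the reciprocals of `p` and `q'`.
  have hinv : ∀ p : ℝ, 0 < p → p ≤ q → 1 ≤ 1 / p + 1 / q.conjExponent := by
    intro p hp0 hpq
    have h1 := hqq.inv_add_inv_eq_one
    have h2 := one_div_le_one_div_of_le hp0 hpq
    rw [one_div, one_div] at h2 ⊢
    linarith
  have h₁₂ : 1 ≤ 1 / p₁ + 1 / p₂ := by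
    rw [div_add_div _ _ hp₁0.ne' hp₂0.ne', le_div_iff₀ (by positivity)]
    linarith
  -- The final `1` pays for `T`, which indicators bound with constant `1`; it also keeps `K`
  -- positive, so that `K` passes through the infima defining the best constants.
  set K := strongUpper n α p₁ p₂ q.conjExponent + weakUpper n α p₁ p₂ q + 2 * dualConst n α q + 1
    with hK
  have hKt : K ≠ ∞ := by
    simp only [hK, ENNReal.add_ne_top]
    exact ⟨⟨⟨strongUpper_ne_top hαn hp₁ hp₂ hqq.symm.lt, weakUpper_ne_top hαn hp₁ hp₂ hq0.le⟩,
      ENNReal.mul_ne_top (by norm_num) (dualConst_ne_top hαn hq)⟩, by norm_num⟩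
  have hK1 : 1 ≤ K := le_add_self
  have hK0 : K ≠ 0 := (zero_lt_one.trans_le hK1).ne'
  have hKs : strongUpper n α p₁ p₂ q.conjExponent ≤ K := by
    rw [hK, add_assoc, add_assoc]; exact le_self_add
  have hKw : weakUpper n α p₁ p₂ q ≤ K :=
    (le_add_self.trans le_self_add).trans (le_self_add (b := (1 : ℝ≥0∞)))
  have hKd : 1 + 2 * dualConst n α q ≤ K := by
    rw [hK, add_assoc, add_comm (1 : ℝ≥0∞)]; exact le_add_self
  refine ⟨K.toNNReal, ENNReal.toNNReal_pos hK0 hKt, ?_⟩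
  intro σ₁ σ₂ w _ _ _
  rw [ENNReal.coe_toNNReal hKt]
  have hsuff : ∀ N : ℝ≥0, K * (testT α p₁ p₂ q σ₁ σ₂ w + testT₁ α p₁ p₂ q σ₁ σ₂ w +
      testT₂ α p₁ p₂ q σ₁ σ₂ w) ≤ N → StrongType α p₁ p₂ q σ₁ σ₂ w N := fun N hN =>
    strongType_of_testConst hn hαn hpr₁ hpr₂ hqq h₁₂ (hinv p₁ hp₁0 hq₁) (hinv p₂ hp₂0 hq₂) σ₁ σ₂ w
      ((mul_le_mul_left hKs _).trans hN)
  have hsuffw : ∀ N : ℝ≥0, K * (testT₁ α p₁ p₂ q σ₁ σ₂ w + testT₂ α p₁ p₂ q σ₁ σ₂ w) ≤ N →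
      WeakType α p₁ p₂ q σ₁ σ₂ w N := fun N hN =>
    weakType_of_testConst hn hαn hpr₁ hpr₂ hqq h₁₂ (hinv p₁ hp₁0 hq₁) (hinv p₂ hp₂0 hq₂) σ₁ σ₂ w
      ((mul_le_mul_left hKw _).trans hN)
  have hnec : ∀ N : ℝ≥0, StrongType α p₁ p₂ q σ₁ σ₂ w N → testT α p₁ p₂ q σ₁ σ₂ w +
      testT₁ α p₁ p₂ q σ₁ σ₂ w + testT₂ α p₁ p₂ q σ₁ σ₂ w ≤ K * N := by
    intro N hN
    refine le_trans ?_ (mul_le_mul_left hKd _)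
    rw [add_assoc, add_mul, one_mul]
    exact add_le_add (hN.testConst_le hp₁0 hp₂0 hq0)
      ((hN.nonnegWeak hp₁0 hp₂0 hq0).testConst_add_le hαn hpr₁ hpr₂ hqq)
  have hnecw : ∀ N : ℝ≥0, WeakType α p₁ p₂ q σ₁ σ₂ w N →
      testT₁ α p₁ p₂ q σ₁ σ₂ w + testT₂ α p₁ p₂ q σ₁ σ₂ w ≤ K * N := by
    intro N hN
    refine le_trans ?_ (mul_le_mul_left (le_add_self.trans hKd) _)
    exact (hN.nonnegWeak hp₁0 hp₂0).testConst_add_le hαn hpr₁ hpr₂ hqq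
  refine ⟨⟨?_, ?_⟩, ?_, ?_, ⟨?_, ?_⟩, ?_, ?_⟩
  · rintro ⟨N, hN⟩
    have := (hnec N hN).trans_lt (ENNReal.mul_lt_top hKt.lt_top ENNReal.coe_lt_top)
    simpa only [ENNReal.add_lt_top, and_assoc] using this
  · rintro ⟨h, h₁, h₂⟩
    have hS := ENNReal.mul_ne_top hKt (ENNReal.add_lt_top.2 ⟨ENNReal.add_lt_top.2 ⟨h, h₁⟩, h₂⟩).ne
    exact ⟨_, hsuff _ (ENNReal.coe_toNNReal hS).ge⟩
  · rcases eq_or_ne (K * (testT α p₁ p₂ q σ₁ σ₂ w + testT₁ α p₁ p₂ q σ₁ σ₂ w +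
      testT₂ α p₁ p₂ q σ₁ σ₂ w)) ∞ with hS | hS
    · rw [hS]; exact le_top
    · exact (iInf₂_le _ (hsuff _ (ENNReal.coe_toNNReal hS).ge)).trans (ENNReal.coe_toNNReal hS).le
  · simp only [strongConst, ENNReal.mul_iInf_of_ne hK0 hKt]
    exact le_iInf₂ hnec
  · rintro ⟨N, hN⟩
    have := (hnecw N hN).trans_lt (ENNReal.mul_lt_top hKt.lt_top ENNReal.coe_lt_top)
    simpa only [ENNReal.add_lt_top] using this
  · rintro ⟨h₁, h₂⟩
    have hS := ENNReal.mul_ne_top hKt (ENNReal.add_lt_top.2 ⟨h₁, h₂⟩).ne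
    exact ⟨_, hsuffw _ (ENNReal.coe_toNNReal hS).ge⟩
  · rcases eq_or_ne (K * (testT₁ α p₁ p₂ q σ₁ σ₂ w + testT₂ α p₁ p₂ q σ₁ σ₂ w)) ∞ with hS | hS
    · rw [hS]; exact le_top
    · exact (iInf₂_le _ (hsuffw _ (ENNReal.coe_toNNReal hS).ge)).trans (ENNReal.coe_toNNReal hS).le
  · simp only [weakConst, ENNReal.mul_iInf_of_ne hK0 hKt]
    exact le_iInf₂ hnecw
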